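/- Let $F=\mathbb C[t,t^{-1}]\otimes\Lambda(\xi_1,\xi_2,\xi_3,\eta_1,\eta_2,\eta_3)$ with its parity $p$, let $E=\sum_i(\xi_i\partial_{\xi_i}+\eta_i\partial_{\eta_i})$, and let $\mathfrak k^L(1|6)$ be the Lie superalgebra of contact vector fields $$K_f=(2-E)(f)\,\partial_t+\partial_t(f)\,E-(-1)^{p(f)}\sum_{i=1}^3\Big(\frac{\partial f}{\partial \xi_i}\frac{\partial}{\partial\eta_i}+\frac{\partial f}{\partial \eta_i}\frac{\partial}{\partial\xi_i}\Big),\qquad f\in F,$$ with the supercommutator as bracket; write $f$ for $K_f$. The standard $\mathbb Z$-grading $\mathfrak g=\bigoplus_d\mathfrak g_d$ of $\mathfrak g=\mathfrak k^L(1|6)$ is given by $\deg t=2$, $\deg\xi_i=\deg\eta_i=1$, $\deg K_f=\deg f-2$. Let $\mathfrak n_+\subset\mathfrak g_0$ be the span of the monomials of degree $0$ in $\mathfrak g$ whose weight (where $\xi_i$ has weight $\varepsilon_i$ and $\eta_i$ has weight $-\varepsilon_i$) is one of the positive roots $\varepsilon_i\pm\varepsilon_j$, $i<j$, of $\mathfrak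 o(6)$. Put $$X_1=\xi_1\eta_2,\quad X_2=\xi_2\eta_3,\quad X_3=\xi_2\xi_3,\quad X_0=t\eta_1,$$ $$\tilde X_1=\tfrac1t\xi_1\xi_3\eta_2\eta_3,\quad \tilde X_2=\tfrac1t\xi_1\xi_2\eta_1\eta_3,\quad \tilde X_3=\tfrac1t\xi_1\xi_2\xi_3\eta_1,\quad \tilde X_0=\eta_1\eta_2\eta_3 .$$ ($X_0,\tilde X_0$ are odd, the others even.) Let $\mathfrak N$ be the Lie subsuperalgebra of $\mathfrak k^L(1|6)$ generated by these eight elements. Then: (i) $\mathfrak N=\mathfrak n_+\oplus\mathfrak g_1'\oplus\bigoplus_{d\ge2}\mathfrak g_d$, where $\mathfrak g_1'\subset\mathfrak g_1$ is the subspace of codimension $2$ spanned by $\xi_2\eta_1\eta_2+\xi_3\eta_1\eta_3$ and all monomials of degree $1$ in $\mathfrak g$ other than $\xi_3\eta_1\eta_2$, $\xi_2\eta_1\eta_2$, $\xi_3\eta_1\eta_3$. (ii) The following are defining relations of $\mathfrak N$ for these generators. That is, they hold in $\mathfrak N$, and for any complex Lie superalgebra $M$ and any elements of $M$ of the same parities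 satisfying them, there is exactly one homomorphism of Lie superalgebras $\mathfrak N\to M$ that sends the generators to these elements: $$[X_2,X_3]=[X_2,X_0]=[X_3,X_0]=[X_0,X_0]=0;$$ $$(\mathrm{ad}X_1)^2X_2=(\mathrm{ad}X_1)^2X_3=(\mathrm{ad}X_1)^2X_0=(\mathrm{ad}X_2)^2X_1=(\mathrm{ad}X_3)^2X_1=0;$$ $$[X_1,\tilde X_0]=[X_1,\tilde X_1]=[X_2,\tilde X_0]=[X_2,\tilde X_2]=[X_2,\tilde X_3]=[X_3,\tilde X_2]=[X_3,\tilde X_3]=[X_0,\tilde X_0]=0,$$ $$[\tilde X_0,\tilde X_0]=[\tilde X_0,\tilde X_1]=[\tilde X_0,\tilde X_2]=[\tilde X_1,\tilde X_2]=[\tilde X_1,\tilde X_3]=[\tilde X_2,\tilde X_3]=0;$$ $$[X_2,\tilde X_1]+[X_1,\tilde X_2]=0,\qquad [X_3,\tilde X_1]+[X_1,\tilde X_3]=0;\qquad (\mathrm{ad}X_3)^2\tilde X_0-2[X_0,\tilde X_3]=0;$$ $$[\tilde X_0,[X_0,\tilde X_3]]=[\tilde X_1,[X_1,X_2]]=[\tilde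 X_1,[X_1,X_3]]=[\tilde X_1,[X_1,X_0]]=0,$$ $$[\tilde X_2,[X_1,X_2]]=[\tilde X_3,[X_1,X_3]]=[\tilde X_3,[X_3,\tilde X_0]]=[\tilde X_3,[X_0,\tilde X_2]]=0;$$ $$(\mathrm{ad}\tilde X_1)^2X_0=(\mathrm{ad}\tilde X_2)^2X_0=(\mathrm{ad}\tilde X_3)^2X_0=(\mathrm{ad}\tilde X_3)^2\tilde X_0=0;$$ $$[[X_1,X_2],[X_3,\tilde X_0]]+2[\tilde X_2,[X_0,\tilde X_1]]+[X_0,[X_1,\tilde X_2]]+[\tilde X_2,[X_1,X_0]]=0;$$ $$[[X_1,X_2],[X_0,\tilde X_2]]=[[X_1,X_3],[X_0,\tilde X_3]]=[[X_1,\tilde X_2],[X_0,\tilde X_2]]=[[X_1,\tilde X_3],[X_0,\tilde X_3]]=0;$$ $$[[X_1,\tilde X_2],[X_3,\tilde X_0]]-[\tilde X_2,[X_0,\tilde X_1]]=0,\qquad [[X_0,\tilde X_3],[\tilde X_2,[X_0,\tilde X_1]]]=0;$$ $$[[X_0,\tilde X_3],[\tilde X_2,[X_1,X_0]]]+[[X_0,\tilde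 X_3],[X_0,[X_1,\tilde X_2]]]=0;$$ $$2[[X_1,\tilde X_2],[X_0,\tilde X_3]]+2[\tilde X_3,[X_0,[X_1,X_2]]]+[[X_1,X_3],[X_0,\tilde X_2]]-[[X_1,X_2],[X_0,\tilde X_3]]=0;$$ $$2[[X_1,\tilde X_3],[X_0,\tilde X_2]]-2[\tilde X_3,[X_0,[X_1,X_2]]]+[[X_1,X_2],[X_0,\tilde X_3]]-[[X_1,X_3],[X_0,\tilde X_2]]=0.$$ -/

import Mathlib

universe u v

noncomputable section

namespace StringyContact

/-! ### Lie superalgebras over the complex numbers -/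

/-- The Koszul sign `(-1) ^ (i j)` of two parities. -/
def koszul (i j : ZMod 2) : ℂ := if i = 1 ∧ j = 1 then -1 else 1

/-- A complex Lie superalgebra: a space `V = V₀ ⊕ V₁` with an even bilinear bracket which is
super-antisymmetric and satisfies the super Jacobi identity on homogeneous elements. -/
class LieSuperalgebra (V : Type u) [AddCommGroup V] [Module ℂ V] where
  part : ZMod 2 → Submodule ℂ V
  isCompl : IsCompl (part 0) (part 1)
  bracket : V →ₗ[ℂ] V →ₗ[ℂ] V
  bracket_mem : ∀ {i j : ZMod 2} {x y : V}, x ∈ part i → y ∈ part j →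
    bracket x y ∈ part (i + j)
  bracket_skew : ∀ {i j : ZMod 2} {x y : V}, x ∈ part i → y ∈ part j →
    bracket x y = -(koszul i j • bracket y x)
  jacobi : ∀ {i j k : ZMod 2} {x y z : V}, x ∈ part i → y ∈ part j → z ∈ part k →
    bracket x (bracket y z) = bracket (bracket x y) z + koszul i j • bracket y (bracket x z)

notation "⁅" x "," y "⁆ₛ" => LieSuperalgebra.bracket x y

/-- Homomorphisms of Lie superalgebras: even linear maps that preserve brackets. -/
structure LieSuperHom (L : Type u) (M : Type v) [AddCommGroup L] [Module ℂ L]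
    [LieSuperalgebra L] [AddCommGroup M] [Module ℂ M] [LieSuperalgebra M] where
  toLinearMap : L →ₗ[ℂ] M
  map_part : ∀ (i : ZMod 2) (x : L), x ∈ LieSuperalgebra.part i →
    toLinearMap x ∈ LieSuperalgebra.part i
  map_bracket : ∀ x y : L, toLinearMap ⁅x, y⁆ₛ = ⁅toLinearMap x, toLinearMap y⁆ₛ

section Supercommutator

variable {A : Type u} [Ring A] [Algebra ℂ A]

/-- Elements of parity `i` with respect to an involution `s`. -/
def invPart (s : A) (i : ZMod 2) : Submodule ℂ A where
  carrier := {F | F * s = koszul i 1 • (s * F)}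
  add_mem' := by
    intro a b ha hb
    simp only [Set.mem_ofPred_eq] at *
    rw [add_mul, mul_add, smul_add, ha, hb]
  zero_mem' := by simp
  smul_mem' := by
    intro c a ha
    simp only [Set.mem_ofPred_eq] at *
    rw [smul_mul_assoc, ha, mul_smul_comm, smul_comm]

/-- The odd component of `F` with respect to an involution `s`. -/
def oddPart (s : A) : A →ₗ[ℂ] A :=
  (2⁻¹ : ℂ) • (LinearMap.id - (LinearMap.mulRight ℂ s).comp (LinearMap.mulLeft ℂ s))

/-- The supercommutator; on elements of parities `i`, `j` it is `F G - (-1) ^ (i j) G F`. -/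
def superComm (s : A) : A →ₗ[ℂ] A →ₗ[ℂ] A :=
  LinearMap.mul ℂ A - (LinearMap.mul ℂ A).flip +
    (2 : ℂ) • ((LinearMap.mul ℂ A).flip.compl₁₂ (oddPart s) (oddPart s))

theorem zmod2_cases (i : ZMod 2) : i = 0 ∨ i = 1 := by
  revert i; decide

theorem oddPart_of_mem {s : A} (hs : s * s = 1) {i : ZMod 2} {F : A} (hF : F ∈ invPart s i) :
    oddPart s F = if i = 1 then F else 0 := by
  have h : F * s = koszul i 1 • (s * F) := hF
  have h' : s * F * s = koszul i 1 • F := by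
    rw [mul_assoc, h, mul_smul_comm, ← mul_assoc, hs, one_mul]
  have : oddPart s F = (2⁻¹ : ℂ) • (F - s * F * s) := rfl
  rw [this, h']
  rcases zmod2_cases i with rfl | rfl
  · simp [koszul]
  · simp only [koszul, and_self, if_true, neg_smul, one_smul, sub_neg_eq_add]
    rw [← two_smul ℂ F, smul_smul]; norm_num

theorem superComm_of_mem {s : A} (hs : s * s = 1) {i j : ZMod 2} {F G : A}
    (hF : F ∈ invPart s i) (hG : G ∈ invPart s j) :
    superComm s F G = F * G - koszul i j • (G * F) := by
  have : superComm s F G = F * G - G * F + (2 : ℂ) • (oddPart s G * oddPart s F) := rfl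
  rw [this, oddPart_of_mem hs hF, oddPart_of_mem hs hG]
  rcases zmod2_cases i with rfl | rfl <;> rcases zmod2_cases j with rfl | rfl <;>
    simp [koszul, two_smul]

theorem koszul_add_left (i j k : ZMod 2) : koszul (i + j) k = koszul i k * koszul j k := by
  have h : (1 : ZMod 2) + 1 = 0 := by decide
  rcases zmod2_cases i with rfl | rfl <;> rcases zmod2_cases j with rfl | rfl <;>
    rcases zmod2_cases k with rfl | rfl <;> simp [koszul, h]

theorem koszul_comm (i j : ZMod 2) : koszul i j = koszul j i := by
  simp [koszul, and_comm]

theorem koszul_mul_self (i j : ZMod 2) : koszul i j * koszul i j = 1 := by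
  unfold koszul; split_ifs <;> norm_num

theorem mul_mem_invPart {s : A} {i j : ZMod 2} {F G : A}
    (hF : F ∈ invPart s i) (hG : G ∈ invPart s j) : F * G ∈ invPart s (i + j) := by
  have h1 : F * s = koszul i 1 • (s * F) := hF
  have h2 : G * s = koszul j 1 • (s * G) := hG
  show F * G * s = koszul (i + j) 1 • (s * (F * G))
  rw [mul_assoc, h2, mul_smul_comm, ← mul_assoc, h1, smul_mul_assoc, smul_smul, koszul_add_left,
    mul_comm, mul_assoc]

theorem superComm_mem {s : A} (hs : s * s = 1) {i j : ZMod 2} {F G : A}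
    (hF : F ∈ invPart s i) (hG : G ∈ invPart s j) : superComm s F G ∈ invPart s (i + j) := by
  rw [superComm_of_mem hs hF hG]
  refine Submodule.sub_mem _ (mul_mem_invPart hF hG) (Submodule.smul_mem _ _ ?_)
  rw [add_comm]; exact mul_mem_invPart hG hF

/-- An associative algebra with an involution `s` in it is a Lie superalgebra under the
supercommutator; the parity of `F` is read off from `s F s = ± F`. -/
@[reducible] def superCommLie (s : A) (hs : s * s = 1) : LieSuperalgebra A where
  part := invPart s
  isCompl := by
    have key : ∀ F : A, s * F * s * s = s * F := fun F => by rw [mul_assoc, hs, mul_one]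
    have key' : ∀ F : A, s * (s * F * s) = F * s := fun F => by
      rw [← mul_assoc, ← mul_assoc, hs, one_mul]
    constructor
    · rw [Submodule.disjoint_def]
      intro F h0 h1
      have a := oddPart_of_mem hs h0
      have b := oddPart_of_mem hs h1
      simp only [zero_ne_one, if_false, if_true] at a b
      rw [← b, a]
    · rw [codisjoint_iff, Submodule.eq_top_iff']
      intro F
      rw [Submodule.mem_sup]
      refine ⟨(2⁻¹ : ℂ) • (F + s * F * s), ?_, (2⁻¹ : ℂ) • (F - s * F * s), ?_, ?_⟩
      · refine Submodule.smul_mem _ _ ?_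
        show (F + s * F * s) * s = koszul 0 1 • (s * (F + s * F * s))
        rw [add_mul, mul_add, key, key']
        simp [koszul, add_comm]
      · refine Submodule.smul_mem _ _ ?_
        show (F - s * F * s) * s = koszul 1 1 • (s * (F - s * F * s))
        rw [sub_mul, mul_sub, key, key']
        simp [koszul]
      · rw [← smul_add, add_add_sub_cancel, ← two_smul ℂ F, smul_smul]; norm_num
  bracket := superComm s
  bracket_mem := fun hx hy => superComm_mem hs hx hy
  bracket_skew := by
    intro i j x y hx hy
    rw [superComm_of_mem hs hx hy, superComm_of_mem hs hy hx, koszul_comm j i, smul_sub, smul_smul,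
      koszul_mul_self, one_smul, neg_sub]
  jacobi := by
    intro i j k x y z hx hy hz
    rw [superComm_of_mem hs hy hz, superComm_of_mem hs hx hy, superComm_of_mem hs hx hz]
    have hyz : y * z - koszul j k • (z * y) ∈ invPart s (j + k) := by
      rw [← superComm_of_mem hs hy hz]; exact superComm_mem hs hy hz
    have hxy : x * y - koszul i j • (y * x) ∈ invPart s (i + j) := by
      rw [← superComm_of_mem hs hx hy]; exact superComm_mem hs hx hy
    have hxz : x * z - koszul i k • (z * x) ∈ invPart s (i + k) := by
      rw [← superComm_of_mem hs hx hz]; exact superComm_mem hs hx hz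
    rw [superComm_of_mem hs hx hyz, superComm_of_mem hs hxy hz, superComm_of_mem hs hy hxz]
    have h : (1 : ZMod 2) + 1 = 0 := by decide
    rcases zmod2_cases i with rfl | rfl <;> rcases zmod2_cases j with rfl | rfl <;>
      rcases zmod2_cases k with rfl | rfl <;> simp [koszul, h] <;> noncomm_ring

end Supercommutator

section Generated

variable {V : Type u} [AddCommGroup V] [Module ℂ V] [LieSuperalgebra V]

/-- The subspace generated by a set under linear combinations and brackets. -/
def lieSpan (s : Set V) : Submodule ℂ V :=
  sInf {W | s ⊆ W ∧ ∀ x ∈ W, ∀ y ∈ W, ⁅x, y⁆ₛ ∈ W}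

theorem subset_lieSpan (s : Set V) : s ⊆ lieSpan s := by
  intro x hx
  simp only [lieSpan, SetLike.mem_coe, Submodule.mem_sInf]
  exact fun W hW => hW.1 hx

theorem bracket_mem_lieSpan {s : Set V} {x y : V} (hx : x ∈ lieSpan s) (hy : y ∈ lieSpan s) :
    ⁅x, y⁆ₛ ∈ lieSpan s := by
  simp only [lieSpan, Submodule.mem_sInf] at *
  exact fun W hW => hW.2 x (hx W hW) y (hy W hW)

/-- The Lie superalgebra generated by homogeneous elements. -/
@[reducible] def lieSpanLie (s : Set V) (hs : ∀ x ∈ s, ∃ i : ZMod 2, x ∈ LieSuperalgebra.part i) :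
    LieSuperalgebra (lieSpan s) where
  part := fun i => (LieSuperalgebra.part i).comap (lieSpan s).subtype
  isCompl := by
    have hd := (LieSuperalgebra.isCompl (V := V))
    constructor
    · rw [Submodule.disjoint_def]
      intro x h0 h1
      exact Subtype.ext (Submodule.disjoint_def.1 hd.1 x.1 h0 h1)
    · rw [codisjoint_iff, Submodule.eq_top_iff']
      rintro ⟨x, hx⟩
      let W : ZMod 2 → Submodule ℂ V := fun i => lieSpan s ⊓ LieSuperalgebra.part i
      have hW : ∀ i x, x ∈ W i → x ∈ W 0 ⊔ W 1 := by
        intro i x hx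
        rcases zmod2_cases i with rfl | rfl
        · exact Submodule.mem_sup_left hx
        · exact Submodule.mem_sup_right hx
      have hb : ∀ i j x y, x ∈ W i → y ∈ W j → ⁅x, y⁆ₛ ∈ W 0 ⊔ W 1 := fun i j x y hx hy =>
        hW (i + j) _ ⟨bracket_mem_lieSpan hx.1 hy.1, LieSuperalgebra.bracket_mem hx.2 hy.2⟩
      have hle : lieSpan s ≤ W 0 ⊔ W 1 := by
        refine sInf_le ⟨fun y hy => ?_, fun y hy z hz => ?_⟩
        · obtain ⟨i, hi⟩ := hs y hy
          exact hW i y ⟨subset_lieSpan s hy, hi⟩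
        · obtain ⟨y0, hy0, y1, hy1, rfl⟩ := Submodule.mem_sup.1 hy
          obtain ⟨z0, hz0, z1, hz1, rfl⟩ := Submodule.mem_sup.1 hz
          simp only [map_add, LinearMap.add_apply]
          exact add_mem (add_mem (hb _ _ _ _ hy0 hz0) (hb _ _ _ _ hy1 hz0))
            (add_mem (hb _ _ _ _ hy0 hz1) (hb _ _ _ _ hy1 hz1))
      obtain ⟨y, hy, z, hz, hyz⟩ := Submodule.mem_sup.1 (hle hx)
      exact Submodule.mem_sup.2 ⟨⟨y, hy.1⟩, hy.2, ⟨z, hz.1⟩, hz.2, Subtype.ext hyz⟩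
  bracket := LinearMap.mk₂ ℂ (fun x y => ⟨⁅x.1, y.1⁆ₛ, bracket_mem_lieSpan x.2 y.2⟩)
    (by intros; ext; simp) (by intros; ext; simp) (by intros; ext; simp) (by intros; ext; simp)
  bracket_mem := fun hx hy => LieSuperalgebra.bracket_mem (V := V) hx hy
  bracket_skew := fun hx hy => Subtype.ext (LieSuperalgebra.bracket_skew (V := V) hx hy)
  jacobi := fun hx hy hz => Subtype.ext (LieSuperalgebra.jacobi (V := V) hx hy hz)

end Generated

/-! ### Functions on the `1|6`-dimensional supercircle and contact vector fields -/

/-- `ℂ[t, t⁻¹] ⊗ Λ(ξ₁, ξ₂, ξ₃, η₁, η₂, η₃)` in its monomial basis: `(n, S)` stands for `t ^ n`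
times the product, in increasing order, of the odd coordinates with index in `S`, where the odd
coordinates `ξ₁, ξ₂, ξ₃, η₁, η₂, η₃` have the indices `0, 1, 2, 3, 4, 5`. -/
def Fn : Type := (ℤ × Finset (Fin 6)) →₀ ℂ

instance : AddCommGroup Fn := inferInstanceAs (AddCommGroup ((ℤ × Finset (Fin 6)) →₀ ℂ))

instance : Module ℂ Fn := inferInstanceAs (Module ℂ ((ℤ × Finset (Fin 6)) →₀ ℂ))

/-- The index of the odd coordinate `ξ`, numbered from `0`. -/
def xi (k : Fin 3) : Fin 6 := Fin.castAdd 3 k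

/-- The index of the odd coordinate `η`, numbered from `0`. -/
def eta (k : Fin 3) : Fin 6 := Fin.natAdd 3 k

/-- The monomial with exponent `n` of `t` and odd coordinates in `S`. -/
def mono (n : ℤ) (S : Finset (Fin 6)) : Fn :=
  (Finsupp.single (n, S) 1 : (ℤ × Finset (Fin 6)) →₀ ℂ)

/-- Linear extension from monomials. -/
def ofMono {V : Type} [AddCommGroup V] [Module ℂ V] (F : ℤ → Finset (Fin 6) → V) : Fn →ₗ[ℂ] V :=
  (Finsupp.linearCombination ℂ fun p => F p.1 p.2 : ((ℤ × Finset (Fin 6)) →₀ ℂ) →ₗ[ℂ] V)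

theorem ofMono_mono {V : Type} [AddCommGroup V] [Module ℂ V] (F : ℤ → Finset (Fin 6) → V)
    (n : ℤ) (S : Finset (Fin 6)) : ofMono F (mono n S) = F n S := by
  have h := Finsupp.linearCombination_single ℂ (v := fun p : ℤ × Finset (Fin 6) => F p.1 p.2) 1 (n, S)
  rw [one_smul] at h
  exact h

theorem Fn.hom_ext {V : Type} [AddCommGroup V] [Module ℂ V] {f g : Fn →ₗ[ℂ] V}
    (h : ∀ n S, f (mono n S) = g (mono n S)) : f = g :=
  Finsupp.lhom_ext' (M := ℂ) (R := ℂ) fun p => LinearMap.ext_ring (h p.1 p.2)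

/-- The supercommutative product. -/
def mulFn : Fn →ₗ[ℂ] Fn →ₗ[ℂ] Fn :=
  ofMono fun n S => ofMono fun m T =>
    if Disjoint S T then
      (-1 : ℂ) ^ (((S ×ˢ T).filter fun q => q.2 < q.1).card) • mono (n + m) (S ∪ T)
    else 0

/-- `∂ / ∂t`. -/
def dt : Fn →ₗ[ℂ] Fn := ofMono fun n S => (n : ℂ) • mono (n - 1) S

/-- The (left) derivative with respect to the odd coordinate of index `i`. -/
def dOdd (i : Fin 6) : Fn →ₗ[ℂ] Fn := ofMono fun n S =>
  if i ∈ S then (-1 : ℂ) ^ ((S.filter fun j => j < i).card) • mono n (S.erase i) else 0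

/-- The Euler operator of the odd coordinates, `∑ (ξ ∂/∂ξ + η ∂/∂η)`. -/
def euler : Fn →ₗ[ℂ] Fn := ofMono fun n S => (S.card : ℂ) • mono n S

/-- The parity operator `f ↦ (-1) ^ p(f) f`. -/
def parityOp : Module.End ℂ Fn := ofMono fun n S => (-1 : ℂ) ^ S.card • mono n S

/-- The contact vector field
`K_f = (2 - E)(f) ∂_t + ∂_t(f) E - (-1) ^ p(f) ∑ (∂f/∂ξᵢ ∂/∂ηᵢ + ∂f/∂ηᵢ ∂/∂ξᵢ)`. -/
def contactField : Fn →ₗ[ℂ] Module.End ℂ Fn where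
  toFun f := mulFn ((2 : ℂ) • f - euler f) ∘ₗ dt + mulFn (dt f) ∘ₗ euler
    - ∑ k : Fin 3, (mulFn (dOdd (xi k) (parityOp f)) ∘ₗ dOdd (eta k)
        + mulFn (dOdd (eta k) (parityOp f)) ∘ₗ dOdd (xi k))
  map_add' f g := by
    simp only [Fin.sum_univ_three, map_add, smul_add, map_sub, LinearMap.add_comp,
      LinearMap.sub_comp]
    abel
  map_smul' c f := by
    simp only [Fin.sum_univ_three, map_smul, smul_comm (2 : ℂ) c, ← smul_sub, LinearMap.smul_comp,
      RingHom.id_apply, ← smul_add]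

theorem parityOp_mul_self : parityOp * parityOp = 1 := by
  refine Fn.hom_ext fun n S => ?_
  have h : ((-1 : ℂ) ^ S.card) * (-1) ^ S.card = 1 := by
    rw [← mul_pow]; norm_num
  simp only [Module.End.mul_apply, parityOp, ofMono_mono, map_smul, smul_smul, h, one_smul,
    Module.End.one_apply]

/-- Linear operators on functions, with the supercommutator. -/
instance : LieSuperalgebra (Module.End ℂ Fn) := superCommLie parityOp parityOp_mul_self

theorem parityOp_mono (n : ℤ) (S : Finset (Fin 6)) :
    parityOp (mono n S) = (-1 : ℂ) ^ S.card • mono n S := by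
  simp only [parityOp, ofMono_mono]

theorem koszul_cast_one (a : ℕ) : koszul (a : ZMod 2) 1 = (-1) ^ a := by
  induction a with
  | zero => simp [koszul]
  | succ a ih => rw [Nat.cast_succ, koszul_add_left, ih, pow_succ]; simp [koszul]

theorem mem_invPart_of_mono {D : Module.End ℂ Fn} {i : ZMod 2}
    (h : ∀ n S, D (parityOp (mono n S)) = koszul i 1 • parityOp (D (mono n S))) :
    D ∈ invPart parityOp i := by
  show D * parityOp = koszul i 1 • (parityOp * D)
  exact Fn.hom_ext h

theorem dt_mem : dt ∈ invPart parityOp 0 := by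
  refine mem_invPart_of_mono fun n S => ?_
  have h : koszul 0 1 = 1 := by simp [koszul]
  simp only [parityOp_mono, map_smul, dt, ofMono_mono, h, one_smul]
  exact smul_comm _ _ _

theorem euler_mem : euler ∈ invPart parityOp 0 := by
  refine mem_invPart_of_mono fun n S => ?_
  have h : koszul 0 1 = 1 := by simp [koszul]
  simp only [parityOp_mono, map_smul, euler, ofMono_mono, h, one_smul]
  exact smul_comm _ _ _

theorem dOdd_mem (i : Fin 6) : dOdd i ∈ invPart parityOp 1 := by
  refine mem_invPart_of_mono fun n S => ?_
  simp only [parityOp_mono, map_smul, dOdd, ofMono_mono]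
  split_ifs with h
  · rw [map_smul, parityOp_mono, smul_comm, smul_comm (koszul 1 1), ← Finset.card_erase_add_one h,
      smul_smul (koszul 1 1)]
    simp [koszul, pow_succ]
  · simp

theorem mulFn_mem (n : ℤ) (S : Finset (Fin 6)) :
    mulFn (mono n S) ∈ invPart parityOp (S.card : ZMod 2) := by
  refine mem_invPart_of_mono fun m T => ?_
  have h : mulFn (mono n S) (mono m T) = if Disjoint S T then
      (-1 : ℂ) ^ (((S ×ˢ T).filter fun q => q.2 < q.1).card) • mono (n + m) (S ∪ T) else 0 := by
    simp only [mulFn, ofMono_mono]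
  rw [parityOp_mono, map_smul, h, koszul_cast_one]
  split_ifs with hd
  · have h1 : ((-1 : ℂ) ^ S.card) * (-1) ^ S.card = 1 := by
      rw [← mul_pow]; norm_num
    rw [map_smul, parityOp_mono, Finset.card_union_of_disjoint hd, pow_add, smul_comm,
      smul_comm ((-1 : ℂ) ^ S.card), smul_smul ((-1 : ℂ) ^ S.card), ← mul_assoc, h1, one_mul]
  · simp

/-- A contact field has the parity of its generating function. -/
theorem contactField_mem (n : ℤ) (S : Finset (Fin 6)) :
    contactField (mono n S) ∈ invPart parityOp (S.card : ZMod 2) := by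
  have key : ∀ (i j : Fin 6), mulFn (dOdd i (parityOp (mono n S))) ∘ₗ dOdd j ∈
      invPart parityOp (S.card : ZMod 2) := by
    intro i j
    simp only [parityOp_mono, map_smul, dOdd, ofMono_mono]
    split_ifs with h
    · rw [map_smul, LinearMap.smul_comp, LinearMap.smul_comp]
      refine Submodule.smul_mem _ _ (Submodule.smul_mem _ _ ?_)
      rw [← Finset.card_erase_add_one h, Nat.cast_succ]
      exact mul_mem_invPart (mulFn_mem _ _) (dOdd_mem j)
    · simp
  have h1 : mulFn ((2 : ℂ) • mono n S - euler (mono n S)) ∘ₗ dt ∈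
      invPart parityOp (S.card : ZMod 2) := by
    rw [← add_zero (S.card : ZMod 2)]
    refine mul_mem_invPart ?_ dt_mem
    simp only [euler, ofMono_mono, map_sub, map_smul]
    exact sub_mem (Submodule.smul_mem _ _ (mulFn_mem _ _)) (Submodule.smul_mem _ _ (mulFn_mem _ _))
  have h2 : mulFn (dt (mono n S)) ∘ₗ euler ∈ invPart parityOp (S.card : ZMod 2) := by
    rw [← add_zero (S.card : ZMod 2)]
    refine mul_mem_invPart ?_ euler_mem
    simp only [dt, ofMono_mono, map_smul]
    exact Submodule.smul_mem _ _ (mulFn_mem _ _)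
  exact sub_mem (add_mem h1 h2) (Submodule.sum_mem _ fun k _ => add_mem (key _ _) (key _ _))

/-- The stringy contact superalgebra `k^L(1|6)`: all contact vector fields with Laurent
coefficients, inside the linear operators on functions with the supercommutator. -/
def kL : Submodule ℂ (Module.End ℂ Fn) := LinearMap.range contactField

/-- The component of degree `d` of `k^L(1|6)` in the standard grading: `deg t = 2`,
`deg ξ = deg η = 1`, and `deg K_f = deg f - 2`. -/
def kLGrade (d : ℤ) : Submodule ℂ (Module.End ℂ Fn) :=
  (Submodule.span ℂ {f : Fn | ∃ n S, 2 * n + (S.card : ℤ) - 2 = d ∧ f = mono n S}).map contactField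

theorem kLGrade_le (d : ℤ) : kLGrade d ≤ kL := by
  rintro _ ⟨f, -, rfl⟩
  exact ⟨f, rfl⟩

/-- The weight of a monomial with odd coordinates in `S` with respect to the Cartan subalgebra
spanned by the `ξₖ ηₖ`, in the basis in which `ξₖ` has weight `εₖ` and `ηₖ` has weight `-εₖ`. -/
def weight (S : Finset (Fin 6)) (k : Fin 3) : ℤ :=
  (if xi k ∈ S then 1 else 0) - (if eta k ∈ S then 1 else 0)

/-- The maximal nilpotent subalgebra of the component of degree zero: the span of the contact
fields of degree zero whose weight is a positive root of `o(6)`, i.e. has a positive first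
nonzero coordinate. -/
def nPlus : Submodule ℂ (Module.End ℂ Fn) :=
  (Submodule.span ℂ {f : Fn | ∃ n S, 2 * n + (S.card : ℤ) - 2 = 0 ∧
    toLex (0 : Fin 3 → ℤ) < toLex (weight S) ∧ f = mono n S}).map contactField

/-- The subspace of codimension two of the component of degree one that is spanned by
`ξ₂ η₁ η₂ + ξ₃ η₁ η₃` and by all monomials of degree one other than `ξ₃ η₁ η₂`, `ξ₂ η₁ η₂`,
`ξ₃ η₁ η₃`. -/
def gOneSub : Submodule ℂ (Module.End ℂ Fn) :=
  (Submodule.span ℂ ({f : Fn | ∃ n S, 2 * n + (S.card : ℤ) - 2 = 1 ∧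
      S ≠ {xi 2, eta 0, eta 1} ∧ S ≠ {xi 1, eta 0, eta 1} ∧ S ≠ {xi 2, eta 0, eta 2} ∧
      f = mono n S} ∪
    {mono 0 {xi 1, eta 0, eta 1} + mono 0 {xi 2, eta 0, eta 2}})).map contactField

/-! ### The generators and the relations -/

/-- `X₀ = t η₁`, `X₁ = ξ₁ η₂`, `X₂ = ξ₂ η₃`, `X₃ = ξ₂ ξ₃`. -/
def genX : Fin 4 → Module.End ℂ Fn :=
  ![contactField (mono 1 {eta 0}), contactField (mono 0 {xi 0, eta 1}),
    contactField (mono 0 {xi 1, eta 2}), contactField (mono 0 {xi 1, xi 2})]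

/-- `X̃₀ = η₁ η₂ η₃`, `X̃₁ = t⁻¹ ξ₁ ξ₃ η₂ η₃`, `X̃₂ = t⁻¹ ξ₁ ξ₂ η₁ η₃`,
`X̃₃ = t⁻¹ ξ₁ ξ₂ ξ₃ η₁`. -/
def genY : Fin 4 → Module.End ℂ Fn :=
  ![contactField (mono 0 {eta 0, eta 1, eta 2}),
    contactField (mono (-1) {xi 0, xi 2, eta 1, eta 2}),
    contactField (mono (-1) {xi 0, xi 1, eta 0, eta 2}),
    contactField (mono (-1) {xi 0, xi 1, xi 2, eta 0})]

/-- The parities of the generators: `X₀` and `X̃₀` are odd, the others are even. -/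
def genParity : Fin 4 → ZMod 2 := ![1, 0, 0, 0]

theorem genX_mem (i : Fin 4) :
    genX i ∈ LieSuperalgebra.part (V := Module.End ℂ Fn) (genParity i) := by
  fin_cases i
  · exact contactField_mem 1 {eta 0}
  · exact contactField_mem 0 {xi 0, eta 1}
  · exact contactField_mem 0 {xi 1, eta 2}
  · exact contactField_mem 0 {xi 1, xi 2}

theorem genY_mem (i : Fin 4) :
    genY i ∈ LieSuperalgebra.part (V := Module.End ℂ Fn) (genParity i) := by
  fin_cases i
  · exact contactField_mem 0 {eta 0, eta 1, eta 2}
  · exact contactField_mem (-1) {xi 0, xi 2, eta 1, eta 2}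
  · exact contactField_mem (-1) {xi 0, xi 1, eta 0, eta 2}
  · exact contactField_mem (-1) {xi 0, xi 1, xi 2, eta 0}

/-- The positive part of `k^L(1|6)` generated by the `Xᵢ` and the `X̃ᵢ`. -/
def kLPos : Submodule ℂ (Module.End ℂ Fn) := lieSpan (Set.range genX ∪ Set.range genY)

instance : LieSuperalgebra kLPos := lieSpanLie _ <| by
  rintro _ (⟨i, rfl⟩ | ⟨i, rfl⟩)
  · exact ⟨_, genX_mem i⟩
  · exact ⟨_, genY_mem i⟩

/-- The generators `Xᵢ` as elements of the algebra that they generate with the `X̃ᵢ`. -/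
def posX (i : Fin 4) : kLPos := ⟨genX i, subset_lieSpan _ (Or.inl ⟨i, rfl⟩)⟩

/-- The generators `X̃ᵢ` as elements of the algebra that they generate with the `Xᵢ`. -/
def posY (i : Fin 4) : kLPos := ⟨genY i, subset_lieSpan _ (Or.inr ⟨i, rfl⟩)⟩

/-- The defining relations, for elements `X i` and `Y i` (standing for `X̃ᵢ`) of any Lie
superalgebra. -/
def Relations {M : Type v} [AddCommGroup M] [Module ℂ M] [LieSuperalgebra M]
    (X Y : Fin 4 → M) : Prop :=
  (⁅X 2, X 3⁆ₛ = 0 ∧ ⁅X 2, X 0⁆ₛ = 0 ∧ ⁅X 3, X 0⁆ₛ = 0 ∧ ⁅X 0, X 0⁆ₛ = 0) ∧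
  (⁅X 1, ⁅X 1, X 2⁆ₛ⁆ₛ = 0 ∧ ⁅X 1, ⁅X 1, X 3⁆ₛ⁆ₛ = 0 ∧ ⁅X 1, ⁅X 1, X 0⁆ₛ⁆ₛ = 0 ∧
    ⁅X 2, ⁅X 2, X 1⁆ₛ⁆ₛ = 0 ∧ ⁅X 3, ⁅X 3, X 1⁆ₛ⁆ₛ = 0) ∧
  (⁅X 1, Y 0⁆ₛ = 0 ∧ ⁅X 1, Y 1⁆ₛ = 0 ∧ ⁅X 2, Y 0⁆ₛ = 0 ∧ ⁅X 2, Y 2⁆ₛ = 0 ∧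
    ⁅X 2, Y 3⁆ₛ = 0 ∧ ⁅X 3, Y 2⁆ₛ = 0 ∧ ⁅X 3, Y 3⁆ₛ = 0 ∧ ⁅X 0, Y 0⁆ₛ = 0 ∧
    ⁅Y 0, Y 0⁆ₛ = 0 ∧ ⁅Y 0, Y 1⁆ₛ = 0 ∧ ⁅Y 0, Y 2⁆ₛ = 0 ∧
    ⁅Y 1, Y 2⁆ₛ = 0 ∧ ⁅Y 1, Y 3⁆ₛ = 0 ∧ ⁅Y 2, Y 3⁆ₛ = 0) ∧
  (⁅X 2, Y 1⁆ₛ + ⁅X 1, Y 2⁆ₛ = 0 ∧ ⁅X 3, Y 1⁆ₛ + ⁅X 1, Y 3⁆ₛ = 0) ∧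
  (⁅X 3, ⁅X 3, Y 0⁆ₛ⁆ₛ - (2 : ℂ) • ⁅X 0, Y 3⁆ₛ = 0) ∧
  (⁅Y 0, ⁅X 0, Y 3⁆ₛ⁆ₛ = 0 ∧ ⁅Y 1, ⁅X 1, X 2⁆ₛ⁆ₛ = 0 ∧ ⁅Y 1, ⁅X 1, X 3⁆ₛ⁆ₛ = 0 ∧
    ⁅Y 1, ⁅X 1, X 0⁆ₛ⁆ₛ = 0 ∧ ⁅Y 2, ⁅X 1, X 2⁆ₛ⁆ₛ = 0 ∧ ⁅Y 3, ⁅X 1, X 3⁆ₛ⁆ₛ = 0 ∧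
    ⁅Y 3, ⁅X 3, Y 0⁆ₛ⁆ₛ = 0 ∧ ⁅Y 3, ⁅X 0, Y 2⁆ₛ⁆ₛ = 0) ∧
  (⁅Y 1, ⁅Y 1, X 0⁆ₛ⁆ₛ = 0 ∧ ⁅Y 2, ⁅Y 2, X 0⁆ₛ⁆ₛ = 0 ∧ ⁅Y 3, ⁅Y 3, X 0⁆ₛ⁆ₛ = 0 ∧
    ⁅Y 3, ⁅Y 3, Y 0⁆ₛ⁆ₛ = 0) ∧
  (⁅⁅X 1, X 2⁆ₛ, ⁅X 3, Y 0⁆ₛ⁆ₛ + (2 : ℂ) • ⁅Y 2, ⁅X 0, Y 1⁆ₛ⁆ₛ + ⁅X 0, ⁅X 1, Y 2⁆ₛ⁆ₛ +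
    ⁅Y 2, ⁅X 1, X 0⁆ₛ⁆ₛ = 0) ∧
  (⁅⁅X 1, X 2⁆ₛ, ⁅X 0, Y 2⁆ₛ⁆ₛ = 0 ∧ ⁅⁅X 1, X 3⁆ₛ, ⁅X 0, Y 3⁆ₛ⁆ₛ = 0 ∧
    ⁅⁅X 1, Y 2⁆ₛ, ⁅X 0, Y 2⁆ₛ⁆ₛ = 0 ∧ ⁅⁅X 1, Y 3⁆ₛ, ⁅X 0, Y 3⁆ₛ⁆ₛ = 0) ∧
  (⁅⁅X 1, Y 2⁆ₛ, ⁅X 3, Y 0⁆ₛ⁆ₛ - ⁅Y 2, ⁅X 0, Y 1⁆ₛ⁆ₛ = 0 ∧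
    ⁅⁅X 0, Y 3⁆ₛ, ⁅Y 2, ⁅X 0, Y 1⁆ₛ⁆ₛ⁆ₛ = 0) ∧
  (⁅⁅X 0, Y 3⁆ₛ, ⁅Y 2, ⁅X 1, X 0⁆ₛ⁆ₛ⁆ₛ + ⁅⁅X 0, Y 3⁆ₛ, ⁅X 0, ⁅X 1, Y 2⁆ₛ⁆ₛ⁆ₛ = 0) ∧
  ((2 : ℂ) • ⁅⁅X 1, Y 2⁆ₛ, ⁅X 0, Y 3⁆ₛ⁆ₛ + (2 : ℂ) • ⁅Y 3, ⁅X 0, ⁅X 1, X 2⁆ₛ⁆ₛ⁆ₛ +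
    ⁅⁅X 1, X 3⁆ₛ, ⁅X 0, Y 2⁆ₛ⁆ₛ - ⁅⁅X 1, X 2⁆ₛ, ⁅X 0, Y 3⁆ₛ⁆ₛ = 0) ∧
  ((2 : ℂ) • ⁅⁅X 1, Y 3⁆ₛ, ⁅X 0, Y 2⁆ₛ⁆ₛ - (2 : ℂ) • ⁅Y 3, ⁅X 0, ⁅X 1, X 2⁆ₛ⁆ₛ⁆ₛ +
    ⁅⁅X 1, X 2⁆ₛ, ⁅X 0, Y 3⁆ₛ⁆ₛ - ⁅⁅X 1, X 3⁆ₛ, ⁅X 0, Y 2⁆ₛ⁆ₛ = 0)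

end StringyContact

end

noncomputable section

namespace StringyContact

/-! ### The algebra of functions -/

/-! A function `f` is recovered from `K_f` (`contactField_injective`), and `[K_f, K_g] = K_{f,g}`
for the contact bracket `{f, g} = K_f(g) - 2 ∂ₜ(f) g` (`bracket_contactField`). Hence the whole
problem can be moved from operators to functions, where brackets of monomials are explicit.

Grade functions by height: four times the degree plus the value of the weight on `(2, 1, 0)`. That
value lies between `-3` and `3` and is positive on positive roots, so every basis vector of the
positive part has positive height (`posBasis_height_pos`). The positive part is closed under the
bracket (`contactBracket_mem_posPart`): nothing is excluded from degree two on, and the rest is a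
finite check. It is generated by the eight generators (`posPart_le`): up to degree four an explicit
table writes the remaining basis vectors as brackets, and a monomial of degree at least five is a
nonzero multiple of `{t², ·}` applied to the monomial with one power of `t` less. This gives the
description of the algebra (`kLPos_eq_map`, `map_posAlg`), and generation makes homomorphisms unique
(`hom_ext_of_generators`).

For existence, prescribe the images of the generators in `M`. The table and the bracket with `t²`
then dictate the values of a linear map `φ` on all of the positive part (`extendMap`); it remains to
show that `φ` preserves brackets. Its failure is measured by the defect `δ(x, y) = [φx, φy] - φ{x,
y}`, which is super-antisymmetric. If `δ` vanishes on the pairs formed from `x, y, z`, the two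
Jacobi identities give `δ(x, {y, z}) = δ({x, y}, z) ± δ(y, {x, z})` (`defect_jacobi`).

The proof that `δ = 0` is an induction on the total height `H` of the pair (`vanishesBelow`). If one
entry is a bracket `{a, b}` of elements of positive height, the identity above expresses `δ({a, b},
y)` through `δ(a, {b, y})` and `δ(b, {a, y})`, again of height `H`. So, by generation, it is enough
to treat pairs of a generator and a basis vector (`defect_gen`).

For these pairs there is a certificate. At a given total degree and weight some defects vanish by
the very definition of `φ`. The others are linked by linear equations with right-hand side zero: one
from every defining relation, in which only the outermost brackets can contribute since the inner
ones have smaller height, and one from every triple of basis vectors, by the Jacobi identity. The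
tables list combinations of these equations, each of which leaves a single new defect with nonzero
coefficient (`eq_zero_of_determines`, `pairDefect_of_checkSteps`). Total degrees zero to four are
treated one by one. Higher degrees are uniform: with the exponent of `t` in one entry shifted by a
parameter `N ≥ 0`, coefficients become polynomials in `N`, and the two tables for degrees `5 + 2N`
and `6 + 2N` settle everything else. -/

theorem Fn.induction {p : Fn → Prop} (f : Fn) (h0 : p 0) (ha : ∀ f g, p f → p g → p (f + g))
    (hs : ∀ (c : ℂ) f, p f → p (c • f)) (hm : ∀ n S, p (mono n S)) : p f := by
  refine Finsupp.induction_linear (motive := p) f h0 ha fun q c => ?_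
  have : (Finsupp.single q c : (ℤ × Finset (Fin 6)) →₀ ℂ) = c • Finsupp.single q 1 := by
    rw [Finsupp.smul_single, smul_eq_mul, mul_one]
  rw [this]
  exact hs c _ (hm q.1 q.2)

/-- The number of pairs `(i, j)` in `S × T` with `j < i`. -/
def invCount (S T : Finset (Fin 6)) : ℕ := ((S ×ˢ T).filter fun q => q.2 < q.1).card

theorem invCount_eq_sum (S T : Finset (Fin 6)) :
    invCount S T = ∑ i ∈ S, ∑ j ∈ T, if j < i then 1 else 0 := by
  rw [invCount, Finset.card_filter, Finset.sum_product]

theorem invCount_union_left {S T : Finset (Fin 6)} (h : Disjoint S T) (U : Finset (Fin 6)) :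
    invCount (S ∪ T) U = invCount S U + invCount T U := by
  simp only [invCount_eq_sum, Finset.sum_union h]

theorem invCount_union_right {T U : Finset (Fin 6)} (h : Disjoint T U) (S : Finset (Fin 6)) :
    invCount S (T ∪ U) = invCount S T + invCount S U := by
  simp only [invCount_eq_sum, Finset.sum_union h, Finset.sum_add_distrib]

/-- Two distinct indices are inverted in exactly one of the two orders. This is the source of the
sign `(-1) ^ (|S| |T|)` in supercommutativity. -/
theorem invCount_add_comm {S T : Finset (Fin 6)} (h : Disjoint S T) :
    invCount S T + invCount T S = S.card * T.card := by
  have h2 : invCount T S = ∑ i ∈ S, ∑ j ∈ T, if i < j then 1 else 0 := by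
    rw [invCount_eq_sum, Finset.sum_comm]
  rw [h2, invCount_eq_sum, ← Finset.sum_add_distrib]
  have : ∀ i ∈ S, ((∑ j ∈ T, if j < i then 1 else 0) + ∑ j ∈ T, if i < j then 1 else 0)
      = T.card := by
    intro i hi
    rw [← Finset.sum_add_distrib, Finset.card_eq_sum_ones]
    refine Finset.sum_congr rfl fun j hj => ?_
    have hne : i ≠ j := fun e => Finset.disjoint_left.1 h hi (e ▸ hj)
    rcases lt_or_gt_of_ne hne with h | h <;> simp [h, h.not_gt]
  rw [Finset.sum_congr rfl this, Finset.sum_const, smul_eq_mul]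

/-- The number of elements of `S` below `i`. -/
def below (S : Finset (Fin 6)) (i : Fin 6) : ℕ := (S.filter fun j => j < i).card

/-- The number of elements of `S` above `i`. -/
def above (S : Finset (Fin 6)) (i : Fin 6) : ℕ := (S.filter fun j => i < j).card

theorem invCount_singleton_left (T : Finset (Fin 6)) (i : Fin 6) :
    invCount {i} T = below T i := by
  rw [invCount_eq_sum, Finset.sum_singleton, below, Finset.card_filter]

theorem invCount_singleton_right (T : Finset (Fin 6)) (i : Fin 6) :
    invCount T {i} = above T i := by
  rw [invCount_eq_sum, above, Finset.card_filter]
  simp only [Finset.sum_singleton]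

theorem invCount_erase_left {S : Finset (Fin 6)} {i : Fin 6} (h : i ∈ S) (T : Finset (Fin 6)) :
    invCount S T = below T i + invCount (S.erase i) T := by
  rw [← invCount_singleton_left, ← invCount_union_left (by simp), ← Finset.insert_eq,
    Finset.insert_erase h]

theorem invCount_erase_right {T : Finset (Fin 6)} {i : Fin 6} (h : i ∈ T) (S : Finset (Fin 6)) :
    invCount S T = above S i + invCount S (T.erase i) := by
  rw [← invCount_singleton_right, ← invCount_union_right (by simp), ← Finset.insert_eq,
    Finset.insert_erase h]

theorem below_union {S T : Finset (Fin 6)} (h : Disjoint S T) (i : Fin 6) :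
    below (S ∪ T) i = below S i + below T i := by
  simp only [← invCount_singleton_left, invCount_union_right h]

theorem below_add_above_of_mem {S : Finset (Fin 6)} {i : Fin 6} (h : i ∈ S) :
    below S i + above S i + 1 = S.card := by
  revert i S; decide +kernel

theorem below_add_above_of_notMem {S : Finset (Fin 6)} {i : Fin 6} (h : i ∉ S) :
    below S i + above S i = S.card := by
  revert i S; decide +kernel

theorem mulFn_mono (n m : ℤ) (S T : Finset (Fin 6)) : mulFn (mono n S) (mono m T) =
    if Disjoint S T then (-1 : ℂ) ^ invCount S T • mono (n + m) (S ∪ T) else 0 := by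
  simp only [mulFn, ofMono_mono, invCount]

theorem mulFn_mono_of_disjoint (n m : ℤ) {S T : Finset (Fin 6)} (h : Disjoint S T) :
    mulFn (mono n S) (mono m T) = (-1 : ℂ) ^ invCount S T • mono (n + m) (S ∪ T) := by
  rw [mulFn_mono, if_pos h]

theorem mulFn_mono_of_not_disjoint (n m : ℤ) {S T : Finset (Fin 6)} (h : ¬ Disjoint S T) :
    mulFn (mono n S) (mono m T) = 0 := by
  rw [mulFn_mono, if_neg h]

theorem dt_mono (n : ℤ) (S : Finset (Fin 6)) : dt (mono n S) = (n : ℂ) • mono (n - 1) S := by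
  simp only [dt, ofMono_mono]

theorem euler_mono (n : ℤ) (S : Finset (Fin 6)) : euler (mono n S) = (S.card : ℂ) • mono n S := by
  simp only [euler, ofMono_mono]

theorem dOdd_mono_of_mem (n : ℤ) {S : Finset (Fin 6)} {i : Fin 6} (h : i ∈ S) :
    dOdd i (mono n S) = (-1 : ℂ) ^ below S i • mono n (S.erase i) := by
  simp only [dOdd, ofMono_mono, if_pos h, below]

theorem dOdd_mono_of_notMem (n : ℤ) {S : Finset (Fin 6)} {i : Fin 6} (h : i ∉ S) :
    dOdd i (mono n S) = 0 := by
  simp only [dOdd, ofMono_mono, if_neg h]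

/-- Division by `t`. -/
def tInv : Fn →ₗ[ℂ] Fn := ofMono fun n S => mono (n - 1) S

theorem tInv_mono (n : ℤ) (S : Finset (Fin 6)) : tInv (mono n S) = mono (n - 1) S := by
  simp only [tInv, ofMono_mono]

/-- Inversions are additive over disjoint unions, so both sides carry the inversions of the three
pairs of factors; if two of the sets meet, both sides vanish. -/
theorem mulFn_assoc (f g h : Fn) : mulFn (mulFn f g) h = mulFn f (mulFn g h) := by
  induction f using Fn.induction with
  | h0 => simp
  | ha _ _ h1 h2 => simp only [map_add, LinearMap.add_apply, h1, h2]
  | hs _ _ h1 => simp only [map_smul, LinearMap.smul_apply, h1]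
  | hm n S =>
  induction g using Fn.induction with
  | h0 => simp
  | ha _ _ h1 h2 => simp only [map_add, LinearMap.add_apply, h1, h2]
  | hs _ _ h1 => simp only [map_smul, LinearMap.smul_apply, h1]
  | hm m T =>
  induction h using Fn.induction with
  | h0 => simp
  | ha _ _ h1 h2 => simp only [map_add, h1, h2]
  | hs _ _ h1 => simp only [map_smul, h1]
  | hm l U =>
  by_cases hST : Disjoint S T
  · rw [mulFn_mono_of_disjoint n m hST, map_smul, LinearMap.smul_apply]
    by_cases hTU : Disjoint T U
    · rw [mulFn_mono_of_disjoint m l hTU, map_smul]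
      by_cases hSU : Disjoint S U
      · rw [mulFn_mono_of_disjoint _ _ (Finset.disjoint_union_left.2 ⟨hSU, hTU⟩),
          mulFn_mono_of_disjoint _ _ (Finset.disjoint_union_right.2 ⟨hST, hSU⟩), smul_smul,
          smul_smul, ← pow_add, ← pow_add, invCount_union_left hST, invCount_union_right hTU,
          Finset.union_assoc, add_assoc n]
        congr 2; ring
      · rw [mulFn_mono_of_not_disjoint _ _ fun h => hSU (Finset.disjoint_union_left.1 h).1,
          mulFn_mono_of_not_disjoint _ _ fun h => hSU (Finset.disjoint_union_right.1 h).2]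
        simp
    · rw [mulFn_mono_of_not_disjoint _ _ fun h => hTU (Finset.disjoint_union_left.1 h).2,
        mulFn_mono_of_not_disjoint m l hTU]
      simp
  · rw [mulFn_mono_of_not_disjoint n m hST, map_zero, LinearMap.zero_apply]
    by_cases hTU : Disjoint T U
    · rw [mulFn_mono_of_disjoint m l hTU, map_smul,
        mulFn_mono_of_not_disjoint _ _ fun h => hST (Finset.disjoint_union_right.1 h).1, smul_zero]
    · rw [mulFn_mono_of_not_disjoint m l hTU, map_zero]

/-- The Koszul sign of parities `p, q` is half of `1 + (-1)^p + (-1)^q - (-1)^(p+q)`. With the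
parity operator in place of the signs, supercommutativity becomes bilinear and needs no homogeneity
assumption. -/
theorem two_smul_mulFn_comm (f g : Fn) : (2 : ℂ) • mulFn g f = mulFn f g + mulFn (parityOp f) g +
    mulFn f (parityOp g) - mulFn (parityOp f) (parityOp g) := by
  induction f using Fn.induction with
  | h0 => simp
  | ha _ _ h1 h2 => simp only [map_add, LinearMap.add_apply, smul_add, h1, h2]; abel
  | hs c _ h1 =>
    simp only [map_smul, LinearMap.smul_apply, smul_comm (2 : ℂ) c, h1, smul_sub, smul_add]
  | hm n S =>
  induction g using Fn.induction with
  | h0 => simp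
  | ha _ _ h1 h2 => simp only [map_add, LinearMap.add_apply, smul_add, h1, h2]; abel
  | hs c _ h1 =>
    simp only [map_smul, LinearMap.smul_apply, smul_comm (2 : ℂ) c, h1, smul_sub, smul_add]
  | hm m T =>
  by_cases hST : Disjoint S T
  · simp only [parityOp_mono, map_smul, LinearMap.smul_apply, mulFn_mono_of_disjoint _ _ hST,
      mulFn_mono_of_disjoint _ _ hST.symm, Finset.union_comm T S, add_comm m n, smul_smul,
      ← add_smul, ← sub_smul]
    congr 1
    have h1 : (-1 : ℂ) ^ invCount T S = (-1) ^ invCount S T * (-1) ^ (S.card * T.card) := by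
      rw [← invCount_add_comm hST, pow_add, ← mul_assoc, ← pow_add, ← two_mul, pow_mul]
      norm_num
    rw [h1]
    rcases Nat.even_or_odd S.card with hS | hS <;> rcases Nat.even_or_odd T.card with hT | hT
    · rw [(hS.mul_right _).neg_one_pow, hS.neg_one_pow, hT.neg_one_pow]; ring
    · rw [(hS.mul_right _).neg_one_pow, hS.neg_one_pow, hT.neg_one_pow]; ring
    · rw [(hT.mul_left _).neg_one_pow, hS.neg_one_pow, hT.neg_one_pow]; ring
    · rw [(hS.mul hT).neg_one_pow, hS.neg_one_pow, hT.neg_one_pow]; ring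
  · simp [parityOp_mono, mulFn_mono_of_not_disjoint _ _ hST,
      mulFn_mono_of_not_disjoint _ _ fun h => hST (Disjoint.symm h)]

theorem dOdd_mulFn (i : Fin 6) (f g : Fn) :
    dOdd i (mulFn f g) = mulFn (dOdd i f) g + mulFn (parityOp f) (dOdd i g) := by
  induction f using Fn.induction with
  | h0 => simp
  | ha _ _ h1 h2 => simp only [map_add, LinearMap.add_apply, h1, h2]; abel
  | hs c _ h1 => simp only [map_smul, LinearMap.smul_apply, h1, smul_add]
  | hm n S =>
  induction g using Fn.induction with
  | h0 => simp
  | ha _ _ h1 h2 => simp only [map_add, h1, h2]; abel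
  | hs c _ h1 => simp only [map_smul, h1, smul_add]
  | hm m T =>
  simp only [parityOp_mono, map_smul, LinearMap.smul_apply]
  have hneg : ∀ a b : ℕ, a % 2 = b % 2 → (-1 : ℂ) ^ a = (-1) ^ b := by
    intro a b h
    rw [neg_one_pow_eq_pow_mod_two, h, ← neg_one_pow_eq_pow_mod_two]
  by_cases hS : i ∈ S <;> by_cases hT : i ∈ T
  -- Both factors contain the coordinate `i`, so the product is zero and the two terms on the right
  -- have to cancel: their sign exponents differ by an odd number.
  · have hd : ¬ Disjoint S T := Finset.not_disjoint_iff.2 ⟨i, hS, hT⟩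
    rw [mulFn_mono_of_not_disjoint n m hd, dOdd_mono_of_mem n hS, dOdd_mono_of_mem m hT]
    simp only [map_smul, LinearMap.smul_apply, map_zero]
    have e1 : Disjoint (S.erase i) T ↔ Disjoint S (T.erase i) := by
      rw [Finset.disjoint_erase_comm]
    by_cases h : Disjoint (S.erase i) T
    · have eU : S.erase i ∪ T = S ∪ T := by
        ext j; by_cases hj : j = i
        · subst hj; simp [hS, hT]
        · simp [hj]
      have eU' : S ∪ T.erase i = S ∪ T := by
        ext j; by_cases hj : j = i
        · subst hj; simp [hS, hT]
        · simp [hj]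
      rw [mulFn_mono_of_disjoint n m h, mulFn_mono_of_disjoint n m (e1.1 h), eU, eU', smul_smul,
        smul_smul, smul_smul, ← add_smul]
      have h1 := invCount_erase_left hS T
      have h2 := invCount_erase_right hT S
      have h3 := below_add_above_of_mem hS
      rw [← pow_add, ← pow_add, ← pow_add,
        hneg (S.card + below T i + invCount S (T.erase i))
          (below S i + invCount (S.erase i) T + 1) (by omega), pow_succ]
      simp
    · rw [mulFn_mono_of_not_disjoint n m h, mulFn_mono_of_not_disjoint n m (fun h' => h (e1.2 h'))]
      simp
  · rw [dOdd_mono_of_mem n hS, dOdd_mono_of_notMem m hT]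
    simp only [map_zero, smul_zero, add_zero, map_smul, LinearMap.smul_apply]
    have e1 : Disjoint (S.erase i) T ↔ Disjoint S T := by
      rw [Finset.disjoint_erase_comm, Finset.erase_eq_of_notMem hT]
    by_cases h : Disjoint S T
    · have hU : i ∈ S ∪ T := Finset.mem_union_left _ hS
      rw [mulFn_mono_of_disjoint n m h, mulFn_mono_of_disjoint n m (e1.2 h), map_smul,
        dOdd_mono_of_mem _ hU, smul_smul, smul_smul, below_union h, ← pow_add, ← pow_add,
        Finset.erase_union_distrib, Finset.erase_eq_of_notMem hT]
      congr 1
      have h1 := invCount_erase_left hS T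
      exact hneg _ _ (by omega)
    · rw [mulFn_mono_of_not_disjoint n m h, mulFn_mono_of_not_disjoint n m (fun h' => h (e1.1 h'))]
      simp
  · rw [dOdd_mono_of_notMem n hS, dOdd_mono_of_mem m hT]
    simp only [map_zero, LinearMap.zero_apply, zero_add, map_smul]
    have e1 : Disjoint S (T.erase i) ↔ Disjoint S T := by
      rw [← Finset.disjoint_erase_comm, Finset.erase_eq_of_notMem hS]
    by_cases h : Disjoint S T
    · have hU : i ∈ S ∪ T := Finset.mem_union_right _ hT
      rw [mulFn_mono_of_disjoint n m h, mulFn_mono_of_disjoint n m (e1.2 h), map_smul,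
        dOdd_mono_of_mem _ hU, smul_smul, smul_smul, smul_smul, below_union h, ← pow_add,
        ← pow_add, ← pow_add, Finset.erase_union_distrib, Finset.erase_eq_of_notMem hS]
      congr 1
      have h1 := invCount_erase_right hT S
      have h3 := below_add_above_of_notMem hS
      exact hneg _ _ (by omega)
    · rw [mulFn_mono_of_not_disjoint n m h, mulFn_mono_of_not_disjoint n m (fun h' => h (e1.1 h'))]
      simp
  · rw [dOdd_mono_of_notMem n hS, dOdd_mono_of_notMem m hT]
    simp only [map_zero, LinearMap.zero_apply, zero_add, smul_zero]
    by_cases h : Disjoint S T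
    · rw [mulFn_mono_of_disjoint n m h, map_smul, dOdd_mono_of_notMem _ (by simp [hS, hT]),
        smul_zero]
    · rw [mulFn_mono_of_not_disjoint n m h, map_zero]

theorem dOdd_dOdd (i j : Fin 6) (f : Fn) : dOdd i (dOdd j f) = -dOdd j (dOdd i f) := by
  -- Removing the larger index first leaves the position of the smaller one unchanged; in the other
  -- order the larger one has moved down by one place. Hence the single extra sign.
  have key : ∀ (S : Finset (Fin 6)) (i j : Fin 6), i ∈ S → j ∈ S → i ≠ j →
      (below S j + below (S.erase j) i) % 2 = (below S i + below (S.erase i) j + 1) % 2 := by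
    decide +kernel
  induction f using Fn.induction with
  | h0 => simp
  | ha _ _ h1 h2 => simp only [map_add, h1, h2]; abel
  | hs c _ h1 => simp only [map_smul, h1, smul_neg]
  | hm n S =>
  by_cases hij : i = j
  · subst hij
    by_cases hi : i ∈ S
    · rw [dOdd_mono_of_mem n hi, map_smul, dOdd_mono_of_notMem n (by simp)]; simp
    · rw [dOdd_mono_of_notMem n hi]; simp
  by_cases hi : i ∈ S
  · by_cases hj : j ∈ S
    · rw [dOdd_mono_of_mem n hi, map_smul, dOdd_mono_of_mem n hj, map_smul,
        dOdd_mono_of_mem n (Finset.mem_erase.2 ⟨hij, hi⟩),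
        dOdd_mono_of_mem n (Finset.mem_erase.2 ⟨Ne.symm hij, hj⟩), smul_smul, smul_smul, ← pow_add,
        ← pow_add, Finset.erase_right_comm, ← neg_smul, neg_one_pow_eq_pow_mod_two,
        key S i j hi hj hij, ← neg_one_pow_eq_pow_mod_two, pow_succ]
      simp
    · rw [dOdd_mono_of_notMem n hj, dOdd_mono_of_mem n hi, map_smul,
        dOdd_mono_of_notMem n (by simp [hj])]; simp
  · rw [dOdd_mono_of_notMem n hi]
    by_cases hj : j ∈ S
    · rw [dOdd_mono_of_mem n hj, map_smul, dOdd_mono_of_notMem n (by simp [hi])]; simp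
    · rw [dOdd_mono_of_notMem n hj]; simp

theorem tInv_mulFn_left (f g : Fn) : mulFn (tInv f) g = tInv (mulFn f g) := by
  induction f using Fn.induction with
  | h0 => simp
  | ha _ _ h1 h2 => simp only [map_add, LinearMap.add_apply, h1, h2]
  | hs c _ h1 => simp only [map_smul, LinearMap.smul_apply, h1]
  | hm n S =>
  induction g using Fn.induction with
  | h0 => simp
  | ha _ _ h1 h2 => simp only [map_add, h1, h2]
  | hs c _ h1 => simp only [map_smul, h1]
  | hm m T =>
  rw [tInv_mono, mulFn_mono, mulFn_mono]
  split_ifs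
  · rw [map_smul, tInv_mono]; congr 2; ring
  · simp

theorem tInv_mulFn_right (f g : Fn) : mulFn f (tInv g) = tInv (mulFn f g) := by
  induction f using Fn.induction with
  | h0 => simp
  | ha _ _ h1 h2 => simp only [map_add, LinearMap.add_apply, h1, h2]
  | hs c _ h1 => simp only [map_smul, LinearMap.smul_apply, h1]
  | hm n S =>
  induction g using Fn.induction with
  | h0 => simp
  | ha _ _ h1 h2 => simp only [map_add, h1, h2]
  | hs c _ h1 => simp only [map_smul, h1]
  | hm m T =>
  rw [tInv_mono, mulFn_mono, mulFn_mono]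
  split_ifs
  · rw [map_smul, tInv_mono]; congr 2; ring
  · simp

theorem dOdd_tInv (i : Fin 6) (f : Fn) : dOdd i (tInv f) = tInv (dOdd i f) := by
  induction f using Fn.induction with
  | h0 => simp
  | ha _ _ h1 h2 => simp only [map_add, h1, h2]
  | hs c _ h1 => simp only [map_smul, h1]
  | hm n S =>
  rw [tInv_mono]
  by_cases hi : i ∈ S
  · rw [dOdd_mono_of_mem _ hi, dOdd_mono_of_mem _ hi, map_smul, tInv_mono]
  · rw [dOdd_mono_of_notMem _ hi, dOdd_mono_of_notMem _ hi, map_zero]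

/-- `f` is a `t`-homogeneous function of degree `n`, Euler degree `s` and parity sign `ε`. -/
structure IsHom (n s ε : ℂ) (f : Fn) : Prop where
  dt_eq : dt f = n • tInv f
  euler_eq : euler f = s • f
  parity_eq : parityOp f = ε • f

theorem isHom_mono (n : ℤ) (S : Finset (Fin 6)) :
    IsHom n S.card ((-1) ^ S.card) (mono n S) :=
  ⟨by rw [dt_mono, tInv_mono], euler_mono n S, parityOp_mono n S⟩

theorem dt_mulFn (f g : Fn) : dt (mulFn f g) = mulFn (dt f) g + mulFn f (dt g) := by
  induction f using Fn.induction with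
  | h0 => simp
  | ha _ _ h1 h2 => simp only [map_add, LinearMap.add_apply, h1, h2]; abel
  | hs c _ h1 => simp only [map_smul, LinearMap.smul_apply, h1, smul_add]
  | hm n S =>
  induction g using Fn.induction with
  | h0 => simp
  | ha _ _ h1 h2 => simp only [map_add, h1, h2]; abel
  | hs c _ h1 => simp only [map_smul, h1, smul_add]
  | hm m T =>
  simp only [dt_mono, map_smul, LinearMap.smul_apply]
  by_cases h : Disjoint S T
  · simp only [mulFn_mono_of_disjoint _ _ h, map_smul, dt_mono, smul_smul]
    rw [show n - 1 + m = n + m - 1 by ring, show n + (m - 1) = n + m - 1 by ring, ← add_smul]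
    congr 1; push_cast; ring
  · simp [mulFn_mono_of_not_disjoint _ _ h]

theorem euler_mulFn (f g : Fn) : euler (mulFn f g) = mulFn (euler f) g + mulFn f (euler g) := by
  induction f using Fn.induction with
  | h0 => simp
  | ha _ _ h1 h2 => simp only [map_add, LinearMap.add_apply, h1, h2]; abel
  | hs c _ h1 => simp only [map_smul, LinearMap.smul_apply, h1, smul_add]
  | hm n S =>
  induction g using Fn.induction with
  | h0 => simp
  | ha _ _ h1 h2 => simp only [map_add, h1, h2]; abel
  | hs c _ h1 => simp only [map_smul, h1, smul_add]
  | hm m T =>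
  simp only [euler_mono, map_smul, LinearMap.smul_apply]
  by_cases h : Disjoint S T
  · simp only [mulFn_mono_of_disjoint _ _ h, map_smul, euler_mono, smul_smul,
      Finset.card_union_of_disjoint h]
    rw [← add_smul]
    congr 1; push_cast; ring
  · simp [mulFn_mono_of_not_disjoint _ _ h]

theorem parityOp_mulFn (f g : Fn) : parityOp (mulFn f g) = mulFn (parityOp f) (parityOp g) := by
  induction f using Fn.induction with
  | h0 => simp
  | ha _ _ h1 h2 => simp only [map_add, LinearMap.add_apply, h1, h2]
  | hs c _ h1 => simp only [map_smul, LinearMap.smul_apply, h1]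
  | hm n S =>
  induction g using Fn.induction with
  | h0 => simp
  | ha _ _ h1 h2 => simp only [map_add, h1, h2]
  | hs c _ h1 => simp only [map_smul, h1]
  | hm m T =>
  simp only [parityOp_mono, map_smul, LinearMap.smul_apply]
  by_cases h : Disjoint S T
  · simp only [mulFn_mono_of_disjoint _ _ h, map_smul, parityOp_mono, smul_smul,
      Finset.card_union_of_disjoint h, pow_add]
    congr 1; ring
  · simp [mulFn_mono_of_not_disjoint _ _ h]

theorem tInv_dt (f : Fn) : dt (tInv f) = tInv (dt f) - tInv (tInv f) := by
  induction f using Fn.induction with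
  | h0 => simp
  | ha _ _ h1 h2 => simp only [map_add, h1, h2]; abel
  | hs c _ h1 => simp only [map_smul, h1, smul_sub]
  | hm n S =>
  simp only [tInv_mono, dt_mono, map_smul]
  push_cast
  rw [sub_smul, one_smul]

theorem euler_dOdd (i : Fin 6) (f : Fn) : euler (dOdd i f) = dOdd i (euler f) - dOdd i f := by
  induction f using Fn.induction with
  | h0 => simp
  | ha _ _ h1 h2 => simp only [map_add, h1, h2]; abel
  | hs c _ h1 => simp only [map_smul, h1, smul_sub]
  | hm n S =>
  by_cases hi : i ∈ S
  · simp only [euler_mono, map_smul, dOdd_mono_of_mem n hi, smul_smul]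
    rw [← Finset.card_erase_add_one hi, ← sub_smul]
    congr 1; push_cast; ring
  · simp [euler_mono, dOdd_mono_of_notMem n hi]

theorem dt_dOdd (i : Fin 6) (f : Fn) : dt (dOdd i f) = dOdd i (dt f) := by
  induction f using Fn.induction with
  | h0 => simp
  | ha _ _ h1 h2 => simp only [map_add, h1, h2]
  | hs c _ h1 => simp only [map_smul, h1]
  | hm n S =>
  by_cases hi : i ∈ S
  · simp only [dt_mono, map_smul, dOdd_mono_of_mem _ hi, smul_smul]
    congr 1; ring
  · simp [dt_mono, dOdd_mono_of_notMem _ hi]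

theorem parityOp_dOdd (i : Fin 6) (f : Fn) : parityOp (dOdd i f) = -dOdd i (parityOp f) := by
  induction f using Fn.induction with
  | h0 => simp
  | ha _ _ h1 h2 => simp only [map_add, h1, h2]; abel
  | hs c _ h1 => simp only [map_smul, h1, smul_neg]
  | hm n S =>
  by_cases hi : i ∈ S
  · simp only [parityOp_mono, map_smul, dOdd_mono_of_mem n hi, smul_smul]
    rw [← Finset.card_erase_add_one hi, ← neg_smul]
    congr 1; rw [pow_succ]; ring
  · simp [parityOp_mono, dOdd_mono_of_notMem n hi]

namespace IsHom

variable {n m s r ε δ : ℂ} {f g : Fn}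

theorem dOdd (hf : IsHom n s ε f) (i : Fin 6) :
    IsHom n (s - 1) (-ε) (StringyContact.dOdd i f) where
  dt_eq := by rw [dt_dOdd, hf.dt_eq, map_smul, dOdd_tInv]
  euler_eq := by rw [euler_dOdd, hf.euler_eq, map_smul, sub_smul, one_smul]
  parity_eq := by rw [parityOp_dOdd, hf.parity_eq, map_smul, neg_smul]

theorem mulFn (hf : IsHom n s ε f) (hg : IsHom m r δ g) :
    IsHom (n + m) (s + r) (ε * δ) (StringyContact.mulFn f g) where
  dt_eq := by
    rw [dt_mulFn, hf.dt_eq, hg.dt_eq, map_smul, map_smul, LinearMap.smul_apply, tInv_mulFn_left,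
      tInv_mulFn_right, add_smul]
  euler_eq := by
    rw [euler_mulFn, hf.euler_eq, hg.euler_eq, map_smul, map_smul, LinearMap.smul_apply, add_smul]
  parity_eq := by
    rw [parityOp_mulFn, hf.parity_eq, hg.parity_eq, map_smul, map_smul, LinearMap.smul_apply,
      smul_smul, mul_comm]

theorem tInv (hf : IsHom n s ε f) : IsHom (n - 1) s ε (StringyContact.tInv f) where
  dt_eq := by rw [tInv_dt, hf.dt_eq, map_smul, sub_smul, one_smul]
  euler_eq := by
    have : ∀ f, euler (StringyContact.tInv f) = StringyContact.tInv (euler f) := fun f => by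
      induction f using Fn.induction with
      | h0 => simp
      | ha _ _ h1 h2 => simp only [map_add, h1, h2]
      | hs c _ h1 => simp only [map_smul, h1]
      | hm n S => simp only [tInv_mono, euler_mono, map_smul]
    rw [this, hf.euler_eq, map_smul]
  parity_eq := by
    have : ∀ f, parityOp (StringyContact.tInv f) = StringyContact.tInv (parityOp f) := fun f => by
      induction f using Fn.induction with
      | h0 => simp
      | ha _ _ h1 h2 => simp only [map_add, h1, h2]
      | hs c _ h1 => simp only [map_smul, h1]
      | hm n S => simp only [tInv_mono, parityOp_mono, map_smul]
    rw [this, hf.parity_eq, map_smul]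

/-- For signs `ε` and `δ` the scalar is the Koszul sign. Writing it as a polynomial in them
postpones the case distinction to the end of the computation. -/
theorem mulFn_comm (hf : IsHom n s ε f) (hg : IsHom m r δ g) :
    StringyContact.mulFn g f = ((1 + ε + δ - ε * δ) / 2) • StringyContact.mulFn f g := by
  have h := two_smul_mulFn_comm f g
  rw [hf.parity_eq, hg.parity_eq] at h
  simp only [map_smul, LinearMap.smul_apply] at h
  have h2 : StringyContact.mulFn g f = (2⁻¹ : ℂ) • (2 : ℂ) • StringyContact.mulFn g f := by
    rw [smul_smul]; norm_num
  rw [h2, h]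
  module

end IsHom

/-! ### The contact bracket -/

/-- Adding `3` in `Fin 6` interchanges `ξₖ` and `ηₖ`, so the symmetric Poisson part is one sum over
all six coordinates. -/
theorem contactField_apply (f h : Fn) : contactField f h =
    mulFn ((2 : ℂ) • f - euler f) (dt h) + mulFn (dt f) (euler h) -
      ∑ i : Fin 6, mulFn (dOdd i (parityOp f)) (dOdd (i + 3) h) := by
  have h1 : contactField f h = mulFn ((2 : ℂ) • f - euler f) (dt h) + mulFn (dt f) (euler h) -
      ∑ k : Fin 3, (mulFn (dOdd (xi k) (parityOp f)) (dOdd (eta k) h) +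
        mulFn (dOdd (eta k) (parityOp f)) (dOdd (xi k) h)) := by
    simp [contactField]
  have e : xi 0 = 0 ∧ xi 1 = 1 ∧ xi 2 = 2 ∧ eta 0 = 3 ∧ eta 1 = 4 ∧ eta 2 = 5 := by decide
  have e' : (0 : Fin 6) + 3 = 3 ∧ (1 : Fin 6) + 3 = 4 ∧ (2 : Fin 6) + 3 = 5 ∧
    (3 : Fin 6) + 3 = 0 ∧ (4 : Fin 6) + 3 = 1 ∧ (5 : Fin 6) + 3 = 2 := by decide
  obtain ⟨e0, e1, e2, e3, e4, e5⟩ := e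
  obtain ⟨f0, f1, f2, f3, f4, f5⟩ := e'
  rw [h1, Fin.sum_univ_three, Fin.sum_univ_six, e0, e1, e2, e3, e4, e5, f0, f1, f2, f3, f4, f5]
  abel

/-- The bracket on functions that corresponds to the supercommutator of contact fields. -/
def contactBracket : Fn →ₗ[ℂ] Fn →ₗ[ℂ] Fn :=
  contactField - (2 : ℂ) • mulFn ∘ₗ dt

theorem contactBracket_apply (f g : Fn) :
    contactBracket f g = contactField f g - (2 : ℂ) • mulFn (dt f) g := rfl

namespace IsHom

variable {n m l s r u ε δ η : ℂ} {f g h : Fn}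

theorem contactField_apply (hf : IsHom n s ε f) (hh : IsHom l u η h) :
    contactField f h = ((2 - s) * l + n * u) • StringyContact.tInv (StringyContact.mulFn f h) -
      ε • ∑ i : Fin 6, StringyContact.mulFn (StringyContact.dOdd i f)
        (StringyContact.dOdd (i + 3) h) := by
  rw [StringyContact.contactField_apply, hf.euler_eq, hf.dt_eq, hf.parity_eq, hh.dt_eq,
    hh.euler_eq, ← sub_smul]
  simp only [map_smul, LinearMap.smul_apply, tInv_mulFn_left, tInv_mulFn_right, Finset.smul_sum]
  rw [smul_smul, smul_smul, ← add_smul]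
  congr 2; ring

theorem dOdd_mulFn (hf : IsHom n s ε f) (i : Fin 6) (g : Fn) :
    StringyContact.dOdd i (StringyContact.mulFn f g) =
      StringyContact.mulFn (StringyContact.dOdd i f) g +
        ε • StringyContact.mulFn f (StringyContact.dOdd i g) := by
  rw [StringyContact.dOdd_mulFn, hf.parity_eq, map_smul, LinearMap.smul_apply]

theorem mulFn_left_comm (hf : IsHom n s ε f) (hg : IsHom m r δ g) (h : Fn) :
    StringyContact.mulFn g (StringyContact.mulFn f h) =
      ((1 + ε + δ - ε * δ) / 2) • StringyContact.mulFn f (StringyContact.mulFn g h) := by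
  rw [← mulFn_assoc, hf.mulFn_comm hg, map_smul, LinearMap.smul_apply, mulFn_assoc]

/-- A normal form for the double action: every term is a product of a derivative of `f`, one of `g`
and one of `h`, in this order, with powers of `t⁻¹` pulled out. On homogeneous functions `∂ₜ` and
the Euler operator only produce scalars. -/
theorem contactField_comp (hf : IsHom n s ε f) (hg : IsHom m r δ g) (hh : IsHom l u η h) :
    contactField f (contactField g h) =
      ((2 - r) * l + m * u) • (((2 - s) * (m + l - 1) + n * (r + u)) •
          StringyContact.tInv (StringyContact.tInv (StringyContact.mulFn f
            (StringyContact.mulFn g h)))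
        - ε • ∑ i : Fin 6, StringyContact.tInv (StringyContact.mulFn (StringyContact.dOdd i f)
            (StringyContact.mulFn (StringyContact.dOdd (i + 3) g) h))
        - (ε * δ) • ∑ i : Fin 6, StringyContact.tInv (StringyContact.mulFn
            (StringyContact.dOdd i f) (StringyContact.mulFn g (StringyContact.dOdd (i + 3) h))))
      - δ • (((2 - s) * (m + l) + n * (r + u - 2)) •
          ∑ j : Fin 6, StringyContact.tInv (StringyContact.mulFn f (StringyContact.mulFn
            (StringyContact.dOdd j g) (StringyContact.dOdd (j + 3) h)))
        - ε • (∑ i : Fin 6, ∑ j : Fin 6, StringyContact.mulFn (StringyContact.dOdd i f)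
            (StringyContact.mulFn (StringyContact.dOdd (i + 3) (StringyContact.dOdd j g))
              (StringyContact.dOdd (j + 3) h))
          - δ • ∑ i : Fin 6, ∑ j : Fin 6, StringyContact.mulFn (StringyContact.dOdd i f)
            (StringyContact.mulFn (StringyContact.dOdd j g)
              (StringyContact.dOdd (i + 3) (StringyContact.dOdd (j + 3) h))))) := by
  have e1 := hf.contactField_apply (hg.mulFn hh).tInv
  have e2 := fun j => hf.contactField_apply ((hg.dOdd j).mulFn (hh.dOdd (j + 3)))
  have e3 := fun i => hg.dOdd_mulFn i h
  have e4 := fun i j => (hg.dOdd j).dOdd_mulFn i (StringyContact.dOdd (j + 3) h)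
  rw [hg.contactField_apply hh, map_sub, map_smul, map_smul, map_sum, e1]
  simp only [e2, dOdd_tInv, e3, e4, tInv_mulFn_right, map_add, map_smul, Finset.sum_add_distrib,
    Finset.sum_sub_distrib, ← Finset.smul_sum]
  rw [Finset.sum_comm (s := (Finset.univ : Finset (Fin 6)))
      (f := fun j i => StringyContact.mulFn (StringyContact.dOdd i f)
            (StringyContact.mulFn (StringyContact.dOdd (i + 3) (StringyContact.dOdd j g))
              (StringyContact.dOdd (j + 3) h))),
    Finset.sum_comm (s := (Finset.univ : Finset (Fin 6)))
      (f := fun j i => StringyContact.mulFn (StringyContact.dOdd i f)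
            (StringyContact.mulFn (StringyContact.dOdd j g)
              (StringyContact.dOdd (i + 3) (StringyContact.dOdd (j + 3) h))))]
  module

theorem sum_add_three {V : Type*} [AddCommMonoid V] (F : Fin 6 → V) :
    ∑ i, F (i + 3) = ∑ i, F i := Equiv.sum_comp (Equiv.addRight (3 : Fin 6)) F

theorem add_three_add_three (i : Fin 6) : i + 3 + 3 = i := by revert i; decide

/-- Compare the normal forms of both sides. The terms with two derivatives of `h` cancel because odd
derivatives anticommute; those with two derivatives of `f` or `g` are the ones produced by
differentiating the bracket. -/
theorem contactField_comm (hf : IsHom n s ε f) (hg : IsHom m r δ g) (hh : IsHom l u η h)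
    (hε : ε = 1 ∨ ε = -1) (hδ : δ = 1 ∨ δ = -1) :
    contactField f (contactField g h) - ((1 + ε + δ - ε * δ) / 2) •
      contactField g (contactField f h) = contactField (contactBracket f g) h := by
  have hA : ∀ h, StringyContact.mulFn g (StringyContact.mulFn f h) = _ := hf.mulFn_left_comm hg
  have hP := fun i h => (hf.dOdd (i + 3)).mulFn_left_comm (hg.dOdd i) h
  have hQ := fun i h => hf.mulFn_left_comm (hg.dOdd i) h
  have hR := fun i h => (hf.dOdd i).mulFn_left_comm hg h
  have hR1 := fun i j h => ((hf.dOdd j).dOdd (i + 3)).mulFn_left_comm (hg.dOdd i) h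
  have hR2 := fun i j h => (hf.dOdd j).mulFn_left_comm (hg.dOdd i) h
  have e1 := hf.contactField_comp hg hh
  have e2 := hg.contactField_comp hf hh
  have k1 := (hf.mulFn hg).tInv.contactField_apply hh
  have k2 := fun i => ((hf.dOdd i).mulFn (hg.dOdd (i + 3))).contactField_apply hh
  have k3 := fun i => hf.dOdd_mulFn i g
  have k4 := fun i j => (hf.dOdd i).dOdd_mulFn j (StringyContact.dOdd (i + 3) g)
  have c0 : contactBracket f g = ((2 - s) * m + n * r - 2 * n) •
      StringyContact.tInv (StringyContact.mulFn f g) - ε • ∑ i : Fin 6,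
        StringyContact.mulFn (StringyContact.dOdd i f) (StringyContact.dOdd (i + 3) g) := by
    rw [contactBracket_apply, hf.contactField_apply hg, hf.dt_eq, map_smul, LinearMap.smul_apply,
      tInv_mulFn_left]
    module
  rw [e1, e2, c0, map_sub, map_smul, map_smul, map_sum, LinearMap.sub_apply, LinearMap.smul_apply,
    LinearMap.smul_apply, LinearMap.sum_apply, k1]
  clear e1 e2 c0 k1
  simp only [k2, k3, k4, hA, hP, hQ, hR, hR1, hR2, map_smul, map_add, LinearMap.add_apply,
    LinearMap.smul_apply, dOdd_tInv, tInv_mulFn_left, mulFn_assoc, Finset.sum_add_distrib,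
    Finset.sum_sub_distrib, ← Finset.smul_sum]
  clear k2 k3 k4 hA hP hQ hR hR1 hR2
  -- The next four identities bring the double sums to a common form, by shifting the index by
  -- three, by exchanging summations and by anticommuting derivatives.
  have s1 : ∑ i : Fin 6, StringyContact.tInv (StringyContact.mulFn
      (StringyContact.dOdd (i + 3) f) (StringyContact.mulFn (StringyContact.dOdd i g) h)) =
      ∑ i : Fin 6, StringyContact.tInv (StringyContact.mulFn
      (StringyContact.dOdd i f) (StringyContact.mulFn (StringyContact.dOdd (i + 3) g) h)) := by
    rw [← sum_add_three]
    simp only [add_three_add_three]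
  have s2 : ∑ i : Fin 6, ∑ j : Fin 6, StringyContact.mulFn
      (StringyContact.dOdd (i + 3) (StringyContact.dOdd j f))
      (StringyContact.mulFn (StringyContact.dOdd i g) (StringyContact.dOdd (j + 3) h)) =
      -∑ i : Fin 6, ∑ j : Fin 6, StringyContact.mulFn
      (StringyContact.dOdd j (StringyContact.dOdd i f))
      (StringyContact.mulFn (StringyContact.dOdd (i + 3) g) (StringyContact.dOdd (j + 3) h)) := by
    rw [← sum_add_three]
    simp only [add_three_add_three, ← Finset.sum_neg_distrib]
    refine Finset.sum_congr rfl fun i _ => Finset.sum_congr rfl fun j _ => ?_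
    rw [dOdd_dOdd, map_neg, LinearMap.neg_apply]
  have s3 : ∑ i : Fin 6, ∑ j : Fin 6, StringyContact.mulFn (StringyContact.dOdd j f)
      (StringyContact.mulFn (StringyContact.dOdd i g)
        (StringyContact.dOdd (i + 3) (StringyContact.dOdd (j + 3) h))) =
      -∑ i : Fin 6, ∑ j : Fin 6, StringyContact.mulFn (StringyContact.dOdd i f)
      (StringyContact.mulFn (StringyContact.dOdd j g)
        (StringyContact.dOdd (i + 3) (StringyContact.dOdd (j + 3) h))) := by
    rw [Finset.sum_comm]
    simp only [← Finset.sum_neg_distrib]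
    refine Finset.sum_congr rfl fun i _ => Finset.sum_congr rfl fun j _ => ?_
    rw [dOdd_dOdd, map_neg, map_neg]
  have s4 : ∑ i : Fin 6, ∑ j : Fin 6, StringyContact.mulFn (StringyContact.dOdd i f)
      (StringyContact.mulFn (StringyContact.dOdd j (StringyContact.dOdd (i + 3) g))
        (StringyContact.dOdd (j + 3) h)) =
      -∑ i : Fin 6, ∑ j : Fin 6, StringyContact.mulFn (StringyContact.dOdd i f)
      (StringyContact.mulFn (StringyContact.dOdd (i + 3) (StringyContact.dOdd j g))
        (StringyContact.dOdd (j + 3) h)) := by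
    simp only [← Finset.sum_neg_distrib]
    refine Finset.sum_congr rfl fun i _ => Finset.sum_congr rfl fun j _ => ?_
    rw [dOdd_dOdd, map_neg, LinearMap.neg_apply, map_neg]
  rw [s1, s2, s3, s4]
  -- Both sides are now combinations of the same products; the coefficients agree once the signs are
  -- specialised.
  rcases hε with rfl | rfl <;> rcases hδ with rfl | rfl <;> module

end IsHom

/-- The supercommutator of contact fields is the contact field of the contact bracket. -/
theorem bracket_contactField (f g : Fn) :
    ⁅contactField f, contactField g⁆ₛ = contactField (contactBracket f g) := by
  induction f using Fn.induction with
  | h0 => simp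
  | ha _ _ h1 h2 => simp only [map_add, LinearMap.add_apply, h1, h2]
  | hs c _ h1 => simp only [map_smul, LinearMap.smul_apply, h1]
  | hm n S =>
  induction g using Fn.induction with
  | h0 => simp
  | ha _ _ h1 h2 => simp only [map_add, h1, h2]
  | hs c _ h1 => simp only [map_smul, h1]
  | hm m T =>
  have hsgn : ∀ k : ℕ, (-1 : ℂ) ^ k = 1 ∨ (-1 : ℂ) ^ k = -1 := neg_one_pow_eq_or ℂ
  have hk : koszul (S.card : ZMod 2) (T.card : ZMod 2) =
      (1 + (-1) ^ S.card + (-1) ^ T.card - (-1) ^ S.card * (-1) ^ T.card) / 2 := by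
    rw [← koszul_cast_one, ← koszul_cast_one]
    rcases zmod2_cases (S.card : ZMod 2) with h | h <;>
      rcases zmod2_cases (T.card : ZMod 2) with h' | h' <;> rw [h, h'] <;> norm_num [koszul]
  refine Fn.hom_ext fun l U => ?_
  have h := superComm_of_mem parityOp_mul_self (contactField_mem n S) (contactField_mem m T)
  have h' : ⁅contactField (mono n S), contactField (mono m T)⁆ₛ = _ := h
  rw [h', hk, ← (isHom_mono n S).contactField_comm (isHom_mono m T) (isHom_mono l U) (hsgn _)
    (hsgn _)]
  rfl

/-! ### A contact field determines its generating function -/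

theorem contactField_t (f : Fn) :
    contactField f (mono 1 ∅) = (2 : ℂ) • f - euler f := by
  have h : ∀ g : Fn, mulFn g (mono 0 ∅) = g := fun g => by
    induction g using Fn.induction with
    | h0 => simp
    | ha _ _ h1 h2 => simp only [map_add, LinearMap.add_apply, h1, h2]
    | hs c _ h1 => simp only [map_smul, LinearMap.smul_apply, h1]
    | hm m T => rw [mulFn_mono_of_disjoint _ _ (by simp)]; simp [invCount]
  rw [contactField_apply, dt_mono, euler_mono]
  simp [dOdd_mono_of_notMem, h]

theorem mulFn_odd_comm (i : Fin 6) (g : Fn) :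
    mulFn (mono 0 {i}) g = mulFn (parityOp g) (mono 0 {i}) := by
  have h := two_smul_mulFn_comm (mono 0 {i}) (parityOp g)
  have hp : parityOp (parityOp g) = g := LinearMap.congr_fun parityOp_mul_self g
  have hi : parityOp (mono 0 {i}) = -mono 0 {i} := by
    rw [parityOp_mono, Finset.card_singleton, pow_one, neg_one_smul]
  rw [hp, hi, map_neg, LinearMap.neg_apply, LinearMap.neg_apply, add_neg_cancel, zero_add,
    sub_neg_eq_add, ← two_smul ℂ] at h
  exact (smul_right_injective Fn (two_ne_zero (α := ℂ)) h).symm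

theorem euler_eq_sum (f : Fn) : euler f = ∑ i : Fin 6, mulFn (mono 0 {i}) (dOdd i f) := by
  induction f using Fn.induction with
  | h0 => simp
  | ha _ _ h1 h2 => simp only [map_add, h1, h2, Finset.sum_add_distrib]
  | hs c _ h1 => simp only [map_smul, h1, Finset.smul_sum]
  | hm n S =>
    have h : ∀ i : Fin 6, mulFn (mono 0 {i}) (dOdd i (mono n S)) =
        if i ∈ S then mono n S else 0 := by
      intro i
      split_ifs with hi
      · rw [dOdd_mono_of_mem n hi, map_smul, mulFn_mono_of_disjoint _ _ (by simp), smul_smul,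
          invCount_singleton_left, ← pow_add, zero_add, ← Finset.insert_eq, Finset.insert_erase hi]
        have : below (S.erase i) i = below S i := by
          rw [below, below, Finset.filter_erase, Finset.erase_eq_of_notMem (by simp)]
        rw [this, ← two_mul, pow_mul]; simp
      · rw [dOdd_mono_of_notMem n hi, map_zero]
    rw [euler_mono, Finset.sum_congr rfl fun i _ => h i, Finset.sum_ite_mem, Finset.univ_inter,
      Finset.sum_const, Nat.cast_smul_eq_nsmul]

theorem contactField_odd (f : Fn) (i : Fin 6) :
    contactField f (mono 0 {i}) = mulFn (dt f) (mono 0 {i}) - dOdd (i + 3) (parityOp f) := by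
  have h1 : ∀ g : Fn, mulFn g (mono 0 ∅) = g := fun g => by
    induction g using Fn.induction with
    | h0 => simp
    | ha _ _ h1 h2 => simp only [map_add, LinearMap.add_apply, h1, h2]
    | hs c _ h1 => simp only [map_smul, LinearMap.smul_apply, h1]
    | hm m T => rw [mulFn_mono_of_disjoint _ _ (by simp)]; simp [invCount]
  have h2 : ∀ j : Fin 6, dOdd j (mono 0 {i}) = if j = i then mono 0 ∅ else 0 := by
    intro j
    split_ifs with h
    · subst h; rw [dOdd_mono_of_mem _ (by simp)]; simp [below, Finset.filter_singleton]
    · exact dOdd_mono_of_notMem _ (by simpa using h)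
  rw [contactField_apply, dt_mono, euler_mono, ← IsHom.sum_add_three]
  simp [IsHom.add_three_add_three, h2, apply_ite, h1]

/-- If `K_f = 0`, then `K_f(t) = 0` says `E f = 2 f`. Applied to the odd coordinates, `K_f = 0`
expresses each derivative of `f` as `∂ₜ f` times a coordinate; inserting this into `E = ∑ θᵢ ∂ᵢ`
gives a multiple of `∑ θᵢ₊₃ θᵢ`, which is zero. So `E f = 0` too, and `f = 0`. -/
theorem contactField_injective : Function.Injective contactField := by
  rw [← LinearMap.ker_eq_bot, LinearMap.ker_eq_bot']
  intro f hf
  have h2 : euler f = (2 : ℂ) • f := by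
    have := contactField_t f
    rw [hf, LinearMap.zero_apply] at this
    exact (sub_eq_zero.1 this.symm).symm
  have hp : parityOp (parityOp f) = f := LinearMap.congr_fun parityOp_mul_self f
  have hd : ∀ i, dOdd (i + 3) (parityOp f) = mulFn (dt f) (mono 0 {i}) := by
    intro i
    have h := contactField_odd f i
    rw [hf, LinearMap.zero_apply] at h
    exact (sub_eq_zero.1 h.symm).symm
  have h0 : euler (parityOp f) = 0 := by
    -- The terms for `i` and `i + 3` cancel since the two coordinates anticommute.
    have h3 : ∀ i : Fin 6, mulFn (mono 0 {i + 3}) (mono 0 {i}) +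
        mulFn (mono 0 {i + 3 + 3}) (mono 0 {i + 3}) = 0 := by
      intro i
      rw [IsHom.add_three_add_three, mulFn_odd_comm i, parityOp_mono]
      simp
    have h6 : ∑ i : Fin 6, mulFn (mono 0 {i + 3}) (mono 0 {i}) = 0 := by
      have h7 := Finset.sum_eq_zero fun i (_ : i ∈ Finset.univ) => h3 i
      rw [Finset.sum_add_distrib,
        IsHom.sum_add_three fun i => mulFn (mono 0 {i + 3}) (mono 0 {i}), ← two_smul ℂ] at h7
      exact (smul_eq_zero.1 h7).resolve_left two_ne_zero
    have h8 : ∀ i : Fin 6, mulFn (mono 0 {i + 3}) (dOdd (i + 3) (parityOp f)) =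
        mulFn (parityOp (dt f)) (mulFn (mono 0 {i + 3}) (mono 0 {i})) := by
      intro i
      rw [hd, ← mulFn_assoc, mulFn_odd_comm, mulFn_assoc]
    rw [euler_eq_sum, ← IsHom.sum_add_three, Finset.sum_congr rfl fun i _ => h8 i, ← map_sum, h6,
      map_zero]
  have h4 : euler (parityOp f) = parityOp (euler f) := by
    rw [euler_eq_sum, euler_eq_sum, map_sum]
    simp only [parityOp_mulFn, parityOp_dOdd, parityOp_mono]
    simp
  rw [h4, h2, map_smul] at h0
  have h5 := (smul_eq_zero.1 h0).resolve_left two_ne_zero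
  rw [← hp, h5, map_zero]

/-! ### Computing with monomials

The label `64 (n + 4) + S + 4096 e` stands for `t ^ (n + e N)` times the odd coordinates whose
indices are the bits of `S < 64`, where `N` is a parameter and coefficients are polynomials in `N`.
Only the label `282` stands for the sum of its monomial and the one of `300`, so that the labels
accepted by `isLab` form a basis of the positive part. The pair of `a` and `b` has the code
`8192 a + b`, and a linear map is shown to preserve the brackets of all pairs by working out, by
increasing height, which pairs are settled by the relations and the Jacobi identity. -/

/-- Polynomials in one variable as lists of coefficients. -/
def polyAdd : List ℤ → List ℤ → List ℤ
  | [], q => q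
  | p, [] => p
  | a :: p, b :: q => (a + b) :: polyAdd p q

/-- The multiple of a polynomial by a number. -/
def polyScale (c : ℤ) : List ℤ → List ℤ
  | [] => []
  | a :: p => (c * a) :: polyScale c p

/-- The product of polynomials. -/
def polyMul : List ℤ → List ℤ → List ℤ
  | [], _ => []
  | a :: p, q => polyAdd (polyScale a q) (0 :: polyMul p q)

/-- Formal linear combinations. -/
abbrev Comb := List (List ℤ × ℕ)

/-- The number of bits of a number below `64`. -/
def bitCount (m : ℕ) : ℕ :=
  Nat.add (Nat.mod m 2) (Nat.add (Nat.mod (Nat.div m 2) 2) (Nat.add (Nat.mod (Nat.div m 4) 2)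
    (Nat.add (Nat.mod (Nat.div m 8) 2) (Nat.add (Nat.mod (Nat.div m 16) 2)
      (Nat.mod (Nat.div m 32) 2)))))

/-- The number of inversions between the bits of two numbers below `64`. -/
def bitInv (S T : ℕ) : ℕ :=
  S / 2 % 2 * (T % 2) + (S / 4 % 2 * bitCount (T % 4) + (S / 8 % 2 * bitCount (T % 8) +
    (S / 16 % 2 * bitCount (T % 16) + S / 32 % 2 * bitCount (T % 32))))

/-- The sign `(-1) ^ k`. -/
def intSign (k : ℕ) : ℤ := bif Nat.beq (Nat.mod k 2) 0 then 1 else -1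

/-- Evaluate a number before passing it on. -/
def force {α : Type} (n : ℕ) (f : ℕ → α) : α := Nat.rec (f 0) (fun k _ => f (Nat.succ k)) n

/-- Add `p` times the monomial `k`, in terms of the basis. -/
def pushMono (p : List ℤ) (k : ℕ) (l : Comb) : Comb :=
  bif Nat.beq k 282 then (p, 282) :: (polyScale (-1) p, 300) :: l else (p, k) :: l

/-- The term of the bracket of two monomials that removes the bits `p` and `q`. -/
def poissonTerm (p q S T h : ℕ) (l : Comb) : Comb :=
  bif Nat.beq (Nat.land S p) 0 then l else bif Nat.beq (Nat.land T q) 0 then l else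
  bif Nat.beq (Nat.land (Nat.sub S p) (Nat.sub T q)) 0 then
    pushMono [intSign (1 + (bitCount S + (bitCount (S % p) + (bitCount (T % q) + bitInv (S - p) (T - q)))))]
      (Nat.add (Nat.mul 64 (Nat.sub h 4)) (Nat.lor (Nat.sub S p) (Nat.sub T q))) l
  else l

/-- The term of the bracket of two monomials that contains their product. -/
def unionTerm (S T h k : ℕ) (l : Comb) : Comb :=
  bif Nat.beq (Nat.land S T) 0 then
    pushMono [intSign (bitInv S T) * ((2 - (bitCount S : ℤ)) * ((k % 64 : ℕ) - 4 : ℤ) -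
        (2 - (bitCount T : ℤ)) * ((h % 64 : ℕ) - 4 : ℤ)),
       intSign (bitInv S T) * ((2 - (bitCount S : ℤ)) * (k / 64 : ℕ) -
        (2 - (bitCount T : ℤ)) * (h / 64 : ℕ))]
      (Nat.add (Nat.mul 64 (Nat.sub (Nat.add h k) 5)) (Nat.lor S T)) l
  else l

/-- The terms of the bracket of two monomials that pair odd coordinates. -/
def poissonTerms (S T h : ℕ) (l : Comb) : Comb :=
  poissonTerm 1 8 S T h (poissonTerm 2 16 S T h (poissonTerm 4 32 S T h
    (poissonTerm 8 1 S T h (poissonTerm 16 2 S T h (poissonTerm 32 4 S T h l)))))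

/-- The bracket of two monomials, added to `l`. -/
def monoBracket (a b : ℕ) (l : Comb) : Comb :=
  force (Nat.mod a 64) fun S => force (Nat.mod b 64) fun T => force (Nat.div a 64) fun h =>
    force (Nat.div b 64) fun k => unionTerm S T h k (force (Nat.add h k) fun h => poissonTerms S T h l)

/-- The bracket of a monomial and a basis vector, added to `l`. -/
def labBracketAux (a b : ℕ) (l : Comb) : Comb :=
  bif Nat.beq b 282 then monoBracket a 282 (monoBracket a 300 l) else monoBracket a b l

/-- The bracket of two basis vectors. -/
def labBracket (a b : ℕ) : Comb :=
  bif Nat.beq a 282 then labBracketAux 282 b (labBracketAux 300 b []) else labBracketAux a b []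

/-- Add a term to a combination, collecting like terms. -/
def Comb.insert (p : List ℤ) (a : ℕ) : Comb → Comb
  | [] => [(p, a)]
  | x :: l => bif Nat.beq a x.2 then (polyAdd p x.1, a) :: l else x :: Comb.insert p a l

/-- Whether a label is odd. -/
def isOdd (a : ℕ) : Bool := Nat.beq (Nat.mod (bitCount (Nat.mod a 64)) 2) 1

/-- The Koszul sign of two labels. -/
def pairSign (a b : ℕ) : ℤ := bif isOdd a && isOdd b then -1 else 1

/-- Membership in a list of numbers. -/
def memNat (a : ℕ) : List ℕ → Bool
  | [] => false
  | b :: l => bif Nat.beq a b then true else memNat a l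

/-- Whether a pair consists of the same even label twice. -/
def trivialPair (q : ℕ) : Bool := Nat.beq (Nat.div q 8192) (Nat.mod q 8192) && !isOdd (Nat.mod q 8192)

/-- Add `p` times the pair with code `q` unless it is known to vanish. -/
def pushPair (known : List ℕ) (p : List ℤ) (q : ℕ) (l : Comb) : Comb :=
  bif memNat q known then l else bif trivialPair q then l else Comb.insert p q l

/-- Add `p` times the pair `(a, b)`, in normal order, unless it is known to vanish. -/
def addPair (known : List ℕ) (p : List ℤ) (a b : ℕ) (l : Comb) : Comb :=
  bif Nat.ble a b then force (Nat.add (Nat.mul 8192 a) b) fun q => pushPair known p q l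
  else force (Nat.add (Nat.mul 8192 b) a) fun q => pushPair known (polyScale (-pairSign a b) p) q l

/-- Add `m` times the pairs of `a` and a combination. -/
def addLeft (known : List ℕ) (m : List ℤ) (a : ℕ) (l : Comb) : Comb → Comb
  | [] => l
  | x :: c => addPair known (polyMul m x.1) a x.2 (addLeft known m a l c)

/-- Add `m` times the pairs of a combination and `b`. -/
def addRight (known : List ℕ) (m : List ℤ) (b : ℕ) (l : Comb) : Comb → Comb
  | [] => l
  | x :: c => addPair known (polyMul m x.1) x.2 b (addRight known m b l c)

/-- Add `m` times the Jacobi identity of `a`, `b` and `c`. -/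
def addJacobi (known : List ℕ) (m : List ℤ) (a b c : ℕ) (l : Comb) : Comb :=
  addLeft known m a
    (addRight known (polyScale (-1) m) c
      (addLeft known (polyScale (-pairSign a b) m) b l (labBracket a c)) (labBracket a b))
    (labBracket b c)

/-- Bracket expressions in the generators. -/
inductive Tree
  | gen (i : ℕ)
  | br (s t : Tree)

/-- The bracket of two combinations of basis vectors. -/
def combBracket (l m : Comb) : Comb :=
  l.flatMap fun x => m.flatMap fun y =>
    (labBracket x.2 y.2).map fun z => (polyMul (polyMul x.1 y.1) z.1, z.2)

/-- The value of a bracket expression as a combination of basis vectors. -/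
def Tree.comb : Tree → Comb
  | .gen i => [([1], i)]
  | .br s t => combBracket s.comb t.comb

/-- Add `m` times the outermost pair of a bracket expression. -/
def addTree (known : List ℕ) (m : List ℤ) : Tree → Comb → Comb
  | .gen _, l => l
  | .br s t, l => s.comb.foldr (fun x l => addLeft known (polyMul m x.1) x.2 l t.comb) l

/-- Add `m` times the outermost pairs of a combination of bracket expressions. -/
def addTrees (known : List ℕ) (m : List ℤ) (l : Comb) : List (ℤ × Tree) → Comb
  | [] => l
  | x :: r => addTree known (polyScale x.1 m) x.2 (addTrees known m l r)

/-- The generator `X₀`. -/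
def X0 := Tree.gen 328
/-- The generator `X₁`. -/
def X1 := Tree.gen 273
/-- The generator `X₂`. -/
def X2 := Tree.gen 290
/-- The generator `X₃`. -/
def X3 := Tree.gen 262
/-- The generator `X̃₀`. -/
def Y0 := Tree.gen 312
/-- The generator `X̃₁`. -/
def Y1 := Tree.gen 245
/-- The generator `X̃₂`. -/
def Y2 := Tree.gen 235
/-- The generator `X̃₃`. -/
def Y3 := Tree.gen 207
infixl:70 " ⋆ " => Tree.br

/-- The defining relations. -/
def relTrees : List (List (ℤ × Tree)) :=
  [[(1, X2 ⋆ X3)], [(1, X2 ⋆ X0)], [(1, X3 ⋆ X0)], [(1, X0 ⋆ X0)],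
   [(1, X1 ⋆ (X1 ⋆ X2))], [(1, X1 ⋆ (X1 ⋆ X3))], [(1, X1 ⋆ (X1 ⋆ X0))], [(1, X2 ⋆ (X2 ⋆ X1))],
   [(1, X3 ⋆ (X3 ⋆ X1))],
   [(1, X1 ⋆ Y0)], [(1, X1 ⋆ Y1)], [(1, X2 ⋆ Y0)], [(1, X2 ⋆ Y2)], [(1, X2 ⋆ Y3)],
   [(1, X3 ⋆ Y2)], [(1, X3 ⋆ Y3)], [(1, X0 ⋆ Y0)], [(1, Y0 ⋆ Y0)], [(1, Y0 ⋆ Y1)],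
   [(1, Y0 ⋆ Y2)], [(1, Y1 ⋆ Y2)], [(1, Y1 ⋆ Y3)], [(1, Y2 ⋆ Y3)],
   [(1, X2 ⋆ Y1), (1, X1 ⋆ Y2)], [(1, X3 ⋆ Y1), (1, X1 ⋆ Y3)],
   [(1, X3 ⋆ (X3 ⋆ Y0)), (-2, X0 ⋆ Y3)],
   [(1, Y0 ⋆ (X0 ⋆ Y3))], [(1, Y1 ⋆ (X1 ⋆ X2))], [(1, Y1 ⋆ (X1 ⋆ X3))], [(1, Y1 ⋆ (X1 ⋆ X0))],
   [(1, Y2 ⋆ (X1 ⋆ X2))], [(1, Y3 ⋆ (X1 ⋆ X3))], [(1, Y3 ⋆ (X3 ⋆ Y0))], [(1, Y3 ⋆ (X0 ⋆ Y2))],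
   [(1, Y1 ⋆ (Y1 ⋆ X0))], [(1, Y2 ⋆ (Y2 ⋆ X0))], [(1, Y3 ⋆ (Y3 ⋆ X0))], [(1, Y3 ⋆ (Y3 ⋆ Y0))],
   [(1, (X1 ⋆ X2) ⋆ (X3 ⋆ Y0)), (2, Y2 ⋆ (X0 ⋆ Y1)), (1, X0 ⋆ (X1 ⋆ Y2)), (1, Y2 ⋆ (X1 ⋆ X0))],
   [(1, (X1 ⋆ X2) ⋆ (X0 ⋆ Y2))], [(1, (X1 ⋆ X3) ⋆ (X0 ⋆ Y3))],
   [(1, (X1 ⋆ Y2) ⋆ (X0 ⋆ Y2))], [(1, (X1 ⋆ Y3) ⋆ (X0 ⋆ Y3))],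
   [(1, (X1 ⋆ Y2) ⋆ (X3 ⋆ Y0)), (-1, Y2 ⋆ (X0 ⋆ Y1))],
   [(1, (X0 ⋆ Y3) ⋆ (Y2 ⋆ (X0 ⋆ Y1)))],
   [(1, (X0 ⋆ Y3) ⋆ (Y2 ⋆ (X1 ⋆ X0))), (1, (X0 ⋆ Y3) ⋆ (X0 ⋆ (X1 ⋆ Y2)))],
   [(2, (X1 ⋆ Y2) ⋆ (X0 ⋆ Y3)), (2, Y3 ⋆ (X0 ⋆ (X1 ⋆ X2))), (1, (X1 ⋆ X3) ⋆ (X0 ⋆ Y2)),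
     (-1, (X1 ⋆ X2) ⋆ (X0 ⋆ Y3))],
   [(2, (X1 ⋆ Y3) ⋆ (X0 ⋆ Y2)), (-2, Y3 ⋆ (X0 ⋆ (X1 ⋆ X2))), (1, (X1 ⋆ X2) ⋆ (X0 ⋆ Y3)),
     (-1, (X1 ⋆ X3) ⋆ (X0 ⋆ Y2))]]

/-- The degree of a label. -/
def labDeg (a : ℕ) : ℕ :=
  Nat.sub (Nat.add (Nat.mul 2 (Nat.mod (Nat.div a 64) 64)) (bitCount (Nat.mod a 64))) 10

/-- The value of the weight of a label on `(2, 1, 0)`, increased by `6`. -/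
def labWt (a : ℕ) : ℕ :=
  Nat.sub (Nat.sub (Nat.add 6 (Nat.add (Nat.mul 2 (Nat.mod a 2)) (Nat.mod (Nat.div a 2) 2)))
    (Nat.mul 2 (Nat.mod (Nat.div a 8) 2))) (Nat.mod (Nat.div a 16) 2)

/-- Whether `a` is the label of a basis vector. -/
def isLab (a : ℕ) : Bool :=
  force (Nat.mod (Nat.div a 64) 64) fun h =>
    Nat.ble 3 h && (Nat.ble h 20 && (Nat.ble 10 (Nat.add (Nat.mul 2 h) (bitCount (Nat.mod a 64))) &&
      bif Nat.beq (labDeg a) 0 then Nat.ble 7 (labWt a)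
      else !Nat.beq a 284 && !Nat.beq a 300))

/-- Whether all the coefficients vanish. -/
def isZeroPoly : List ℤ → Bool
  | [] => true
  | a :: p => decide (a = 0) && isZeroPoly p

/-- Whether all the coefficients are nonnegative. -/
def nonnegPoly : List ℤ → Bool
  | [] => true
  | a :: p => decide (0 ≤ a) && nonnegPoly p

/-- Whether the constant term is positive and the other coefficients are nonnegative. -/
def posPoly : List ℤ → Bool
  | [] => false
  | a :: p => decide (0 < a) && nonnegPoly p

/-- Whether a polynomial evidently has no zeros on the nonnegative numbers. -/
def nonvanishing (p : List ℤ) : Bool := posPoly p || posPoly (polyScale (-1) p)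

/-- The terms with nonzero coefficients. -/
def nonzeroTerms : Comb → Comb
  | [] => []
  | x :: l => bif isZeroPoly x.1 then nonzeroTerms l else x :: nonzeroTerms l

/-- Whether the vanishing of a combination implies that of the term `t`. -/
def determines (t : ℕ) (l : Comb) : Bool :=
  match nonzeroTerms l with
  | [x] => Nat.beq x.2 t && nonvanishing x.1
  | _ => false

/-- Whether labels have given total degree and weight. -/
def validTriple (tail D w a b c : ℕ) : Bool :=
  isLab a && (isLab b && (isLab c && (Nat.ble (Nat.mul 2 tail) (labDeg c) &&
    (Nat.beq (Nat.add (Nat.add (labDeg a) (labDeg b)) (labDeg c)) D &&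
      -- Each label's weight is stored with an offset of `6`, and so is `w`; three labels therefore
      -- exceed `w` by `12`.
      Nat.beq (Nat.add (Nat.add (labWt a) (labWt b)) (labWt c)) (w + 12)))))

/-- The height of a label. -/
def labHt (a : ℕ) : ℕ := Nat.sub (Nat.add (Nat.mul 4 (labDeg a)) (labWt a)) 6

/-- The height of a bracket expression. -/
def Tree.height : Tree → ℕ
  | .gen i => labHt i
  | .br s t => Nat.add s.height t.height

/-- Whether the heights of bracket expressions, increased by `6`, are at most `h`. -/
def lowTrees (h : ℕ) : List (ℤ × Tree) → Bool
  | [] => true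
  | x :: r => Nat.ble (Nat.add x.2.height 6) h && lowTrees h r

/-- Add `m` times a relation or a Jacobi identity. -/
def addItem (tail D w : ℕ) (known : List ℕ) (m : List ℤ) (code : ℕ) (l : Comb) : Comb :=
  -- Codes below `48` number the relations. A larger code packs a triple for the Jacobi identity
  -- into fields of nine, nine and ten bits; only the third label may carry the shift by `N`.
  bif Nat.blt code 48 then 
    bif lowTrees (Nat.add (Nat.mul 4 D) w) (relTrees.getD code []) then
      addTrees known m l (relTrees.getD code [])
    else l
  else force (Nat.mod code 512) fun a => force (Nat.mod (Nat.div code 512) 512) fun b =>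
    force (Nat.mod (Nat.div code 262144) 1024) fun c =>
      bif validTriple tail D w a b c then
        force (Nat.add c (Nat.mul 4096 tail)) fun c => addJacobi known m a b c l
      else l

/-- The sum of multiples of relations and Jacobi identities. -/
def addItems (tail D w : ℕ) (known : List ℕ) : List (List ℤ × ℕ) → Comb
  | [] => []
  | x :: r => addItem tail D w known x.1 x.2 (addItems tail D w known r)

/-- Whether each step determines a new pair from the previous ones. -/
def checkSteps (tail D w : ℕ) : List ℕ → List (ℕ × List (List ℤ × ℕ)) → Bool
  | _, [] => true
  | known, s :: r => determines s.1 (addItems tail D w known s.2) &&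
      checkSteps tail D w (s.1 :: known) r

/-- Check the stages of degree `D` in the order of their weights. -/
def checkStages (tail D : ℕ) : ℕ → List (List ℕ × List (ℕ × List (List ℤ × ℕ))) → Bool
  | _, [] => true
  | w, s :: r => checkSteps tail D w s.1 s.2 && checkStages tail D (w + 1) r

/-- The labels of the generators. -/
def genKeys : List ℕ := [328, 273, 290, 262, 312, 245, 235, 207]

/-- Expressions of labels as combinations of brackets. -/
abbrev Table := List (ℕ × List (ℤ × ℕ))

/-- Pairs with vanishing defect, followed by derivations of further such pairs. -/
abbrev Stage := List ℕ × List (ℕ × List (List ℤ × ℕ))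

/-- Whether brackets involve known labels and have the height and parity of `k`. -/
def validItems (known : List ℕ) (k : ℕ) : List (ℤ × ℕ) → Bool
  | [] => true
  | x :: r => memNat (x.2 / 8192) known && (memNat (x.2 % 8192) known && (
      Nat.beq (labHt (x.2 / 8192) + labHt (x.2 % 8192)) (labHt k) &&
      Nat.beq ((bitCount (x.2 / 8192 % 64) + bitCount (x.2 % 8192 % 64)) % 2)
        (bitCount (k % 64) % 2))) && validItems known k r

/-- Whether the table expresses labels as combinations of brackets of previous labels. -/
def validTable (known : List ℕ) : Table → Bool
  | [] => true
  | x :: r => !memNat x.1 known && isLab x.1 && Nat.blt x.1 576 && Nat.ble (labDeg x.1) 4 && validItems known x.1 x.2 &&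
      validTable (x.1 :: known) r

/-- Add `m` times a combination to another one. -/
def insertAll (m : List ℤ) (l : Comb) : Comb → Comb
  | [] => l
  | x :: c => Comb.insert (polyMul m x.1) x.2 (insertAll m l c)

/-- Collect the terms of a combination. -/
def normalize (l : Comb) : Comb := nonzeroTerms (insertAll [1] [] l)

/-- Add a combination of brackets to a combination of basis vectors. -/
def expandItems (l : Comb) : List (ℤ × ℕ) → Comb
  | [] => l
  | x :: r => insertAll [x.1] (expandItems l r) (labBracket (x.2 / 8192) (x.2 % 8192))

/-- Whether the combinations of brackets in the table are multiples of the basis vectors. -/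
def correctTable : Table → Bool
  | [] => true
  | x :: r => (nonzeroTerms (expandItems [([-12], x.1)] x.2)).isEmpty && correctTable r

/-- The entry of a label in a table. -/
def lookup (k : ℕ) : Table → List (ℤ × ℕ)
  | [] => []
  | x :: r => bif Nat.beq k x.1 then x.2 else lookup k r

/-- A table entry as a formal combination. -/
def itemComb : List (ℤ × ℕ) → Comb
  | [] => []
  | x :: r => ([x.1], x.2) :: itemComb r

/-- Replace labels by their table entries. -/
def expandTable (t : Table) (l : Comb) : Comb → Comb
  | [] => l
  | x :: c => insertAll x.1 (expandTable t l c) (itemComb (lookup x.2 t))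

/-- Whether the bracket of a pair is a combination of brackets by definition. -/
def definitional (t : Table) (q : ℕ) : Bool :=
  isLab (q / 8192) && isLab (q % 8192) && Nat.blt (q / 8192) 576 && Nat.blt (q % 8192) 576 &&
  Nat.ble (labDeg (q / 8192)) 4 && Nat.ble (labDeg (q % 8192)) 4 &&
  -- A label without an entry, such as a generator, would be replaced by zero, so its occurrence has
  -- to be excluded.
  (normalize (labBracket (q / 8192) (q % 8192))).all (fun x => !(lookup x.2 t).isEmpty) &&
  (nonzeroTerms (expandTable t [([-12], q)] (normalize (labBracket (q / 8192) (q % 8192))))).isEmpty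

/-- Whether a pair consists of `t ^ 2` and a label of degree at least `3`. -/
def tailPair (q : ℕ) : Bool :=
  Nat.beq (q / 8192) 384 && Nat.beq (q % 8192 / 4096) 1 && isLab (q % 4096) &&
    Nat.ble 3 (labDeg (q % 4096))

/-- All the pairs that a stage treats. -/
def knownPairs (s : Stage) : List ℕ := s.1 ++ s.2.map Prod.fst

/-- Whether a pair is trivial or in a list, up to order. -/
def hasPair (known : List ℕ) (a b : ℕ) : Bool :=
  bif Nat.ble a b then force (Nat.add (Nat.mul 8192 a) b) fun q => trivialPair q || memNat q known
  else force (Nat.add (Nat.mul 8192 b) a) fun q => memNat q known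

/-- The code of the exponent of a monomial of degree `d` with odd part `S`. -/
def exponentOf (d S : ℕ) : ℕ := (d + 10 - bitCount S) / 2

/-- Whether the stages treat all the pairs of a generator and a label. -/
def coversGen (tail D : ℕ) (l : List (List ℕ)) (g : ℕ) : Bool :=
  (List.range 64).all fun S => force (64 * exponentOf (D - labDeg g) S + S) fun v =>
    bif Nat.beq (labDeg v + labDeg g) D && isLab v then
      -- Stages are indexed by the total weight with one offset of `6`, whereas the two labels bring
      -- two offsets.
      hasPair (l.getD (labWt g + labWt v - 6) []) g (v + 4096 * tail)
    else true

/-- Whether the stages treat all the pairs of generators and labels. -/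
def covers (tail D : ℕ) (l : List Stage) : Bool :=
  genKeys.all (coversGen tail D (l.map knownPairs))

/-- The labels of degree at most `1`. -/
def lowKeys : List ℕ := (List.range 512).filter fun a => isLab a && Nat.ble (labDeg a) 1

/-- Whether the bracket of two labels of low degree is in the positive part. -/
def gradedPair (a b : ℕ) : Bool :=
  bif Nat.ble (labDeg a + labDeg b) 1 then
    (normalize (labBracket a b)).all fun x => isLab x.2 &&
      (Nat.ble x.2 4095 && Nat.beq (labHt x.2) (labHt a + labHt b))
  else true

/-- Whether a bracket expression has labels in the range of the computation. -/
def validTree : Tree → Bool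
  | .gen i => memNat i genKeys
  | .br s t => s.comb.all (fun x => Nat.ble 192 x.2 && Nat.blt x.2 576) &&
      t.comb.all (fun x => Nat.ble 192 x.2 && Nat.blt x.2 576) && validTree s && validTree t

/-- The value of a combination of bracket expressions. -/
def insertTrees : List (ℤ × Tree) → Comb
  | [] => []
  | x :: r => insertAll [x.1] (insertTrees r) x.2.comb

/-- Twelve times the labels of degree at most `4`, other than generators, as brackets. -/
def defTable : List (ℕ × List (ℤ × ℕ)) :=
  [(215, [(12, 1696017)]), (243, [(12, 1925393)]), (261, [(-12, 2146577)]), (289, [(12,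
  2236706)]), (231, [(12, 1761570)]), (259, [(-12, 2138402)]), (254, [(-12, 1696056)]), (282,
  [(12, 2146616)]), (253, [(-12, 2081041)]), (270, [(-12, 1696072)]), (281, [(12, 2081041), (-12,
  2007368), (12, 2236698)]), (298, [(-12, 1925448)]), (308, [(12, 2081041), (-12, 2007368)]),
  (336, [(-12, 2236744)]), (223, [(12, 2072838)]), (251, [(-12, 2072866)]), (269, [(12,
  2146585)]), (278, [(12, 2146612)]), (297, [(12, 2302242)]), (306, [(12, 2375988)]), (324, [(-12,
  2138440)]), (352, [(-12, 2367816)]), (239, [(12, 1827106)]), (267, [(-12, 2203938)]), (277,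
  [(12, 2203921)]), (294, [(12, 2277666)]), (305, [(-12, 2236713)]), (322, [(-12, 2122056)]),
  (247, [(12, 1958161)]), (275, [(12, 2187537)]), (293, [(12, 2236710)]), (321, [(12, 2236738)]),
  (263, [(-12, 2146579)]), (291, [(12, 2253090)]), (316, [(-12, 2523464)]), (344, [(12,
  2302280)]), (286, [(12, 2277704)]), (314, [(-12, 2507080)]), (332, [(12, 2203976)]), (360, [(12,
  2433352)]), (285, [(12, 2236702)]), (302, [(12, 2408776)]), (313, [(12, 2236730)]), (330, [(12,
  2187592)]), (340, [(-12, 2236748)]), (368, [(-12, 2236776)]), (255, [(6, 2400584), (-6,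
  2023752), (-6, 2236718), (3, 2376020), (3, 2146672)]), (283, [(12, 2253128), (-6, 2376020), (6,
  2146672)]), (301, [(12, 2400584), (6, 2376020), (6, 2146672)]), (310, [(12, 2400584), (-12,
  2236718), (6, 2376020), (6, 2146672)]), (329, [(12, 2236746), (6, 2376020), (-6, 2146672)]),
  (338, [(6, 2376020), (-6, 2146672)]), (356, [(-6, 2376020), (-6, 2146672)]), (384, [(12,
  2629960)]), (271, [(12, 2146587)]), (299, [(12, 2318626)]), (309, [(-12, 2236717)]), (326,
  [(-12, 2146642)]), (337, [(-12, 2236745)]), (354, [(-12, 2376018)]), (279, [(12, 2220305)]),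
  (307, [(-12, 2236715)]), (325, [(12, 2236742)]), (353, [(12, 2236770)]), (295, [(12, 2285858)]),
  (323, [(12, 2376005)]), (348, [(-12, 2687316)]), (376, [(12, 2687344)]), (318, [(-6, 2539848)]),
  (346, [(-12, 2687314)]), (364, [(-12, 2687332)]), (392, [(12, 2687305)]), (317, [(12,
  2236734)]), (334, [(-12, 2670920)]), (345, [(12, 2236762)]), (362, [(-12, 2687330)]), (372,
  [(-12, 2236780)]), (400, [(-12, 2236808)]), (287, [(-12, 2146621)]), (315, [(12, 2375997)]),
  (333, [(12, 2146649)]), (342, [(12, 2146676)]), (361, [(-12, 2376025)]), (370, [(12, 2376052)]),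
  (388, [(-12, 2146704)]), (416, [(-12, 2376080)]), (303, [(12, 2351394)]), (331, [(12,
  2376013)]), (341, [(-12, 2236749)]), (358, [(-12, 2376022)]), (369, [(-12, 2236777)]), (386,
  [(12, 2376068)]), (311, [(-12, 2236719)]), (339, [(-12, 2236747)]), (357, [(12, 2236774)]),
  (385, [(12, 2236802)]), (327, [(-12, 2146643)]), (355, [(-12, 2376019)]), (380, [(-3,
  2589056)]), (408, [(-6, 2818432)]), (350, [(-3, 2343296)]), (378, [(-3, 2572672)]), (396, [(-6,
  2720128)]), (424, [(-6, 2949504)]), (349, [(-3, 2335104)]), (366, [(-3, 2474368)]), (377, [(-3,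
  2564480)]), (394, [(-6, 2703744)]), (404, [(-6, 2785664)]), (432, [(-6, 3015040)]), (319, [(-2,
  2089344)]), (347, [(-3, 2318720)]), (365, [(-3, 2466176)]), (374, [(-3, 2539904)]), (393, [(-6,
  2695552)]), (402, [(-6, 2769280)]), (420, [(-6, 2916736)]), (448, [(-6, 2695552), (12,
  2687361)]), (335, [(-3, 2220416)]), (363, [(-3, 2449792)]), (373, [(-3, 2531712)]), (390, [(-6,
  2670976)]), (401, [(-6, 2761088)]), (418, [(-6, 2900352)]), (343, [(-3, 2285952)]), (371, [(-3,
  2515328)]), (389, [(-6, 2662784)]), (417, [(-6, 2892160)]), (359, [(-3, 2417024)]), (387, [(-6,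
  2646400)])]

/-- The derivations for pairs of total degree `0`, by weight. -/
def stages0 : List (List ℕ × List (ℕ × List (List ℤ × ℕ))) :=
  [([], []),
   ([], []),
   ([], []),
   ([], []),
   ([], []),
   ([], []),
   ([], []),
   ([], []),
   ([1696017, 1925393, 2146577, 2236706], [(2146594, [([1], 0)]), (2007313, [([1], 10)]),
   (1925410, [([1], 12)]), (1696034, [([1], 13)]), (1925382, [([1], 14)]), (1696006, [([1], 15)]),
   (1925365, [([1], 20)]), (1695989, [([1], 21)]), (1695979, [([1], 22)]), (2007330, [([1], 23)]),
   (2007302, [([1], 24)])]),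
   ([1761570, 2138402], [(2236705, [([1], 4)]), (2138385, [([1], 5)]), (2367778, [([1], 7)]),
   (2138374, [([1], 8)]), (2007329, [([1], 27)]), (2007301, [([1], 28)]), (1925409, [([1], 30)]),
   (1696005, [([1], 31)]), (1695959, [([1], 68807375)]), (1761525, [([1], 71690959)]), (1695987,
   [([1], 76147407)]), (1761515, [([1], 68807403)]), (1990901, [([1], 71690987)]), (1925363,
   [([1], 76147435)]), (1761542, [([1], 71699663)]), (1696033, [([1], 76161743)]), (1990946,
   [([1], 76161771)]), (1761553, [([1], 71699701)]), (1990918, [([1], 76156149)]), (1990929,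
   [([1], 76161781)]), (2146593, [([1], 76161798)]), (1925381, [([1], 71699691)])]),
   ([], [(1695975, [([1], 76132047)]), (1892587, [([1], 75880143)]), (1892597, [([1], 75885263)]),
   (1696003, [([1], 76155599)]), (1892642, [([1], 76169935)]), (1892614, [([1], 76156119)]),
   (1925379, [([1], 75893995)]), (2121990, [([1], 76156165)]), (2122018, [([1], 76169990)]),
   (1761569, [([1], 75899599), ([-1], 76161751)]), (1892625, [([1], 75899599)]), (1990917, [([1],
   71699179)]), (2007299, [([1], 76155637)]), (2122001, [([1], 76161797), ([-1], 75899654)])]),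
   ([], []),
   ([], [])]

/-- The derivations for pairs of total degree `1`, by weight. -/
def stages1 : List (List ℕ × List (ℕ × List (List ℤ × ℕ))) :=
  [([], []),
   ([], []),
   ([], []),
   ([], []),
   ([1696056, 2146616], [(2236728, [([1], 9)]), (2375992, [([1], 11)]), (2007352, [([1], 18)]),
   (1925432, [([1], 19)])]),
   ([2081041, 1696072, 2007368, 2236698, 1925448, 2236744], [(2376008, [([1], 1)]), (2146632,
   [([1], 2)]), (1696026, [([1], 32)]), (1695998, [([1], 37)]), (1925374, [([1], 81909455)]),
   (2007294, [([1], 81914575)]), (2081058, [([1], 81937615)]), (1925402, [([1], 81923307)]),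
   (1990968, [([1], 81928939)]), (2310434, [([1], 81937670)]), (2367800, [([1], 81937681)]),
   (2146586, [([1], 25)]), (2081030, [([1], 81923279)]), (1761592, [([1], 81928911)]), (2007322,
   [([1], 81923317)]), (2138424, [([1], 81928966)])]),
   ([2072838, 2072866, 2146585, 2146612, 2302242, 2375988, 2138440, 2367816], [(2236752, [([1],
   6)]), (2007376, [([1], 29)]), (1696042, [([1], 33)]), (1925418, [([1], 35)]), (1696014, [([1],
   36)]), (1695997, [([1], 74050255)]), (2146574, [([1], 86117583)]), (2212130, [([1],
   86131919)]), (1925373, [([1], 81909463)]), (2007293, [([1], 81914583)]), (2072849, [([1],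
   81928919)]), (2146602, [([1], 86117611)]), (1925390, [([1], 74058987)]), (2375978, [([1],
   86131947)]), (2007348, [([1], 34)]), (1761562, [([1], 81923287)]), (1892664, [([1],
   81937623)]), (1990938, [([1], 81923315)]), (2007321, [([1], 81922805)]), (2081029, [([1],
   71699710)]), (2146640, [([1], 86123270)]), (2376016, [([1], 86131985)]), (1925428, [([1],
   43)]), (2007338, [([1], 86108907)]), (1925401, [([1], 81922795)]), (1761608, [([1],
   86117621)]), (2007310, [([1], 74058997)]), (2236724, [([1], 86123253)]), (1990984, [([1],
   86131957)]), (2138394, [([1], 81923333)]), (2122040, [([1], 81937669)]), (2310433, [([1],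
   76166417)]), (2212113, [([1], 74064646)]), (1925456, [([1], 38)]), (2236697, [([1],
   81928965)]), (1696052, [([1], 86108879)]), (1696025, [([1], 81922767)]), (1696080, [([1],
   86123215)]), (2236714, [([1], 86123243)])]),
   ([1827106, 2203938, 2203921, 2277666, 2236713, 2122056], [(2367786, [([1], 39)]), (2138382,
   [([1], 40)]), (1695967, [([1], 74034895)]), (1695995, [([1], 74049231)]), (1827061, [([1],
   80865999)]), (1696013, [([1], 73796815)]), (1696041, [([1], 76165839)]), (1827051, [([1],
   74045143)]), (2072865, [([1], 81937111)]), (1925371, [([1], 81909479)]), (2007291, [([1],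
   81914599)]), (2056465, [([1], 81928935)]), (2056482, [([1], 81937639)]), (1925389, [([1],
   73796843)]), (1925417, [([1], 76165867)]), (1827078, [([1], 68815614)]), (2146628, [([1],
   86117637)]), (2376032, [([1], 86132001)]), (2007309, [([1], 88206031)]), (1696068, [([1],
   86117071)]), (1696022, [([1], 74058447)]), (1696050, [([1], 80889039)]), (2146582, [([1],
   86117591)]), (1892634, [([1], 76166359)]), (2056454, [([1], 81923303)]), (2007337, [([1],
   88206059)]), (1925426, [([1], 81921771)]), (1925398, [([1], 80874731)]), (1925472, [([1],
   86131435)]), (2375986, [([1], 86131955)]), (2007346, [([1], 81921781)]), (2236722, [([1],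
   81928963)]), (2375977, [([1], 81937667)]), (2376004, [([1], 86131973)]), (2146601, [([1],
   76165894)]), (2146656, [([1], 86131462)]), (2146610, [([1], 80889094)]), (2367796, [([1],
   80889105)]), (2146573, [([1], 88214735)]), (1696096, [([1], 88229071)]), (1892680, [([1],
   86131927)]), (1925444, [([1], 88214763)]), (2007392, [([1], 86131445)]), (2138448, [([1],
   86123269), ([-1], 88220422)]), (2236740, [([1], 86123269)]), (2236768, [([1], 86131473), ([1],
   88229137)]), (1761588, [([2], 80880335), ([1], 71699709), ([-1], 71699198)]), (1827089, [([1],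
   80880335)]), (2007318, [([1], 80874741)]), (1761616, [([1], 88220367)]), (2236694, [([1],
   86123223)]), (2007364, [([1], 88214773)])]),
   ([1958161, 2187537, 2236710, 2236738], [(1695983, [([1], 78229199)]), (1925359, [([1],
   80336591)]), (1696021, [([1], 85060303)]), (1958133, [([1], 80341711)]), (1696011, [([1],
   77991119)]), (1761604, [([1], 85074639)]), (1696038, [([1], 76164303)]), (1696066, [([1],
   85083343)]), (1958178, [([1], 80364751)]), (2007317, [([1], 88206039)]), (1958150, [([1],
   78253271)]), (2236693, [([1], 88220375)]), (1925425, [([1], 92400363)]), (1925442, [([1],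
   92409067)]), (1925387, [([1], 77991147)]), (1925414, [([1], 80350443)]), (1991008, [([1],
   92414699)]), (2007345, [([1], 88206067)]), (2236721, [([1], 88220403)]), (2146626, [([1],
   86117635)]), (2376002, [([1], 86131971)]), (2146571, [([1], 76159750)]), (2146598, [([1],
   76164358)]), (2187554, [([1], 78005510)]), (2375974, [([1], 80364806)]), (2146581, [([1],
   88214743)]), (2375985, [([1], 88229107)]), (2056453, [([1], 71699707)]), (2072835, [([1],
   76155645)]), (1761632, [([1], 92414671)]), (1892688, [([1], 86123239)]), (1990980, [([1],
   85074667)]), (2146609, [([1], 88214771)]), (2007362, [([1], 92409077)]), (2269474, [([1],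
   85083381)]), (1696049, [([1], 77996751), ([-1], 80356047), ([1], 78258903)]), (1761577, [([1],
   77996751)]), (1892633, [([1], 75903695)]), (1925397, [([1], 73796331)]), (2007307, [([1],
   77991157)]), (2007334, [([1], 74057461)])]),
   ([2146579, 2253090], [(1695991, [([1], 77967055)]), (1925367, [([1], 80074447)]), (2007287,
   [([1], 80079567)]), (1696019, [([1], 73795279)]), (1696037, [([1], 77990607)]), (2023714,
   [([1], 80102607)]), (2023697, [([1], 75899615)]), (1925395, [([1], 73795307)]), (2023686,
   [([1], 72748267)]), (1925413, [([1], 75897579)]), (1827075, [([1], 70911733)]), (2007361,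
   [([1], 88213237)]), (2007315, [([1], 73795317)]), (2056451, [([1], 78251765)]), (2007333,
   [([1], 80873205)]), (2236737, [([1], 88220419)]), (2236691, [([1], 73802499)]), (2236709,
   [([1], 80880387)]), (2121997, [([1], 73796867)]), (2122025, [([1], 76165891)]), (2375973,
   [([1], 78005509)]), (2146597, [([1], 75897606)]), (1696065, [([1], 88213199)]), (1925441,
   [([1], 88213227)]), (2122080, [([1], 88229123), ([-1], 92423429)]), (2376001, [([1],
   88229123)]), (2122052, [([1], 86117123), ([1], 88214787), ([-1], 92409093)]), (2146625, [([1],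
   88214787)])]),
   ([], [(1696007, [([1], 84520655)]), (1696035, [([1], 84534991)]), (2007303, [([1], 84273871)]),
   (2146567, [([1], 84282575)]), (2154786, [([1], 84296911)]), (1925383, [([1], 84530903)]),
   (1925411, [([1], 92395239)]), (2154769, [([1], 85074663)]), (2236707, [([1], 92414695)]),
   (2375971, [([1], 92423399)]), (2007331, [([1], 84273899)]), (2146595, [([1], 84282603)])]),
   ([], []),
   ([], [])]

/-- The derivations for pairs of total degree `2`, by weight. -/
def stages2 : List (List ℕ × List (ℕ × List (List ℤ × ℕ))) :=
  [([], [(2556216, [([1], 17)])]),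
   ([], [(2556232, [([1], 16)]), (2081080, [([1], 81948879)]), (2310456, [([1], 81948934)])]),
   ([], [(2687304, [([1], 3)]), (2212152, [([1], 26)]), (2072888, [([1], 81948887)]), (2441528,
   [([1], 86143211)]), (2310472, [([1], 86143238)]), (2556240, [([1], 86143249)]), (2081096,
   [([1], 86143183)]), (2523448, [([1], 86143221)]), (2302264, [([1], 81948933)])]),
   ([2523464, 2302280], [(2212168, [([1], 86151375)]), (2056504, [([1], 81948903)]), (2441544,
   [([1], 86151403)]), (1827128, [([1], 81927413)]), (2687312, [([1], 86151441)]), (2433336,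
   [([1], 81937689)]), (2556256, [([1], 86143265)]), (2507064, [([1], 81946914)]), (2072904,
   [([1], 86151413)]), (2081104, [([1], 86123262)]), (2203960, [([1], 88240335)]), (2277688,
   [([1], 86143191)]), (2556228, [([1], 86143237)])]),
   ([2277704, 2507080, 2203976, 2433352], [(1696060, [([1], 74068687)]), (1958200, [([1],
   81937631)]), (1925436, [([1], 81926891)]), (2056474, [([1], 74069235)]), (2498872, [([1],
   88240371)]), (2007356, [([1], 88210677)]), (2654536, [([1], 86151429)]), (2687328, [([1],
   86151457)]), (1827144, [([1], 86151383)]), (2056520, [([1], 86151411)]), (2146620, [([1],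
   86117629)]), (2375996, [([1], 86131965)]), (2081092, [([1], 86117118)]), (2146648, [([1],
   86127366)]), (2187576, [([1], 81937677)]), (2408760, [([1], 81937166)]), (2310441, [([1],
   76166425)]), (2376024, [([1], 86131993)]), (1696088, [([1], 85094607)]), (2556226, [([1],
   86143235)]), (1925464, [([1], 88225003)]), (2072912, [([1], 86123261), ([-1], 88220414)]),
   (2269496, [([1], 88240343)]), (2523472, [([1], 88248565)]), (2236732, [([1], 86123261)]),
   (2302288, [([1], 88240389)]), (2236760, [([1], 86127377)]), (2007384, [([1], 88225013)])]),
   ([2236702, 2408776, 2236730, 2187592, 2236748, 2236776], [(2056462, [([1], 44)]), (2007326,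
   [([1], 90303183)]), (1696030, [([1], 85064911)]), (1696058, [([1], 78262991)]), (2146590,
   [([1], 86117599)]), (2023736, [([1], 81937119)]), (2007354, [([1], 90303211)]), (1925434,
   [([1], 92404971)]), (1925406, [([1], 82971883)]), (2375994, [([1], 86131963)]), (2638152,
   [([1], 86151427)]), (2146636, [([1], 86121222)]), (2376040, [([1], 86135586)]), (1696076,
   [([1], 90311887)]), (1761624, [([1], 90317519)]), (1827152, [([1], 86123231)]), (1958216,
   [([1], 86151399)]), (1991000, [([1], 90317547)]), (1925480, [([1], 92419307)]), (2007372,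
   [([1], 90311925)]), (2007400, [([1], 90326261)]), (2146618, [([1], 86117627)]), (2056528,
   [([1], 86123259)]), (2081090, [([1], 86116094)]), (2367804, [([1], 88228606)]), (2343202,
   [([1], 85083390)]), (2138456, [([1], 90317574)]), (2146664, [([1], 86135558)]), (2253112,
   [([1], 81928971)]), (2400568, [([1], 81937165)]), (2376012, [([1], 86131981)]), (2212137,
   [([1], 76165902)]), (1696104, [([1], 84570319)]), (2556225, [([1], 84570385)]), (1925452,
   [([1], 88218859)]), (2203984, [([1], 88252623)]), (2433360, [([1], 88252651)]), (2302276,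
   [([1], 88224518)]), (2269512, [([1], 86127365)]), (2498888, [([1], 86135569)])]),
   ([2400584, 2023752, 2236718, 2376020, 2146672, 2253128, 2236746, 2629960], [(1696046, [([1],
   87152335)]), (1925422, [([1], 94492367)]), (1696029, [([1], 87157455)]), (1696074, [([1],
   87180495)]), (2375982, [([1], 94520527)]), (2007325, [([1], 90303191)]), (2236701, [([1],
   90317527)]), (1925433, [([1], 94497515)]), (2146606, [([1], 87166187)]), (1925450, [([1],
   94506219)]), (2023706, [([1], 74066667)]), (2007353, [([1], 90303219)]), (2236729, [([1],
   90317555)]), (2007380, [([1], 90311413)]), (2007408, [([1], 90325749)]), (2236756, [([1],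
   90317573)]), (2146634, [([1], 86120198)]), (2212117, [([1], 74066694)]), (2376010, [([1],
   94520582)]), (2236784, [([1], 90325777)]), (2375993, [([1], 80102682)]), (1696057, [([1],
   80098511)]), (1892668, [([1], 82985679)]), (1827113, [([1], 80892623)]), (1761594, [([1],
   82986199)]), (1827122, [([1], 81921759)]), (1925405, [([1], 82971371)]), (2007342, [([1],
   82447605)]), (1827140, [([1], 85073141)]), (2056544, [([1], 88229115)]), (2146589, [([1],
   85069053)]), (2138398, [([1], 85068542)]), (2367802, [([1], 92422910)]), (2138444, [([1],
   88218885)]), (2146644, [([1], 87171846)]), (2384184, [([1], 81937163)]), (2441521, [([1],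
   78267161)]), (2376048, [([1], 86139682)]), (1696084, [([1], 86125263)]), (1925488, [([1],
   86139627)]), (1958224, [([1], 86123247)]), (2138472, [([1], 94511878)]), (2187600, [([1],
   86123275)]), (2367820, [([1], 87180561)]), (2408784, [([1], 86134033)]), (2277728, [([1],
   88229142)]), (1827168, [([1], 92442839)]), (2138426, [([1], 88233221)]), (2146617, [([1],
   86139654)]), (2343201, [([1], 88228622)]), (2335010, [([1], 86131989)]), (2081089, [([1],
   92408574)]), (1696112, [([1], 94511823), ([1], 80892678), ([-1], 80889101), ([-1], 88237263),
   ([1], 86135511)]), (1761640, [([1], 94511823)]), (1892696, [([1], 90325711)]), (1925460, [([1],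
   90311403)]), (2007370, [([1], 94506229)]), (2154808, [([1], 84308175)])]),
   ([2146587, 2318626, 2236717, 2146642, 2236745, 2376018], [(1761593, [([1], 82191055)]),
   (1696054, [([1], 74065615)]), (1696027, [([1], 77999311)]), (1958166, [([1], 80358607)]),
   (1696045, [([1], 77214415)]), (2023705, [([1], 80097999)]), (1892666, [([1], 82461391)]),
   (1827110, [([1], 80891087)]), (1958185, [([1], 80368335)]), (2023722, [([1], 80106703)]),
   (1958194, [([1], 80372943)]), (1761582, [([1], 87152343)]), (1827083, [([1], 77991135)]),
   (2023732, [([1], 80884455)]), (1925403, [([1], 80354027)]), (1925430, [([1], 74065643)]),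
   (1925421, [([1], 77214443)]), (2007323, [([1], 80354037)]), (2007341, [([1], 77214453)]),
   (2253081, [([1], 73806595)]), (2187533, [([1], 73799430)]), (2310435, [([1], 81938182)]),
   (2146688, [([1], 86147846)]), (2236800, [([1], 92440849)]), (2376064, [([1], 86147874)]),
   (1695999, [([1], 85063375)]), (1696073, [([1], 84554447)]), (1925375, [([1], 92395231)]),
   (1925449, [([1], 92412651)]), (2007295, [([1], 88206063)]), (2007350, [([1], 84278517)]),
   (2007396, [([1], 88231157)]), (2236754, [([1], 90317571)]), (2236726, [([1], 82977539)]),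
   (2203942, [([1], 80354054)]), (2187542, [([1], 77999366)]), (2146605, [([1], 77214470)]),
   (2146660, [([1], 89277702)]), (2376036, [([1], 96617734)]), (2375981, [([1], 82199814)]),
   (2253108, [([1], 80880395)]), (2187570, [([1], 80889099)]), (2302245, [([1], 77214481)]),
   (2375990, [([1], 76166419)]), (2408745, [([1], 78005526)]), (2089250, [([1], 96617679)]),
   (1958240, [([1], 92431567)]), (1761610, [([1], 86120151)]), (1958212, [([1], 85087447)]),
   (2253098, [([1], 92427479)]), (1761648, [([1], 92432599)]), (2072897, [([1], 84308183)]),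
   (2089233, [([1], 90317543)]), (2023760, [([1], 88224487)]), (1892712, [([1], 86135527)]),
   (2056514, [([1], 84570343)]), (1925476, [([1], 94505707)]), (2089222, [([1], 89263339)]),
   (1925458, [([1], 86124267)]), (2007378, [([1], 96603381)]), (2007369, [([1], 88217333)]),
   (2335009, [([1], 87180021)]), (2138414, [([1], 78256901)]), (2138425, [([1], 81929989)]),
   (2146614, [([1], 79307526)]), (2236699, [([1], 82191110)]), (2154824, [([1], 86124294)]),
   (2269536, [([1], 92414733)]), (2302273, [([1], 84554513)]), (2498884, [([1], 85086993)]),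
   (2384200, [([1], 86131987)]), (2367828, [([1], 86131477)]), (2523457, [([1], 85092641)]),
   (1696082, [([1], 92417231)]), (1696100, [([1], 88231119)]), (2212161, [([1], 84292870)]),
   (2236772, [([1], 84292881)]), (2187616, [([1], 92455119)]), (2187588, [([1], 85100779)]),
   (2433346, [([1], 92427014)]), (1696128, [([1], 86147791)]), (1925504, [([1], 88245483)]),
   (2007424, [([1], 86147829)]), (2122088, [([1], 86135555)]), (2376009, [([1], 94520581)]),
   (2146633, [([1], 88217350)])]),
   ([2220305, 2236715, 2236742, 2236770], [(1696015, [([1], 86617807)]), (1696043, [([1],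
   86632143)]), (1696053, [([1], 89253583)]), (2007311, [([1], 93448911)]), (1696070, [([1],
   87164623)]), (2146575, [([1], 100797647)]), (2220322, [([1], 100811983)]), (1925391, [([1],
   86628055)]), (1925429, [([1], 96589527)]), (2007349, [([1], 96594647)]), (2236725, [([1],
   96608983)]), (1925419, [([1], 94492391)]), (2375979, [([1], 94520551)]), (2007339, [([1],
   93448939)]), (1925474, [([1], 94504683)]), (2146603, [([1], 100797675)]), (2007377, [([1],
   96602869)]), (1761590, [([1], 81399029)]), (2146630, [([1], 87166211)]), (2376034, [([1],
   94520579)]), (2236753, [([1], 96609029)]), (1761636, [([1], 93463247)]), (1696098, [([1],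
   88753359)]), (1958210, [([1], 84567247)]), (2187586, [([1], 92439759)]), (1892682, [([1],
   86656215)]), (1761618, [([1], 85091543)]), (1892692, [([1], 87171815)]), (1892720, [([1],
   94511847)]), (1925446, [([1], 86641387)]), (1925457, [([1], 96602859)]), (1991040, [([1],
   100803307)]), (1991012, [([1], 93463275)]), (2146613, [([1], 89263347)]), (2007366, [([1],
   93457653)]), (2375989, [([1], 100812021)]), (2007394, [([1], 93471989)]), (2122058, [([1],
   86120195)]), (2122068, [([1], 87171843)]), (2122096, [([1], 94511875)]), (2376006, [([1],
   87180547)]), (2376017, [([1], 96617733)]), (2146658, [([1], 86655750)]), (2146641, [([1],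
   89277190)]), (1696081, [([1], 88744655)])]),
   ([2285858, 2376005], [(1696023, [([1], 86355663)]), (1696051, [([1], 86369999)]), (2007319,
   [([1], 88468175)]), (1696069, [([1], 89261775)]), (1925399, [([1], 86365911)]), (2146583,
   [([1], 100797655)]), (2236695, [([1], 100803287)]), (1925427, [([1], 96589543)]), (2007347,
   [([1], 96594663)]), (2236723, [([1], 96608999)]), (2375987, [([1], 96617703)]), (1925473,
   [([1], 96601835)]), (2007365, [([1], 89261813)]), (2007393, [([1], 96601845)]), (2146629,
   [([1], 89263363)]), (2236741, [([1], 89268995)]), (2236769, [([1], 96609027)]), (2376033,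
   [([1], 96617731)]), (1696097, [([1], 88491215)]), (1892681, [([1], 86394071)]), (1925445,
   [([1], 86379243)]), (2146611, [([1], 88476907)]), (2122057, [([1], 86394117)]), (2146657,
   [([1], 86393606)])]),
   ([], [(1696039, [([1], 92909263)]), (1925415, [([1], 92657359)]), (2007335, [([1], 92662479)]),
   (1696067, [([1], 86378191)]), (2375975, [([1], 92685519)]), (2146599, [([1], 92933335)]),
   (2236711, [([1], 100803303)]), (1925443, [([1], 86378219)]), (2122037, [([1], 100796149)]),
   (2146627, [([1], 86379779)]), (2376003, [([1], 86394115)]), (1761633, [([1], 92676815)]),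
   (2023745, [([1], 84300503)]), (2253121, [([1], 92439255)]), (2007363, [([1], 86378229)]),
   (2122065, [([1], 88221443)]), (2367813, [([1], 89277187)]), (2138465, [([1], 86393605)]),
   (2236739, [([1], 92676870)])]),
   ([], []),
   ([], [])]

/-- The derivations for pairs of total degree `3`, by weight. -/
def stages3 : List (List ℕ × List (ℕ × List (List ℤ × ℕ))) :=
  [([], [(2556220, [([1], 86143229)]), (2556248, [([1], 86143257)])]),
   ([], [(2343224, [([1], 86143199)]), (2556218, [([1], 90337515)]), (2589000, [([1], 86151421)]),
   (2687320, [([1], 86151449)]), (2556264, [([1], 90337570)]), (2556236, [([1], 86143245)])]),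
   ([], [(2335032, [([1], 88240351)]), (2343240, [([1], 86151391)]), (2474296, [([1], 87191787)]),
   (2556217, [([1], 90337523)]), (2572616, [([1], 86151419)]), (2687308, [([1], 90345734)]),
   (2556244, [([1], 87191825)]), (2556272, [([1], 94531857)]), (2556234, [([1], 87191842)]),
   (2687336, [([1], 90345762)])]),
   ([2687316, 2687344], [(2474312, [([1], 86151407)]), (2687306, [([1], 94540038)]), (2507068,
   [([1], 81945878)]), (2523450, [([1], 81946918)]), (2654552, [([1], 90345733)]), (2720080,
   [([1], 90349830)]), (2466104, [([1], 81946891)]), (2318648, [([1], 81945869)]), (2335048,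
   [([1], 88248589)]), (2539832, [([1], 81943825)]), (2752872, [([1], 94540049)]), (2564424,
   [([1], 88248617)]), (2572624, [([1], 88252714)]), (2089272, [([1], 89288939)]), (2556233,
   [([1], 88240395)]), (2556242, [([1], 86143251)]), (2556260, [([1], 86143269)]), (2556288,
   [([1], 86147896)])]),
   ([2539848, 2687314, 2687332, 2687305], [(1696092, [([1], 87175887)]), (1958204, [([1],
   82994383)]), (1827130, [([1], 82471119)]), (1925496, [([1], 94515947)]), (2449720, [([1],
   92434671)]), (2531640, [([1], 89288947)]), (2007388, [([1], 90315509)]), (2007416, [([1],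
   90329845)]), (2146652, [([1], 86129414)]), (2236792, [([1], 100823313)]), (2236764, [([1],
   85096721)]), (2376056, [([1], 96617754)]), (2556258, [([1], 86667553)]), (2556241, [([1],
   89288993)]), (2687360, [([1], 86151489)]), (2343218, [([1], 86140127)]), (2474292, [([1],
   86141167)]), (2089288, [([1], 86151415)]), (2318664, [([1], 86151443)]), (2466120, [([1],
   86151461)]), (2081152, [([1], 86147838)]), (2146680, [([1], 86143750)]), (2376028, [([1],
   86131997)]), (1696120, [([2], 90329807), ([2], 90330327), ([-2], 90326239), ([-2], 86135519),
   ([2], 87191783), ([2], 87184629), ([1], 100823247)]), (2302254, [([1], 94515919)]), (2343209,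
   [([1], 90329807)]), (2212153, [([1], 86143695)]), (1827176, [([1], 86135519)]), (1925468,
   [([1], 87175915)]), (2335018, [([1], 86129387)]), (2056524, [([1], 87184629)]), (2203962,
   [([1], 86121211)]), (2072906, [([1], 94506237)]), (2187580, [([1], 86120189)]), (2220344,
   [([1], 81929998)]), (2310445, [([1], 80885003)]), (2310427, [([1], 80360717)]), (2310482,
   [([1], 86127891)]), (2310500, [([1], 86133530)]), (2212208, [([1], 96613638)]), (2556230,
   [([1], 84308238)])]),
   ([2236734, 2670920, 2236762, 2687330, 2236780, 2236808], [(1696062, [([1], 91346639)]),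
   (1925438, [([1], 98686671)]), (2007358, [([1], 98691791)]), (1696090, [([1], 86651599)]),
   (2375998, [([1], 98714831)]), (1696108, [([1], 87184079)]), (1827129, [([1], 82208975)]),
   (2146622, [([1], 91360491)]), (1925484, [([1], 94509803)]), (1925466, [([1], 86651627)]),
   (2515256, [([1], 88502507)]), (2146696, [([1], 86413574)]), (2556257, [([1], 92958993)]),
   (2376072, [([1], 86413602)]), (1761656, [([1], 98706127)]), (2203961, [([1], 88240847)]),
   (2335026, [([1], 90334423)]), (2269498, [([1], 88241367)]), (1827184, [([1], 94511839)]),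
   (2023768, [([1], 90325727)]), (2007386, [([1], 90314485)]), (2007404, [([1], 94509813)]),
   (2072960, [([1], 100803326)]), (2089296, [([1], 86123263)]), (2638184, [([1], 94540035)]),
   (2146650, [([1], 88772870)]), (2146668, [([1], 93491462)]), (2703712, [([1], 94552326)]),
   (2220360, [([1], 86151431)]), (2285880, [([1], 81931019)]), (2449736, [([1], 92442891)]),
   (2302235, [([1], 80360205)]), (2318644, [([1], 80897293)]), (2318672, [([1], 86128401)]),
   (2752868, [([1], 93491473)]), (2343234, [([1], 86148374)]), (2302281, [([1], 84554521)]),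
   (2376026, [([1], 86131995)]), (2376044, [([1], 86137634)]), (2539856, [([1], 88252710)]),
   (2572610, [([1], 86148402)]), (1696136, [([1], 90342607)]), (1925512, [([1], 90342635)]),
   (2531656, [([1], 88248567)]), (2564420, [([1], 88246523)]), (2466128, [([1], 88245501)]),
   (2138488, [([1], 86143749)]), (2695504, [([1], 94544133)]), (2523465, [([1], 88238347)]),
   (2400600, [([1], 90328337)]), (2687313, [([1], 86413585)]), (2007432, [([1], 90342645)]),
   (2556229, [([1], 86405381)])]),
   ([2146621, 2375997, 2146649, 2146676, 2376025, 2376052, 2146704, 2376080], [(1696061, [([1],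
   91350735)]), (2146638, [([1], 102894799)]), (1696078, [([1], 90836175)]), (2376014, [([1],
   102909135)]), (1696106, [([1], 90850511)]), (1925437, [([1], 98686679)]), (2007357, [([1],
   98691799)]), (2236733, [([1], 98706135)]), (2146666, [([1], 102894827)]), (1925454, [([1],
   90836203)]), (1925482, [([1], 94508779)]), (2376042, [([1], 102909163)]), (2007412, [([1],
   95560437)]), (2007385, [([1], 90318581)]), (2253086, [([1], 80362757)]), (2187549, [([1],
   78002950)]), (2236761, [([1], 90318609)]), (2236788, [([1], 100821265)]), (2433353, [([1],
   86394137)]), (1696089, [([1], 90318543)]), (1761626, [([1], 90314455)]), (1892728, [([1],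
   98714839)]), (1958256, [([1], 96617695)]), (2449716, [([1], 94529767)]), (2384188, [([1],
   92436711)]), (1925465, [([1], 96606955)]), (1925492, [([1], 96611563)]), (2023784, [([1],
   94511855)]), (2367806, [([1], 90325743)]), (1991020, [([1], 94509811)]), (2007402, [([1],
   95569141)]), (2007440, [([1], 90342133)]), (2023756, [([1], 90311927)]), (2138430, [([1],
   87165691)]), (1827200, [([1], 100797693)]), (2056576, [([1], 100812029)]), (2089284, [([1],
   86117119)]), (2089312, [([1], 86131455)]), (2138504, [([1], 102900486)]), (2277760, [([1],
   100821254)]), (2654537, [([1], 88249094)]), (2416952, [([1], 81938189)]), (2367880, [([1],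
   102909201)]), (2236816, [([1], 90342161)]), (2433408, [([1], 100812057)]), (2507136, [([1],
   100821282)]), (2507081, [([1], 86403362)]), (2695520, [([1], 88249122)]), (1696116, [([1],
   98699983)]), (2285896, [([1], 100831447)]), (2343233, [([1], 86147807)]), (2318660, [([1],
   92440799)]), (2449744, [([1], 100835563)]), (2466144, [([1], 92446959)]), (2515272, [([1],
   100831475)]), (2007374, [([1], 90836213)]), (2122104, [([1], 100823299)]), (2138458, [([1],
   86128389)]), (2253132, [([1], 87188741)]), (2662728, [([1], 86413573)]), (2236750, [([1],
   90841862)]), (2154840, [([1], 90318598)]), (2187632, [([1], 92432651)]), (2236778, [([1],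
   100816145)]), (2687329, [([1], 86413601)]), (1696144, [([1], 90342095)]), (1925520, [([1],
   96635115)]), (2556227, [([1], 86405379)])]),
   ([2351394, 2376013, 2236749, 2376022, 2236777, 2376068], [(1696031, [([1], 95530703)]),
   (1696059, [([1], 95545039)]), (2007327, [([1], 97643215)]), (1696086, [([1], 90835663)]),
   (1696077, [([1], 95554255)]), (1696105, [([1], 90588367)]), (1925407, [([1], 95540951)]),
   (2367805, [([1], 98714327)]), (2146591, [([1], 100797663)]), (2236703, [([1], 100803295)]),
   (1925435, [([1], 98686695)]), (2007355, [([1], 98691815)]), (2236731, [([1], 98706151)]),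
   (2375995, [([1], 98714855)]), (1925453, [([1], 90574059)]), (1925490, [([1], 90850027)]),
   (1925481, [([1], 95568619)]), (2138429, [([1], 91359987)]), (2007373, [([1], 95554293)]),
   (2007382, [([1], 93465845)]), (2007401, [([1], 95568629)]), (2007410, [([1], 96619765)]),
   (2146692, [([1], 102894853)]), (2138446, [([1], 100801797)]), (2146637, [([1], 100801286)]),
   (2146646, [([1], 100805894)]), (2236804, [([1], 93489425)]), (2236832, [([1], 93503761)]),
   (2376096, [([1], 102909217)]), (2367850, [([1], 100816161)]), (2376050, [([1], 96619810)]),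
   (2376041, [([1], 100815650)]), (1696132, [([1], 102894287)]), (1696114, [([1], 97666255)]),
   (1827170, [([1], 92956879)]), (2023754, [([1], 86655711)]), (1958272, [([1], 100811999)]),
   (1892698, [([1], 86651623)]), (1925462, [([1], 90835691)]), (2146619, [([1], 97651947)]),
   (1925536, [([1], 102908651)]), (2236758, [([1], 91366147)]), (2236786, [([1], 98706179)]),
   (2138484, [([1], 95560453)]), (2122120, [([1], 102909189)]), (2146720, [([1], 102908678)]),
   (2146665, [([1], 90588422)]), (2146674, [([1], 97666310)]), (2408832, [([1], 100820230)]),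
   (2638153, [([1], 92443398)]), (2367860, [([1], 95568657)]), (1696160, [([1], 105006287)]),
   (2416968, [([1], 100831463)]), (1925508, [([1], 104991979)]), (2007428, [([1], 102894325)]),
   (2007456, [([1], 102908661)]), (2646344, [([1], 86413571)])]),
   ([2236719, 2236747, 2236774, 2236802], [(1696047, [([1], 95006415)]), (1925423, [([1],
   97113807)]), (1990943, [([1], 97642191)]), (1696085, [([1], 101837519)]), (2007343, [([1],
   97118927)]), (1696075, [([1], 90834639)]), (1696102, [([1], 95553231)]), (1696130, [([1],
   101860559)]), (2375983, [([1], 97141967)]), (2007381, [([1], 104983255)]), (2146607, [([1],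
   95030487)]), (2236757, [([1], 104997591)]), (1925489, [([1], 109177579)]), (1925451, [([1],
   90834667)]), (1925478, [([1], 95553259)]), (1925506, [([1], 109186283)]), (2007409, [([1],
   104983283)]), (2236785, [([1], 104997619)]), (2007398, [([1], 95553269)]), (2146690, [([1],
   102894851)]), (2376066, [([1], 102909187)]), (2146635, [([1], 100800262)]), (2146645, [([1],
   100805382)]), (2146662, [([1], 92941574)]), (2376011, [([1], 94782726)]), (2376038, [([1],
   97142022)]), (2376049, [([1], 100819746)]), (1827169, [([1], 92938975)]), (1958225, [([1],
   88491231)]), (1892697, [([1], 90841831)]), (1925461, [([1], 90573547)]), (1990989, [([1],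
   87433963)]), (2023808, [([1], 100803311)]), (2351393, [([1], 89277167)]), (2007371, [([1],
   87442677)]), (2122045, [([1], 100796157)]), (2122100, [([1], 95560451)]), (2400640, [([1],
   100821251)]), (2367821, [([1], 100811533)]), (1696113, [([1], 104982223)]), (1761696, [([1],
   109191887)]), (1892752, [([1], 105005775)]), (2376021, [([1], 105006295)]), (1991044, [([1],
   101851883)]), (2146673, [([1], 104991987)]), (2007426, [([1], 102893301)])]),
   ([2146643, 2376019], [(1696055, [([1], 94744271)]), (1925431, [([1], 96851663)]), (2007351,
   [([1], 96856783)]), (1696083, [([1], 90572495)]), (1696101, [([1], 94767823)]), (2375991,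
   [([1], 96879823)]), (2122015, [([1], 100796127)]), (2236727, [([1], 92676831)]), (1925459,
   [([1], 90572523)]), (2146615, [([1], 89525483)]), (1925477, [([1], 92674795)]), (2007425,
   [([1], 104990453)]), (2007379, [([1], 90572533)]), (2122043, [([1], 95028981)]), (2007397,
   [([1], 97650421)]), (2236801, [([1], 104997635)]), (2236755, [([1], 90579715)]), (2236773,
   [([1], 97657603)]), (2146689, [([1], 86409990)]), (2376065, [([1], 86410018)]), (2122061,
   [([1], 90574083)]), (2122089, [([1], 90588419)]), (2138470, [([1], 97127685)]), (2376037,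
   [([1], 94782725)]), (2146661, [([1], 93987590)]), (1696129, [([1], 104990415)]), (1925505,
   [([1], 104990443)])]),
   ([], [(1696071, [([1], 101297871)]), (1696099, [([1], 101312207)]), (2007367, [([1],
   101051087)]), (2146631, [([1], 101059791)]), (2376007, [([1], 101074127)]), (1925447, [([1],
   101308119)]), (1925475, [([1], 109172455)]), (2236743, [([1], 101851879)]), (2236771, [([1],
   109191911)]), (2376035, [([1], 109200615)]), (2007395, [([1], 101051115)]), (2146659, [([1],
   101059819)])]),
   ([], []),
   ([], [])]

/-- The derivations for pairs of total degree `4`, by weight. -/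
def stages4 : List (List ℕ × List (ℕ × List (List ℤ × ℕ))) :=
  [([], [(2556252, [([1], 87191833)]), (2556280, [([1], 94531865)])]),
   ([], [(2556222, [([1], 94531807)]), (2556250, [([1], 86667545)]), (2687324, [([1], 86151453)]),
   (2556268, [([1], 87191849)]), (2687352, [([1], 100831544)]), (2556296, [([1], 86413624)])]),
   ([], [(2556221, [([1], 96628959)]), (2556266, [([1], 102920427)]), (2605384, [([1],
   100831486)]), (2556304, [([1], 102920465)]), (2556249, [([1], 90861841)]), (2556276, [([1],
   95580433)]), (2687322, [([1], 86151451)]), (2687340, [([1], 86151469)]), (2687368, [([1],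
   86413640)]), (2572620, [([1], 87199995)]), (2556238, [([1], 87191819)])]),
   ([2589056, 2818432], [(2072922, [([1], 90861783)]), (1827192, [([1], 90329823)]), (2556219,
   [([1], 97677547)]), (2351416, [([1], 89288943)]), (2056540, [([1], 91378933)]), (2687310,
   [([1], 90870022)]), (2302298, [([1], 90321675)]), (2556320, [([1], 102920481)]), (2556274,
   [([1], 90861857)]), (2556265, [([1], 95580449)]), (2687338, [([1], 90870050)]), (2597192,
   [([1], 100831485)]), (2605392, [([1], 100835582)]), (2318680, [([1], 86128409)]), (2687321,
   [([1], 100831513)]), (2752858, [([1], 88248603)]), (2687348, [([1], 100831540)]), (2687376,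
   [([1], 88510792)]), (2204024, [([1], 98738383)]), (2523482, [([1], 90870005)]), (2572628,
   [([1], 89297147)]), (2564428, [([1], 88250619)]), (2556246, [([1], 90861829)]), (2302316,
   [([1], 98710278)]), (2556237, [([1], 89288971)]), (2695512, [([1], 90349835)]), (2818404,
   [([1], 93491481)]), (2720112, [([1], 90347809)]), (2556292, [([1], 87196472)])]),
   ([2343296, 2572672, 2720128, 2949504], [(1696124, [([1], 95564495)]), (1958264, [([1],
   98714847)]), (2482488, [([1], 92958943)]), (2056556, [([1], 95580391)]), (1925500, [([1],
   98704107)]), (2556273, [([1], 105017587)]), (2007420, [([1], 104987893)]), (2597200, [([1],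
   100835581)]), (2433388, [([1], 94524173)]), (2236796, [([1], 100825361)]), (2236824, [([1],
   100839697)]), (2564436, [([1], 89285402)]), (2351432, [([1], 100831455)]), (2531672, [([1],
   90351859)]), (2007448, [([1], 90346229)]), (2580808, [([1], 100831483)]), (2605380, [([1],
   100829438)]), (2589009, [([1], 88514814)]), (2605408, [([1], 100843774)]), (2146684, [([1],
   100825350)]), (2687318, [([1], 97685766)]), (2146712, [([1], 100839686)]), (2556245, [([1],
   88502541)]), (2687309, [([1], 100831501)]), (2834784, [([1], 92442907)]), (2687346, [([1],
   90870049)]), (2376060, [([1], 100825378)]), (2376088, [([1], 100839714)]), (2687337, [([1],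
   100831529)]), (2654572, [([1], 86149421)]), (2687364, [([1], 93491524)]), (2687392, [([1],
   92705096)]), (1696152, [([1], 98732239)]), (2187640, [([1], 98746575)]), (1925528, [([1],
   92453099)]), (2507116, [([1], 95588595)]), (2556262, [([1], 95580419)]), (2556235, [([1],
   100823307)]), (2556290, [([1], 101871906)])]),
   ([2335104, 2474368, 2564480, 2703744, 2785664, 3015040], [(2007390, [([1], 107080399)]),
   (1696094, [([1], 101842127)]), (1696122, [([1], 95040207)]), (1696140, [([1], 95586511)]),
   (2146654, [([1], 102894815)]), (1827188, [([1], 95560415)]), (2023800, [([1], 98714335)]),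
   (2433341, [([1], 96621279)]), (2548024, [([1], 92696799)]), (2056564, [([1], 97677543)]),
   (2007418, [([1], 107080427)]), (1925498, [([1], 109182187)]), (1925470, [([1], 99749099)]),
   (2302267, [([1], 97661675)]), (1925544, [([1], 94540523)]), (2203965, [([1], 89266939)]),
   (2376058, [([1], 102909179)]), (2146700, [([1], 102898438)]), (2507124, [([1], 96625942)]),
   (2376104, [([1], 102912802)]), (2523506, [([1], 96626982)]), (2351440, [([1], 100835551)]),
   (2302313, [([1], 105001707)]), (2482504, [([1], 100831471)]), (2580816, [([1], 100835579)]),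
   (2597216, [([1], 100843773)]), (2605378, [([1], 100828414)]), (2138492, [([1], 100825349)]),
   (2728272, [([1], 95592709)]), (2138520, [([1], 100839685)]), (2236812, [([1], 107094790)]),
   (2236766, [([1], 99754758)]), (2146682, [([1], 100824326)]), (2474313, [([1], 86406406)]),
   (2687334, [([1], 97161478)]), (2654553, [([1], 90611974)]), (2146728, [([1], 100847878)]),
   (2687307, [([1], 100831499)]), (2433358, [([1], 86397710)]), (2236794, [([1], 100824337)]),
   (2236840, [([1], 100847889)]), (2376030, [([1], 87704857)]), (2638170, [([1], 86148379)]),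
   (2367868, [([1], 100825377)]), (2752873, [([1], 95592737)]), (2376076, [([1], 87462178)]),
   (2687362, [([1], 88772930)]), (1696168, [([1], 98731215)]), (2204020, [([1], 97689807)]),
   (2253176, [([1], 98746583)]), (1925516, [([1], 91391211)]), (2433396, [([1], 97689835)]),
   (2007436, [([1], 102898421)]), (2007464, [([1], 102912757)]), (2302322, [([1], 98710275)]),
   (2556261, [([1], 97677571)]), (2556243, [([1], 97153285)]), (2687317, [([1], 90607877)]),
   (2556289, [([1], 101347601)]), (2687345, [([1], 94802193)])]),
   ([2089344, 2318720, 2466176, 2539904, 2695552, 2769280, 2916736, 2687361], [(1696110, [([1],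
   103929551)]), (1925486, [([1], 111269583)]), (1696093, [([1], 103934671)]), (1696138, [([1],
   103957711)]), (2376046, [([1], 111297743)]), (2007389, [([1], 107080407)]), (2236765, [([1],
   107094743)]), (1925497, [([1], 111274731)]), (2146670, [([1], 103943403)]), (1925514, [([1],
   111283435)]), (2310455, [([1], 89535723)]), (2007417, [([1], 107080435)]), (2236793, [([1],
   107094771)]), (2007444, [([1], 107088629)]), (2007472, [([1], 107102965)]), (2236820, [([1],
   107094789)]), (2138462, [([1], 100809989)]), (2146698, [([1], 102897414)]), (2146653, [([1],
   100809478)]), (2376074, [([1], 111297798)]), (2146708, [([1], 100837638)]), (2236848, [([1],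
   107102993)]), (2376057, [([1], 96879898)]), (2367866, [([1], 100824353)]), (2376112, [([1],
   100852002)]), (1696148, [([1], 107088591)]), (1696121, [([1], 96875727)]), (1892732, [([1],
   99762895)]), (2220345, [([1], 100823759)]), (1761658, [([1], 99763415)]), (2203963, [([1],
   98704103)]), (2056525, [([1], 87453927)]), (1925469, [([1], 99748587)]), (1925552, [([1],
   107102955)]), (2572641, [([1], 92713195)]), (2007406, [([1], 99224821)]), (2556259, [([1],
   92696843)]), (2318665, [([1], 86402317)]), (2302283, [([1], 84555545)]), (2433357, [([1],
   87442713)]), (2548040, [([1], 100831479)]), (2605377, [([1], 100827902)]), (2122108, [([1],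
   100825347)]), (2138490, [([1], 100824325)]), (2146681, [([1], 100823814)]), (2146736, [([1],
   100851974)]), (2236782, [([1], 100818193)]), (2236810, [([1], 100832529)]), (2687315, [([1],
   100831507)]), (2376029, [([1], 100812061)]), (2367838, [([1], 100811550)]), (2376084, [([1],
   100837666)]), (2687333, [([1], 100831525)]), (1696176, [([1], 94544591), ([-1], 87192323),
   ([1], 89289987), ([1], 90330885), ([1], 86668037), ([-1], 90334982), ([-1], 94530310), ([-1],
   88503558), ([-2], 98730703), ([2], 86143751)]), (1761704, [([1], 111289039)]), (1892760, [([1],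
   107102927)]), (1925524, [([1], 107088619)]), (1991052, [([1], 103949035)]), (2007434, [([1],
   111283445)]), (2507085, [([1], 87462131)]), (2556231, [([1], 87453955)])]),
   ([2220416, 2449792, 2531712, 2670976, 2761088, 2900352], [(1761657, [([1], 98968271)]),
   (1892730, [([1], 99238607)]), (1696063, [([1], 86404303)]), (1925439, [([1], 86404331)]),
   (2007359, [([1], 93468405)]), (2146623, [([1], 100797695)]), (2236735, [([1], 100803327)]),
   (2375999, [([1], 100812031)]), (2146678, [([1], 100822278)]), (2146697, [([1], 100832006)]),
   (2236763, [([1], 100808465)]), (2236836, [([1], 100845841)]), (2376054, [([1], 100822306)]),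
   (2376073, [([1], 100832034)]), (1696091, [([1], 101840591)]), (1696109, [([1], 101317327)]),
   (1696118, [([1], 99747535)]), (1696137, [([1], 101331663)]), (1925467, [([1], 109172447)]),
   (1925485, [([1], 101317355)]), (1925494, [([1], 99747563)]), (1925513, [([1], 109189867)]),
   (2007405, [([1], 104983279)]), (2007414, [([1], 101055733)]), (2007387, [([1], 99224309)]),
   (2007460, [([1], 105008373)]), (2580802, [([1], 100828411)]), (2597185, [([1], 100827901)]),
   (2122078, [([1], 100809987)]), (2122106, [([1], 100824323)]), (2122124, [([1], 100833539)]),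
   (2711904, [([1], 92452099)]), (2122152, [([1], 100847875)]), (2138506, [([1], 103957765)]),
   (2138478, [([1], 91899141)]), (2138489, [([1], 100823813)]), (2638157, [([1], 95585541)]),
   (2670930, [([1], 88773893)]), (2146651, [([1], 100808454)]), (2367882, [([1], 111297286)]),
   (2146669, [([1], 91636998)]), (2146752, [([1], 102925062)]), (2146706, [([1], 100836614)]),
   (2146724, [([1], 92973318)]), (2638185, [([1], 94814470)]), (2236781, [([1], 100817681)]),
   (2236790, [([1], 100822289)]), (2236864, [([1], 109218065)]), (2236809, [([1], 100832017)]),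
   (2236818, [([1], 100836625)]), (2277762, [([1], 88769814)]), (2376027, [([1], 100812059)]),
   (2769250, [([1], 88773921)]), (2376045, [([1], 100817698)]), (2376128, [([1], 102925090)]),
   (2376082, [([1], 100836642)]), (2376100, [([1], 100845858)]), (2507138, [([1], 88769842)]),
   (2630004, [([1], 100827956)]), (1696146, [([1], 107087567)]), (1696164, [([1], 111282895)]),
   (1761712, [([1], 98730711)]), (1892776, [([1], 98731239)]), (1925522, [([1], 107087595)]),
   (1925540, [([1], 111282923)]), (2007433, [([1], 111282933)]), (2007442, [([1], 113380597)]),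
   (2154888, [([1], 102903043)]), (2384264, [([1], 102917379)]), (2679112, [([1], 87462147)]),
   (2687331, [([1], 94802179)]), (2629966, [([1], 88251651)]), (2629994, [([1], 95068419)]),
   (1696192, [([1], 102925007)]), (1925568, [([1], 102925035)]), (2007488, [([1], 102925045)])]),
   ([2285952, 2515328, 2662784, 2892160], [(1696079, [([1], 103395023)]), (1696107, [([1],
   103409359)]), (1696117, [([1], 106030799)]), (2007375, [([1], 110226127)]), (1696134, [([1],
   103941839)]), (2146639, [([1], 117574863)]), (2376015, [([1], 117589199)]), (1925455, [([1],
   103405271)]), (1925493, [([1], 113366743)]), (2007413, [([1], 113371863)]), (2236789, [([1],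
   113386199)]), (1925483, [([1], 111269607)]), (2376043, [([1], 111297767)]), (2007403, [([1],
   110226155)]), (1925538, [([1], 111281899)]), (2146667, [([1], 117574891)]), (2007441, [([1],
   113380085)]), (1761654, [([1], 98176245)]), (1991030, [([1], 98190581)]), (2146694, [([1],
   103943427)]), (2376098, [([1], 111297795)]), (2122094, [([1], 100818179)]), (2236817, [([1],
   113386245)]), (2146722, [([1], 100844806)]), (2376070, [([1], 100830498)]), (1696162, [([1],
   111281871)]), (1761682, [([1], 101868759)]), (1925510, [([1], 103941867)]), (1991058, [([1],
   109194483)]), (2122105, [([1], 100823811)]), (2449745, [([1], 88503555)]), (2122160, [([1],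
   100851971)]), (2138459, [([1], 100808453)]), (2138486, [([1], 91898629)]), (2376081, [([1],
   113394949)]), (2376053, [([1], 98977029)]), (2417008, [([1], 96622341)]), (2138505, [([1],
   100832005)]), (2138532, [([1], 92707077)]), (2146705, [([1], 103162630)]), (2236751, [([1],
   91104006)]), (2236806, [([1], 110240518)]), (2146677, [([1], 98181894)]), (2236779, [([1],
   94523153)]), (2236834, [([1], 100844817)]), (1696145, [([1], 105521871)]), (1925521, [([1],
   105521899)]), (2007430, [([1], 105516277)]), (2007458, [([1], 105530613)])]),
   ([2417024, 2646400], [(1696087, [([1], 103132879)]), (1696115, [([1], 103147215)]), (2007383,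
   [([1], 105245391)]), (1696133, [([1], 106038991)]), (1925463, [([1], 103143127)]), (2146647,
   [([1], 117574871)]), (2236759, [([1], 117580503)]), (1892726, [([1], 98190551)]), (1925491,
   [([1], 113366759)]), (2007411, [([1], 113371879)]), (2236787, [([1], 113386215)]), (2376051,
   [([1], 113394919)]), (1925537, [([1], 113379051)]), (2007429, [([1], 106039029)]), (2007457,
   [([1], 113379061)]), (2146693, [([1], 106040579)]), (2236805, [([1], 106046211)]), (2236833,
   [([1], 113386243)]), (2376097, [([1], 113394947)]), (1892772, [([1], 101345511)]), (2122093,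
   [([1], 100817667)]), (2122102, [([1], 100822275)]), (2122121, [([1], 100832003)]), (2122130,
   [([1], 88511747)]), (2376069, [([1], 103171333)]), (2138530, [([1], 105530629)]), (2138475,
   [([1], 95831301)]), (2376023, [([1], 98190597)]), (2146721, [([1], 109716230)]), (2146675,
   [([1], 95298310)]), (2367823, [([1], 95830790)]), (1696161, [([1], 110248655)]), (1925509,
   [([1], 110234347)])]),
   ([], [(1696103, [([1], 109686479)]), (1925479, [([1], 109434575)]), (2007399, [([1],
   109439695)]), (1696131, [([1], 103155407)]), (2376039, [([1], 109462735)]), (2146663, [([1],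
   109710551)]), (2236775, [([1], 117580519)]), (1925507, [([1], 103155435)]), (2122101, [([1],
   117573365)]), (2146691, [([1], 103156995)]), (2376067, [([1], 103171331)]), (2236803, [([1],
   100828945)]), (2007427, [([1], 103155445)])]),
   ([], []),
   ([], [])]

/-- The derivations for pairs of total degree `5 + 2 N`, by weight. -/
def stages5 : List (List ℕ × List (ℕ × List (List ℤ × ℕ))) :=
  [([], [(2560408, [([1], 105017672)]), (2560380, [([1], 97677640)])]),
   ([], [(2560424, [([1], 107114786)]), (2560378, [([1], 99774754)]), (2691480, [([1],
   105025864)]), (2691452, [([1], 97685832)]), (2560350, [([1], 75395400)]), (2560396, [([1],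
   89298232)])]),
   ([], [(2691468, [([1], 107122950)]), (2691422, [([1], 99782918)]), (2560404, [([1],
   103969041)]), (2560349, [([1], 91910417)]), (2560432, [([1], 111309073)]), (2560377, [([1],
   99250449)]), (2691496, [([1], 107122978)]), (2691450, [([1], 99782946)]), (2560394, [([1],
   103969058)]), (2560366, [([1], 91910434)])]),
   ([3150172, 3150200], [(2691466, [([1], 111317254)]), (2691438, [([1], 99258630)]), (2060696,
   [([1], 107107573)]), (3084589, [([1], 79089945)]), (3084543, [([1], 67031321)]), (3084598,
   [([1], 81453338)]), (3084571, [([1], 74363177)]), (2691476, [([1], 89325896)]), (2691421,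
   [([1], 74907976)]), (2691504, [([1], 96665928)]), (2691449, [([1], 82248008)]), (2757032,
   [([1], 94568784)]), (2756986, [([1], 82510160)]), (2560347, [([1], 74383672)]), (2560365,
   [([1], 79102264)]), (2560374, [([1], 81461560)]), (2560319, [([1], 67043640)]), (2437528,
   [([1], 107127019)]), (2511256, [([1], 107122931)]), (2576784, [([1], 105014600)]), (2560402,
   [([1], 89026888)]), (2560420, [([1], 93745480)]), (2560393, [([1], 105017611)]), (2568584,
   [([1], 102912848)]), (3019144, [([1], 102917456)]), (2560448, [([1], 102920513)])]),
   ([3150216, 3150170, 3150188, 3150142], [(2150812, [([1], 106074374)]), (1700252, [([1],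
   99780815)]), (2240924, [([1], 107120913)]), (2240952, [([1], 107135249)]), (2560373, [([1],
   95842577)]), (2560418, [([1], 103444769)]), (2560401, [([1], 106066209)]), (2560363, [([1],
   96104737)]), (2380216, [([1], 113414434)]), (1929656, [([1], 111293163)]), (2011548, [([1],
   107092725)]), (2011576, [([1], 99262709)]), (2322778, [([1], 90322699)]), (2773338, [([1],
   90842952)]), (2691465, [([1], 86442312)]), (2691474, [([1], 88801608)]), (2691419, [([1],
   74383688)]), (2691492, [([1], 93520200)]), (2691437, [([1], 79102280)]), (2691446, [([1],
   81461576)]), (2691391, [([1], 67043656)]), (2642328, [([1], 107122947)]), (2658728, [([1],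
   111317253)]), (2150840, [([1], 113414406)]), (2380188, [([1], 107120930)]), (2691520, [([1],
   102928705)]), (1700280, [([2], 99234566), ([2], 82751750), ([2], 111293135), ([2], 98735319),
   ([-2], 95072471), ([-2], 83269922), ([-2], 107092715), ([-2], 102906603), ([1], 98762959)]),
   (2216313, [([1], 98996431)]), (2306414, [([1], 111293135)]), (2568526, [([1], 102920911)]),
   (2740537, [([1], 82251983)]), (1929628, [([1], 103953131)]), (2486616, [([1], 90348787)]),
   (2920794, [([1], 90360075)]), (2560335, [([1], 89026830)]), (3019086, [([1], 90890502)]),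
   (2560390, [([1], 87716161)])]),
   ([3150158, 3150224, 3150169, 3150186, 3150196, 3150141], [(2150782, [([1], 108123910)]),
   (2150856, [([1], 117608710)]), (2380158, [([1], 115492047)]), (1700222, [([1], 108123855)]),
   (1929598, [([1], 115463887)]), (2011518, [([1], 115469007)]), (1700250, [([1], 103428815)]),
   (1700268, [([1], 103961295)]), (1831289, [([1], 98986191)]), (2560417, [([1], 109736209)]),
   (2560371, [([1], 95318289)]), (2380232, [([1], 117608738)]), (1929644, [([1], 111287019)]),
   (1929626, [([1], 103428843)]), (3051830, [([1], 81453334)]), (2830665, [([1], 86418713)]),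
   (2150810, [([1], 90898694)]), (2150828, [([1], 95617286)]), (2699598, [([1], 90870534)]),
   (2208121, [([1], 99000527)]), (1700296, [([1], 102929103)]), (2240968, [([1], 102957329)]),
   (2240922, [([1], 90898705)]), (2240940, [([1], 95617297)]), (2240894, [([1], 83558673)]),
   (2290040, [([1], 98705169)]), (2822455, [([1], 79606033)]), (2322832, [([1], 102905617)]),
   (2552152, [([1], 90332945)]), (2380186, [([1], 90898722)]), (2380204, [([1], 95617314)]),
   (2699626, [([1], 90870562)]), (1929672, [([1], 102929131)]), (2576725, [([1], 89567467)]),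
   (2011564, [([1], 111287029)]), (2011546, [([1], 86946037)]), (2691462, [([1], 85655880)]),
   (2691407, [([1], 71237960)]), (2691490, [([1], 92995912)]), (2691435, [([1], 78577992)]),
   (2273658, [([1], 98708235)]), (2560343, [([1], 89551115)]), (2535770, [([1], 90336011)]),
   (2027928, [([1], 90828624)]), (2757001, [([1], 86442320)]), (2757028, [([1], 93520208)]),
   (2756973, [([1], 79102288)]), (2306441, [([1], 86442265)]), (2527606, [([1], 81461556)]),
   (2142648, [([1], 111321349)]), (2527579, [([1], 99248389)]), (2691473, [([1], 103190801)]),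
   (2691445, [([1], 95850769)]), (2404760, [([1], 107105553)]), (2339232, [([1], 109198609)]),
   (2470288, [([1], 105003810)]), (2527625, [([1], 105015563)]), (2560389, [([1], 103182597)]),
   (2011592, [([1], 107119861)])]),
   ([3150212, 3150157, 3150166, 3150111, 3150240, 3150185, 3150194, 3150139], [(2150798, [([1],
   119643910)]), (1700238, [([1], 107585286)]), (2150826, [([1], 119658246)]), (1929614, [([1],
   107599622)]), (2380174, [([1], 119686351)]), (1700266, [([1], 107627727)]), (1700221, [([1],
   108127951)]), (2240893, [([1], 115453713)]), (2011572, [([1], 112323345)]), (2011517, [([1],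
   100264721)]), (2240976, [([1], 117612817)]), (2240921, [([1], 91136273)]), (2240948, [([1],
   110272785)]), (1929597, [([1], 115463895)]), (2380202, [([1], 119658274)]), (1929642, [([1],
   107599650)]), (2437513, [([1], 103166754)]), (2511222, [([1], 98199842)]), (2011545, [([1],
   91136245)]), (2142664, [([1], 102957317)]), (2142618, [([1], 90898693)]), (2142590, [([1],
   83558661)]), (2150864, [([1], 119677702)]), (2150781, [([1], 100279046)]), (2658623, [([1],
   83796230)]), (2273646, [([1], 99232518)]), (1962388, [([1], 106034950)]), (2150809, [([1],
   90636550)]), (2150836, [([1], 97714438)]), (1700249, [([1], 98994383)]), (1700276, [([1],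
   106063055)]), (2372040, [([1], 102957345)]), (2371994, [([1], 90898721)]), (2372012, [([1],
   95617313)]), (2371966, [([1], 83558689)]), (2421112, [([1], 98705185)]), (3019055, [([1],
   79606049)]), (2535786, [([1], 95042337)]), (2576741, [([1], 87455009)]), (2380240, [([1],
   105054498)]), (2380185, [([1], 90636578)]), (2380212, [([1], 97714466)]), (2380157, [([1],
   83296546)]), (2519404, [([1], 95578914)]), (2593123, [([1], 93747490)]), (1929625, [([1],
   113384171)]), (1929652, [([1], 89841899)]), (2011600, [([1], 107119349)]), (2011534, [([1],
   96110837)]), (2011562, [([1], 95601909)]), (2658651, [([1], 82741572)]), (2658697, [([1],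
   86442308)]), (2388348, [([1], 98715405)]), (2560359, [([1], 93221133)]), (2888073, [([1],
   86442336)]), (2888082, [([1], 88801632)]), (2888027, [([1], 74383712)]), (2888054, [([1],
   81461600)]), (2126264, [([1], 107135235)]), (2511213, [([1], 99771651)]), (2691461, [([1],
   103190789)]), (2691415, [([1], 91132165)]), (2634106, [([1], 99270917)]), (2240910, [([1],
   107619078)]), (1765832, [([1], 119663366)]), (1700304, [([1], 119677647)]), (2240938, [([1],
   107627793)]), (2691489, [([1], 103190817)]), (2691443, [([1], 91132193)]), (2257320, [([1],
   111291681)]), (2453904, [([1], 105012513)]), (2388376, [([1], 107095842)]), (2322848, [([1],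
   105002786)]), (2511241, [([1], 109208845)]), (2560387, [([1], 103182595)]), (1929680, [([1],
   107119339)])]),
   ([3150210, 3150155, 3150165, 3150182, 3150127, 3150193], [(2150852, [([1], 119672069)]),
   (2150751, [([1], 100273413)]), (1700246, [([1], 107585285)]), (1700237, [([1], 112303877)]),
   (1700191, [([1], 100245253)]), (2011533, [([1], 112323333)]), (2011487, [([1], 100264709)]),
   (2142606, [([1], 103974149)]), (1929613, [([1], 107337478)]), (1929567, [([1], 99997446)]),
   (2150797, [([1], 103188742)]), (2150806, [([1], 98208006)]), (1700265, [([1], 107365583)]),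
   (1700219, [([1], 100025551)]), (2240863, [([1], 108121873)]), (2240891, [([1], 115461905)]),
   (2240964, [([1], 117606673)]), (2240992, [([1], 117621009)]), (2380256, [([1], 119686433)]),
   (2380155, [([1], 100287777)]), (1929650, [([1], 107599649)]), (1929641, [([1], 112318241)]),
   (1929595, [([1], 100259617)]), (2011561, [([1], 112323361)]), (2011515, [([1], 100264737)]),
   (2372010, [([1], 111314209)]), (2380201, [([1], 103203106)]), (2380210, [([1], 98222370)]),
   (2011542, [([1], 110243061)]), (2011570, [([1], 113396981)]), (2126280, [([1], 102957315)]),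
   (2126234, [([1], 90898691)]), (2126252, [([1], 95617283)]), (2126206, [([1], 83558659)]),
   (1700292, [([1], 119643909)]), (2380228, [([1], 119686405)]), (2380127, [([1], 100287749)]),
   (2142617, [([1], 90636549)]), (2142644, [([1], 97714437)]), (2240909, [([1], 107356934)]),
   (2240918, [([1], 114434822)]), (2150880, [([1], 119685894)]), (2150779, [([1], 100287238)]),
   (1929622, [([1], 114415366)]), (2642239, [([1], 83804422)]), (2150825, [([1], 94830854)]),
   (2150834, [([1], 97190150)]), (1700274, [([1], 114443471)]), (2273700, [([1], 110238481)]),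
   (2240937, [([1], 94830865)]), (2240946, [([1], 97190161)]), (2920817, [([1], 94816529)]),
   (1929696, [([1], 119658273)]), (2380173, [([1], 87490850)]), (2380182, [([1], 89850146)]),
   (2011588, [([1], 110266613)]), (2011616, [([1], 109234421)]), (2642285, [([1], 83264834)]),
   (2642313, [([1], 86442306)]), (2691459, [([1], 103190787)]), (2691431, [([1], 95850755)]),
   (2371982, [([1], 107627270)]), (1929668, [([1], 121755398)]), (1896904, [([1], 119662342)]),
   (1700320, [([1], 119685839)])]),
   ([3150209, 3150163, 3150181, 3150135], [(2150850, [([1], 119672067)]), (2150767, [([1],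
   100273411)]), (1700235, [([1], 107585283)]), (1700262, [([1], 112303875)]), (1700207, [([1],
   100245251)]), (2380226, [([1], 119686403)]), (2380143, [([1], 100287747)]), (1929611, [([1],
   107599619)]), (1929638, [([1], 112318211)]), (1929583, [([1], 100259587)]), (2011558, [([1],
   112323331)]), (2011503, [([1], 100264707)]), (1700245, [([1], 107323141)]), (2240917, [([1],
   107356933)]), (2011541, [([1], 107342597)]), (2150795, [([1], 104219910)]), (2150822, [([1],
   106579206)]), (2380171, [([1], 111559942)]), (2380198, [([1], 113919238)]), (1929666, [([1],
   125949702)]), (2150805, [([1], 106070790)]), (1700290, [([1], 118637775)]), (2240945, [([1],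
   107365137)]), (2011569, [([1], 111536913)]), (1929649, [([1], 107337505)]), (2380209, [([1],
   113410850)]), (2126288, [([1], 105054467)]), (2126233, [([1], 90636547)]), (2126260, [([1],
   97714435)]), (2126205, [([1], 83296515)]), (2142688, [([1], 121783557)]), (2142587, [([1],
   100025605)]), (1995149, [([1], 112322309)]), (2142633, [([1], 94830853)]), (2240962, [([1],
   125969158)]), (2240879, [([1], 99492614)]), (1896857, [([1], 107341574)]), (1700273, [([1],
   107365071)]), (1929621, [([1], 104191761)]), (2240907, [([1], 86966545)]), (2240934, [([1],
   94044433)]), (2011531, [([1], 104196898)]), (2011586, [([1], 119663363)]), (2380181, [([1],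
   107365637)]), (2150833, [([1], 111551238)])]),
   ([3150151, 3150179], [(1700243, [([1], 107323139)]), (1700215, [([1], 99983107)]), (2240961,
   [([1], 121774851)]), (2240915, [([1], 107356931)]), (2240933, [([1], 114434819)]), (2240887,
   [([1], 100016899)]), (1929619, [([1], 107337475)]), (1929591, [([1], 99997443)]), (2011585,
   [([1], 121760515)]), (2011539, [([1], 107342595)]), (2011557, [([1], 114420483)]), (2011511,
   [([1], 100002563)]), (1700261, [([1], 111517445)]), (2150775, [([1], 106288902)]), (2150849,
   [([1], 117605126)]), (2380151, [([1], 113657039)]), (1929637, [([1], 104191777)]), (2380225,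
   [([1], 117605154)]), (2126221, [([1], 87490819)]), (2126230, [([1], 89850115)]), (2126249,
   [([1], 94830851)]), (2126258, [([1], 97190147)]), (2142603, [([1], 104219909)]), (2142630,
   [([1], 106579205)]), (2380197, [([1], 111559941)]), (2380179, [([1], 113919237)]), (2150803,
   [([1], 103686918)]), (2150821, [([1], 110764806)]), (2158985, [([1], 103163654)]), (1700289,
   [([1], 103187151)]), (2388361, [([1], 103163682)]), (1929665, [([1], 103187179)])]),
   ([], [(2150791, [([1], 104205571)]), (1700231, [([1], 104177411)]), (1700259, [([1],
   111517443)]), (2380195, [([1], 111559939)]), (1929607, [([1], 104191747)]), (1929635, [([1],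
   111531779)]), (2011527, [([1], 104196867)]), (2011555, [([1], 111536899)]), (2150819, [([1],
   117823238)]), (2380167, [([1], 117851343)]), (2240903, [([1], 118607633)]), (2240931, [([1],
   125947665)])]),
   ([], []),
   ([], [])]

/-- The derivations for pairs of total degree `6 + 2 N`, by weight. -/
def stages6 : List (List ℕ × List (ℕ × List (List ℤ × ℕ))) :=
  [([], [(2560412, [([1], 106066248)]), (2560440, [([1], 113406280)])]),
   ([], [(2560382, [([1], 108163307)]), (2691484, [([1], 107123012)]), (2691512, [([1],
   113414472)]), (2560410, [([1], 91124040)]), (2560428, [([1], 95842632)]), (2560456, [([1],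
   117600584)])]),
   ([], [(2560464, [([1], 119697681)]), (2560409, [([1], 107639057)]), (2560436, [([1],
   112357649)]), (2560381, [([1], 100299025)]), (2560426, [([1], 107639074)]), (2691528, [([1],
   117608776)]), (2691482, [([1], 105550152)]), (2691500, [([1], 110268744)]), (2691454, [([1],
   98210120)]), (2560398, [([1], 87978312)])]),
   ([3150232, 3150204], [(2691470, [([1], 107647238)]), (2560480, [([1], 119697697)]), (2560434,
   [([1], 107639073)]), (2560425, [([1], 112357665)]), (2560379, [([1], 100299041)]), (2691498,
   [([1], 107647266)]), (1831352, [([1], 115481845)]), (2060700, [([1], 108156149)]), (2560351,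
   [([1], 104493301)]), (2306458, [([1], 107098891)]), (2838873, [([1], 90616075)]), (2822491,
   [([1], 91108168)]), (2691536, [([1], 105054536)]), (2691481, [([1], 90636616)]), (2691508,
   [([1], 97714504)]), (2691453, [([1], 83296584)]), (2322840, [([1], 90584904)]), (2757064,
   [([1], 102957392)]), (2757018, [([1], 90898768)]), (2756990, [([1], 83558736)]), (2658744,
   [([1], 115511557)]), (2208184, [([1], 115515599)]), (2511260, [([1], 108171507)]), (2773400,
   [([1], 107095880)]), (2576788, [([1], 106063176)]), (2560406, [([1], 90075464)]), (2838928,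
   [([1], 105030984)]), (2699672, [([1], 107127051)]), (2560397, [([1], 106066187)]), (2822537,
   [([1], 105033995)]), (2593216, [([1], 117600525)]), (2830728, [([1], 102929232)]), (3281288,
   [([1], 102933840)]), (2822592, [([1], 102936897)]), (2560452, [([1], 117600580)])]),
   ([3150220, 3150174, 3150248, 3150202], [(1700284, [([1], 112341711)]), (2560433, [([1],
   111571217)]), (2240984, [([1], 107151633)]), (2240956, [([1], 99811601)]), (2560367, [([1],
   92172578)]), (1929660, [([1], 115481323)]), (2011580, [([1], 115481333)]), (2756989, [([1],
   95854928)]), (2150872, [([1], 107151622)]), (2150844, [([1], 99811590)]), (2699614, [([1],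
   99783430)]), (1700312, [([1], 107123407)]), (2560405, [([1], 104231185)]), (2380248, [([1],
   107151650)]), (2380220, [([1], 99811618)]), (2699642, [([1], 99783458)]), (2568586, [([1],
   103969570)]), (2937208, [([1], 98741538)]), (1929688, [([1], 107123435)]), (2011608, [([1],
   107651317)]), (2691524, [([1], 101908808)]), (2691469, [([1], 87490888)]), (2691478, [([1],
   89850184)]), (2691423, [([1], 75432264)]), (2691552, [([1], 109248840)]), (2691497, [([1],
   94830920)]), (2691506, [([1], 97190216)]), (2691451, [([1], 82772296)]), (2560395, [([1],
   103444755)]), (2904444, [([1], 98747670)]), (2560422, [([1], 89834808)]), (2560450, [([1],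
   118649122)])]),
   ([3150218, 3150228, 3150173, 3150190, 3150256, 3150201], [(1700254, [([1], 116498182)]),
   (1929630, [([1], 116512518)]), (2150860, [([1], 119703814)]), (2150814, [([1], 100305158)]),
   (1700282, [([1], 116540623)]), (2011550, [([1], 123857615)]), (1700300, [([1], 112363727)]),
   (2560375, [([1], 96366865)]), (1929658, [([1], 116512546)]), (2380264, [([1], 125997346)]),
   (2380218, [([1], 113938722)]), (2011578, [([1], 123857643)]), (1929704, [([1], 112378091)]),
   (2142680, [([1], 107151621)]), (2142652, [([1], 99811589)]), (2535820, [([1], 103969541)]),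
   (2240972, [([1], 123872006)]), (2240926, [([1], 116531974)]), (2150888, [([1], 111345926)]),
   (2150842, [([1], 99287302)]), (2699630, [([1], 99259142)]), (2290072, [([1], 107113222)]),
   (1700328, [([1], 111317711)]), (2658713, [([1], 107645201)]), (2241000, [([1], 111345937)]),
   (2240954, [([1], 99287313)]), (2822515, [([1], 95334673)]), (2593185, [([1], 109738257)]),
   (2372028, [([1], 99811617)]), (2576785, [([1], 106067233)]), (2380236, [([1], 104005922)]),
   (2380190, [([1], 91947298)]), (2675066, [([1], 99781922)]), (1929676, [([1], 107121899)]),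
   (2011596, [([1], 107121909)]), (2011624, [([1], 109752565)]), (2691522, [([1], 101384520)]),
   (2691467, [([1], 86966600)]), (2691494, [([1], 94044488)]), (2691439, [([1], 79626568)]),
   (2560403, [([1], 105279755)]), (2560421, [([1], 109474061)]), (2757033, [([1], 94830928)]),
   (2691477, [([1], 107385093)]), (2691505, [([1], 111579409)]), (2560449, [([1], 118124817)])]),
   ([3150272, 3150217, 3150226, 3150171, 3150244, 3150189, 3150198, 3150143], [(1700253, [([1],
   116498181)]), (2240980, [([1], 123872005)]), (2240925, [([1], 116531973)]), (2011604, [([1],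
   123857669)]), (2011549, [([1], 116517637)]), (2142622, [([1], 91947269)]), (1700270, [([1],
   115973894)]), (2150858, [([1], 120734982)]), (2150830, [([1], 108676358)]), (2380234, [([1],
   128075014)]), (2380206, [([1], 116016390)]), (1929674, [([1], 128046854)]), (1929646, [([1],
   115988230)]), (2314615, [([1], 98464006)]), (2150868, [([1], 106103046)]), (2150813, [([1],
   91685126)]), (1700298, [([1], 120734927)]), (2241008, [([1], 123880209)]), (2240953, [([1],
   116540177)]), (2011577, [([1], 115993361)]), (1929657, [([1], 116512545)]), (2011632, [([1],
   123857697)]), (2372026, [([1], 99287329)]), (2380217, [([1], 113653026)]), (2380272, [([1],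
   113443106)]), (2543990, [([1], 98186515)]), (1700308, [([1], 123838213)]), (1700281, [([1],
   113652943)]), (2404734, [([1], 115493583)]), (2437471, [([1], 114447055)]), (2027930, [([1],
   107635407)]), (2027948, [([1], 112353999)]), (1962393, [([1], 107373775)]), (1831337, [([1],
   111569103)]), (2085267, [([1], 105803983)]), (2224505, [([1], 99025103)]), (2355561, [([1],
   94824655)]), (1831346, [([1], 111787793)]), (2412925, [([1], 100289809)]), (2511199, [([1],
   92165393)]), (1962420, [([1], 112320273)]), (2077067, [([1], 103677201)]), (1765818, [([1],
   113915095)]), (1929712, [([1], 123852577)]), (2208123, [([1], 100277025)]), (2191741, [([1],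
   100015393)]), (2560419, [([1], 103706913)]), (2257278, [([1], 100281122)]), (2306415, [([1],
   92156706)]), (1929629, [([1], 114432747)]), (2011566, [([1], 112334581)]), (2322825, [([1],
   103179533)]), (2544018, [([1], 105526547)]), (2126268, [([1], 99811587)]), (2142696, [([1],
   111345925)]), (2150896, [([1], 113443078)]), (2150841, [([1], 99025158)]), (2208169, [([1],
   111583439)]), (2306443, [([1], 125973199)]), (2191769, [([1], 107397327)]), (2732393, [([1],
   94838991)]), (2240970, [([1], 103481617)]), (2240942, [([1], 96141585)]), (2257306, [([1],
   107659479)]), (2511254, [([1], 119694551)]), (2372044, [([1], 104005921)]), (2371998, [([1],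
   91947297)]), (2380244, [([1], 106103074)]), (2380189, [([1], 91685154)]), (2634156, [([1],
   95617345)]), (2634110, [([1], 83558721)]), (2699657, [([1], 103166786)]), (2642356, [([1],
   97714498)]), (2642301, [([1], 83296578)]), (2773366, [([1], 98198852)]), (2691521, [([1],
   101122376)]), (2691475, [([1], 89063752)]), (2691493, [([1], 93782344)]), (2691447, [([1],
   81723720)]), (2756975, [([1], 79626576)]), (2888031, [([1], 75432288)]), (2699666, [([1],
   110276867), ([-2], 113414918), ([-1], 110269713)]), (2920850, [([1], 105566469)]), (2699684,
   [([1], 113414918)]), (2773412, [([1], 110269713)]), (2920841, [([1], 103467281)]), (2666920,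
   [([1], 111317765)]), (2896268, [([1], 103977761)]), (2208224, [([1], 111287105)]), (2527682,
   [([1], 105539906)]), (2929032, [([1], 102941453)]), (2920896, [([1], 102943041)]), (2544064,
   [([1], 117598530)]), (1700336, [([3, 1], 112341763), ([1], 91939075), ([1], 103969539), ([-1],
   106067203), ([1], 95597315), ([-1], 107108101), ([1], 113401093), ([-1], 96133381), ([1],
   103445253), ([3, 1], 113914630), ([1], 99795718), ([1], 107112198), ([-1], 111307526), ([1],
   105280774), ([1], 97170182), ([1], 111321807), ([-3, -1], 112334609), ([3, 1], 115481347),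
   ([-2, -1], 99788035), ([1], 98736899), ([-3, -1], 115507919), ([-3, -1], 99751745), ([1],
   98705217), ([1], 95593793)]), (2216369, [([1], 113676495)]), (2208178, [([1], 113942735)]),
   (2191796, [([1], 114475215)]), (2273706, [([1], 111811345)]), (2388380, [([1], 108140321)]),
   (2404762, [([1], 107621154)]), (1929684, [([1], 108167915)]), (2011594, [([1], 107644149)]),
   (2527627, [([1], 103715061)]), (1831392, [([1], 125967605)]), (2224560, [([1], 113360706)]),
   (2544009, [([1], 103180610)]), (2609537, [([1], 101084488)]), (2560391, [([1], 101064504)])]),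
   ([3150214, 3150159, 3150225, 3150242, 3150187, 3150197], [(2150912, [([1], 117637382)]),
   (2150857, [([1], 103219462)]), (2150838, [([1], 98238726)]), (2150783, [([1], 83820806)]),
   (1700223, [([1], 98210511)]), (2241024, [([1], 117637393)]), (2240923, [([1], 91160849)]),
   (2240996, [([1], 110297361)]), (2240895, [([1], 83820817)]), (2380288, [([1], 117637410)]),
   (2380233, [([1], 103219490)]), (2380214, [([1], 98238754)]), (2380159, [([1], 83820834)]),
   (1929599, [([1], 98210539)]), (2011519, [([1], 110245621)]), (2126284, [([1], 104005891)]),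
   (2126238, [([1], 91947267)]), (2126312, [([1], 111345923)]), (2126266, [([1], 99287299)]),
   (2224576, [([1], 117587203)]), (2453952, [([1], 117601539)]), (2142638, [([1], 108676357)]),
   (2642317, [([1], 112362757)]), (2142649, [([1], 99025157)]), (2773365, [([1], 99001605)]),
   (2535872, [([1], 117601029)]), (2372014, [([1], 116015878)]), (2150866, [([1], 105578758)]),
   (2150811, [([1], 91160838)]), (2150884, [([1], 110297350)]), (2150829, [([1], 95879430)]),
   (1896936, [([1], 128074447)]), (1700269, [([1], 100041935)]), (1700297, [([1], 111577295)]),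
   (1700251, [([1], 99518671)]), (1700278, [([1], 112338639)]), (2240969, [([1], 103219473)]),
   (2240978, [([1], 105578769)]), (2240941, [([1], 95879441)]), (2240950, [([1], 98238737)]),
   (1765872, [([1], 113419479)]), (2642345, [([1], 112362785)]), (2380242, [([1], 105578786)]),
   (2380187, [([1], 91160866)]), (2380260, [([1], 110297378)]), (2380205, [([1], 95879458)]),
   (1929645, [([1], 100041963)]), (1929673, [([1], 125967083)]), (1929627, [([1], 113908459)]),
   (1929654, [([1], 112338667)]), (2011574, [([1], 100303605)]), (2011547, [([1], 113908469)]),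
   (2011620, [([1], 110797045)]), (2011565, [([1], 96379125)]), (1700306, [([1], 123838211)]),
   (1929682, [([1], 123852547)]), (2691463, [([1], 104239363)]), (2691491, [([1], 111579395)]),
   (1700324, [([1], 128032517)]), (1929700, [([1], 128046853)]), (2011593, [([1], 128051973)]),
   (2011602, [([1], 130149126)]), (1700352, [([1], 117637327)]), (1929728, [([1], 117637355)]),
   (2011648, [([1], 117637365)])]),
   ([3150213, 3150167, 3150241, 3150195], [(2150854, [([1], 120720643)]), (2150799, [([1],
   108662019)]), (1700294, [([1], 120692483)]), (1700239, [([1], 108633859)]), (1700267, [([1],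
   115973891)]), (2380258, [([1], 128075011)]), (2380203, [([1], 116016387)]), (1929615, [([1],
   108648195)]), (1929698, [([1], 128046851)]), (1929643, [([1], 115988227)]), (2011535, [([1],
   108653315)]), (2011563, [([1], 115993347)]), (2126254, [([1], 96141571)]), (1700277, [([1],
   115711749)]), (2240977, [([1], 130163461)]), (2240949, [([1], 115745541)]), (2011601, [([1],
   130149125)]), (2011573, [([1], 115731205)]), (2150827, [([1], 134338310)]), (2150882, [([1],
   109773062)]), (2380175, [([1], 134366415)]), (1929653, [([1], 130143959)]), (2380230, [([1],
   102433058)]), (1700322, [([1], 128032515)]), (1929670, [([1], 120706819)]), (2126320, [([1],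
   113443075)]), (2126265, [([1], 99025155)]), (2453905, [([1], 105280771)]), (2380241, [([1],
   130172165)]), (2380213, [([1], 115754245)]), (2142665, [([1], 103219461)]), (2142619, [([1],
   91160837)]), (2142692, [([1], 110297349)]), (2142646, [([1], 98238725)]), (2421168, [([1],
   113399557)]), (2150865, [([1], 119939846)]), (2240911, [([1], 107881222)]), (2240966, [([1],
   127017734)]), (2150837, [([1], 114959110)]), (1765833, [([1], 119925510)]), (2273702, [([1],
   113912582)]), (1700305, [([1], 119939791)]), (2240994, [([1], 109773073)]), (2240939, [([1],
   95355153)]), (2503078, [([1], 106586914)]), (1929681, [([1], 113412843)]), (2011590, [([1],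
   110790901)]), (2011618, [([1], 110805237)])]),
   ([3150211, 3150183], [(2150853, [([1], 122817795)]), (2150807, [([1], 108399875)]), (1700293,
   [([1], 122789635)]), (1700247, [([1], 108371715)]), (1700275, [([1], 115711747)]), (2240965,
   [([1], 122823427)]), (2240919, [([1], 108405507)]), (2240993, [([1], 130163459)]), (2240947,
   [([1], 115745539)]), (2380257, [([1], 130172163)]), (2380211, [([1], 115754243)]), (1929623,
   [([1], 108386051)]), (1929697, [([1], 130144003)]), (1929651, [([1], 115726083)]), (2011589,
   [([1], 122809091)]), (2011543, [([1], 108391171)]), (2011617, [([1], 130149123)]), (2011571,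
   [([1], 115731203)]), (2126281, [([1], 103219459)]), (2126290, [([1], 105578755)]), (2126253,
   [([1], 95879427)]), (2126262, [([1], 98238723)]), (2380229, [([1], 119948549)]), (2142690,
   [([1], 122307845)]), (2142635, [([1], 112608517)]), (2380183, [([1], 114967813)]), (2150881,
   [([1], 126493446)]), (2150835, [([1], 112075526)]), (1929669, [([1], 122017542)]), (1765858,
   [([1], 126479110)]), (1700321, [([1], 126493391)])]),
   ([], [(2150851, [([1], 119934211)]), (2150823, [([1], 114953475)]), (1700291, [([1],
   119906051)]), (1700263, [([1], 112566019)]), (2380227, [([1], 119948547)]), (2380199, [([1],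
   114967811)]), (1929667, [([1], 119920387)]), (1929639, [([1], 112580355)]), (2126261, [([1],
   134343427)]), (2011559, [([1], 112585475)]), (2240935, [([1], 134336273)]), (2240963, [([1],
   101646609)]), (2011587, [([1], 119925507)])]),
   ([], []),
   ([], [])]

/-! ### Correctness of the bracket of monomials -/

/-- The value of a polynomial. -/
def polyEval (N : ℤ) : List ℤ → ℤ
  | [] => 0
  | a :: p => a + N * polyEval N p

theorem polyEval_add (N : ℤ) (p q : List ℤ) :
    polyEval N (polyAdd p q) = polyEval N p + polyEval N q := by
  induction p generalizing q with
  | nil => simp [polyAdd, polyEval]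
  | cons a p ih =>
    cases q with
    | nil => simp [polyAdd, polyEval]
    | cons b q => simp only [polyAdd, polyEval, ih]; ring

theorem polyEval_scale (N c : ℤ) (p : List ℤ) :
    polyEval N (polyScale c p) = c * polyEval N p := by
  induction p with
  | nil => simp [polyScale, polyEval]
  | cons a p ih => simp only [polyScale, polyEval, ih]; ring

theorem polyEval_mul (N : ℤ) (p q : List ℤ) :
    polyEval N (polyMul p q) = polyEval N p * polyEval N q := by
  induction p with
  | nil => simp [polyMul, polyEval]
  | cons a p ih => simp only [polyMul, polyEval, polyEval_add, polyEval_scale, ih]; ring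

section Eval

variable {V : Type u} [AddCommGroup V] [Module ℂ V]

/-- The value of a formal linear combination. -/
def Comb.eval (f : ℕ → V) (N : ℤ) : Comb → V
  | [] => 0
  | x :: l => (polyEval N x.1 : ℂ) • f x.2 + Comb.eval f N l

theorem Comb.eval_nil (f : ℕ → V) (N : ℤ) : Comb.eval f N [] = 0 := rfl

theorem Comb.eval_cons (f : ℕ → V) (N : ℤ) (x : List ℤ × ℕ) (l : Comb) :
    Comb.eval f N (x :: l) = (polyEval N x.1 : ℂ) • f x.2 + Comb.eval f N l := rfl

theorem Comb.eval_insert (f : ℕ → V) (N : ℤ) (p : List ℤ) (a : ℕ) (l : Comb) :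
    Comb.eval f N (Comb.insert p a l) = (polyEval N p : ℂ) • f a + Comb.eval f N l := by
  induction l with
  | nil => rfl
  | cons x l ih =>
    rw [Comb.insert]
    cases h : Nat.beq a x.2 with
    | true =>
      rw [cond_true, eval_cons, eval_cons, polyEval_add, Int.cast_add, add_smul,
        Nat.eq_of_beq_eq_true h, add_assoc]
    | false =>
      rw [cond_false, eval_cons, eval_cons, ih, add_left_comm]

theorem Comb.eval_insertAll (f : ℕ → V) (N : ℤ) (m : List ℤ) (l c : Comb) :
    Comb.eval f N (insertAll m l c) =
      (polyEval N m : ℂ) • Comb.eval f N c + Comb.eval f N l := by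
  induction c with
  | nil => simp [insertAll, Comb.eval_nil]
  | cons x c ih =>
    rw [insertAll, eval_insert, ih, eval_cons, polyEval_mul, smul_add, smul_smul, Int.cast_mul,
      add_assoc]

theorem polyEval_of_isZeroPoly (N : ℤ) {p : List ℤ} (h : isZeroPoly p = true) :
    polyEval N p = 0 := by
  induction p with
  | nil => rfl
  | cons a p ih =>
    simp only [isZeroPoly, Bool.and_eq_true, decide_eq_true_eq] at h
    rw [polyEval, h.1, ih h.2, mul_zero, zero_add]

theorem Comb.eval_nonzeroTerms (f : ℕ → V) (N : ℤ) (l : Comb) :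
    Comb.eval f N (nonzeroTerms l) = Comb.eval f N l := by
  induction l with
  | nil => rfl
  | cons x l ih =>
    rw [nonzeroTerms]
    cases h : isZeroPoly x.1 with
    | true => rw [cond_true, ih, eval_cons, polyEval_of_isZeroPoly N h, Int.cast_zero, zero_smul,
        zero_add]
    | false => rw [cond_false, eval_cons, eval_cons, ih]

theorem Comb.eval_normalize (f : ℕ → V) (N : ℤ) (l : Comb) :
    Comb.eval f N (normalize l) = Comb.eval f N l := by
  rw [normalize, eval_nonzeroTerms, eval_insertAll, eval_nil, add_zero]
  simp [polyEval]

theorem Comb.eval_eq_zero (f : ℕ → V) (N : ℤ) {l : Comb}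
    (h : (nonzeroTerms l).isEmpty = true) : Comb.eval f N l = 0 := by
  rw [← eval_nonzeroTerms, List.isEmpty_iff.1 h, eval_nil]

theorem Comb.eval_mem (f : ℕ → V) (N : ℤ) (W : Submodule ℂ V) {l : Comb}
    (h : ∀ x ∈ l, f x.2 ∈ W) : Comb.eval f N l ∈ W := by
  induction l with
  | nil => exact W.zero_mem
  | cons x l ih =>
    exact W.add_mem (W.smul_mem _ (h x (by simp))) (ih fun y hy => h y (by simp [hy]))

theorem Comb.map_eval {W : Type v} [AddCommGroup W] [Module ℂ W] (g : V →ₗ[ℂ] W) (f : ℕ → V)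
    (N : ℤ) (l : Comb) : g (Comb.eval f N l) = Comb.eval (fun k => g (f k)) N l := by
  induction l with
  | nil => exact map_zero g
  | cons x l ih => rw [eval_cons, eval_cons, map_add, map_smul, ih]

theorem Comb.eval_congr {f g : ℕ → V} (N : ℤ) {l : Comb} (h : ∀ x ∈ l, f x.2 = g x.2) :
    Comb.eval f N l = Comb.eval g N l := by
  induction l with
  | nil => rfl
  | cons x l ih =>
    rw [eval_cons, eval_cons, h x (by simp), ih fun y hy => h y (by simp [hy])]

end Eval

/-- The set of the bits of a number. -/
def maskSet (S : ℕ) : Finset (Fin 6) := Finset.univ.filter fun i => S.testBit i = true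

theorem mem_maskSet {S : ℕ} {i : Fin 6} : i ∈ maskSet S ↔ S.testBit i = true := by
  simp [maskSet]

theorem card_maskSet {S : ℕ} (h : S < 64) : (maskSet S).card = bitCount S := by
  have : ∀ S : Fin 64, (maskSet S).card = bitCount S := by decide +kernel
  exact this ⟨S, h⟩

theorem exists_maskSet (S : Finset (Fin 6)) : ∃ s < 64, maskSet s = S := by
  revert S; decide +kernel

theorem maskSet_lor (S T : ℕ) : maskSet (S ||| T) = maskSet S ∪ maskSet T := by
  ext i; simp [mem_maskSet, Nat.testBit_or]

theorem land_eq_zero_iff {S : ℕ} (T : ℕ) (h : S < 64) :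
    S &&& T = 0 ↔ Disjoint (maskSet S) (maskSet T) := by
  rw [Finset.disjoint_left]
  constructor
  · intro h0 i hi hj
    rw [mem_maskSet] at hi hj
    have := congrArg (fun k => Nat.testBit k i) h0
    simp [Nat.testBit_and, hi, hj] at this
  · intro hd
    refine Nat.eq_of_testBit_eq fun i => ?_
    rw [Nat.testBit_and, Nat.zero_testBit]
    by_cases hi : i < 6
    · have := @hd ⟨i, hi⟩
      simp only [mem_maskSet] at this
      cases hS : S.testBit i <;> cases hT : T.testBit i <;> simp_all
    · have : S.testBit i = false := by
        refine Nat.testBit_lt_two_pow (lt_of_lt_of_le h ?_)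
        calc 64 = 2 ^ 6 := by norm_num
          _ ≤ 2 ^ i := Nat.pow_le_pow_right (by norm_num) (by omega)
      simp [this]

theorem below_maskSet {S : ℕ} (h : S < 64) (i : Fin 6) :
    below (maskSet S) i = bitCount (S % 2 ^ (i : ℕ)) := by
  have : ∀ (S : Fin 64) (i : Fin 6), below (maskSet S) i = bitCount (S % 2 ^ (i : ℕ)) := by
    decide +kernel
  exact this ⟨S, h⟩ i

theorem maskSet_sub {S : ℕ} (h : S < 64) (i : Fin 6) (hi : i ∈ maskSet S) :
    maskSet (S - 2 ^ (i : ℕ)) = (maskSet S).erase i := by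
  have : ∀ (S : Fin 64) (i : Fin 6), i ∈ maskSet S →
      maskSet (S - 2 ^ (i : ℕ)) = (maskSet S).erase i := by
    decide +kernel
  exact this ⟨S, h⟩ i hi

theorem land_two_pow_eq_zero_iff {S : ℕ} (h : S < 64) (i : Fin 6) :
    S &&& 2 ^ (i : ℕ) = 0 ↔ i ∉ maskSet S := by
  have : ∀ (S : Fin 64) (i : Fin 6), S.1 &&& 2 ^ (i : ℕ) = 0 ↔ i ∉ maskSet S := by
    decide +kernel
  exact this ⟨S, h⟩ i

/-- An element `i` of the first set contributes the number of bits of `T` below `i`, which is the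
bit count of `T` modulo `2 ^ i`. The lowest bit contributes nothing. -/
theorem invCount_maskSet (S : ℕ) {T : ℕ} (hT : T < 64) :
    invCount (maskSet S) (maskSet T) = bitInv S T := by
  have h1 : ∀ i : Fin 6, (∑ j ∈ maskSet T, if j < i then 1 else 0) = bitCount (T % 2 ^ (i : ℕ)) :=
    fun i => by rw [← below_maskSet hT, below, Finset.card_filter]
  have h2 : ∀ (i : ℕ) (x : ℕ), (if S.testBit i = true then x else 0) = S / 2 ^ i % 2 * x := by
    intro i x
    rw [Nat.testBit_eq_decide_div_mod_eq]
    rcases Nat.mod_two_eq_zero_or_one (S / 2 ^ i) with h | h <;> simp [h]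
  have h3 : bitCount (T % 2) = T % 2 := by
    rcases Nat.mod_two_eq_zero_or_one T with h | h <;> rw [h] <;> rfl
  have h4 : bitCount 0 = 0 := rfl
  rw [invCount_eq_sum, Finset.sum_congr rfl fun i _ => h1 i, maskSet, Finset.sum_filter]
  simp only [h2]
  simp [Fin.sum_univ_six, bitInv, h3, h4, Nat.mod_one, add_assoc]

theorem intSign_eq (k : ℕ) : ((intSign k : ℤ) : ℂ) = (-1) ^ k := by
  have : Nat.mod k 2 = k % 2 := rfl
  rw [intSign, this]
  rcases Nat.even_or_odd k with h | h
  · rw [Nat.even_iff.1 h, h.neg_one_pow]; exact Int.cast_one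
  · rw [Nat.odd_iff.1 h, h.neg_one_pow]
    show ((-1 : ℤ) : ℂ) = -1
    norm_num

theorem force_eq {α : Type} (n : ℕ) (f : ℕ → α) : force n f = f n := by
  cases n <;> rfl

/-- The monomial encoded by `64 (n + 4) + S + 4096 e`, with exponent `n + e N`. -/
def rawVec (N : ℤ) (k : ℕ) : Fn :=
  mono (((k / 64 % 64 : ℕ) : ℤ) - 4 + N * ((k / 4096 : ℕ) : ℤ)) (maskSet (k % 64))

/-- The basis vector with a given label. -/
def basisVec (N : ℤ) (k : ℕ) : Fn :=
  if k = 282 then rawVec N 282 + rawVec N 300 else rawVec N k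

/-- The correction `-2 ∂ₜ(f) g` turns the coefficient `(2 - |S|) m + n |T|` into an antisymmetric
one. -/
theorem contactBracket_mono (n m : ℤ) (S T : Finset (Fin 6)) :
    contactBracket (mono n S) (mono m T) =
      ((2 - (S.card : ℂ)) * m - (2 - (T.card : ℂ)) * n) • tInv (mulFn (mono n S) (mono m T)) -
        (-1 : ℂ) ^ S.card • ∑ i : Fin 6, mulFn (dOdd i (mono n S)) (dOdd (i + 3) (mono m T)) := by
  rw [contactBracket_apply, (isHom_mono n S).contactField_apply (isHom_mono m T),
    (isHom_mono n S).dt_eq, map_smul, LinearMap.smul_apply, tInv_mulFn_left, smul_smul,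
    sub_right_comm, ← sub_smul]
  congr 2
  ring

/-- The label `282` means a sum of two monomials while `300` keeps its own, so the monomial with
code `282` is the difference of these two vectors. -/
theorem eval_pushMono (N : ℤ) (p : List ℤ) (k : ℕ) (l : Comb) :
    Comb.eval (basisVec N) N (pushMono p k l) =
      (polyEval N p : ℂ) • rawVec N k + Comb.eval (basisVec N) N l := by
  rw [pushMono]
  cases h : Nat.beq k 282 with
  | true =>
    obtain rfl := Nat.eq_of_beq_eq_true h
    rw [cond_true, Comb.eval_cons, Comb.eval_cons, polyEval_scale]
    simp only [basisVec, if_true, show (300 : ℕ) ≠ 282 by norm_num, if_false]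
    push_cast
    module
  | false =>
    rw [cond_false, Comb.eval_cons, basisVec, if_neg (Nat.ne_of_beq_eq_false h)]

theorem rawVec_pair (N : ℤ) {c e S : ℕ} (hS : S < 64) (hc : c < 64) :
    rawVec N (64 * (c + 64 * e) + S) = mono ((c : ℤ) - 4 + N * e) (maskSet S) := by
  have h1 : (64 * (c + 64 * e) + S) / 64 % 64 = c := by omega
  have h2 : (64 * (c + 64 * e) + S) / 4096 = e := by omega
  have h3 : (64 * (c + 64 * e) + S) % 64 = S := by omega
  rw [rawVec, h1, h2, h3]

/-- Exponents are stored with offset `4`, so the exponent `n + m - 1` of `t⁻¹ f g` has the code `h +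
k - 5`. The bounds on `c + d` prevent a borrow from or a carry into the field that counts multiples
of `N`, hence these fields simply add. -/
theorem eval_unionTerm (N : ℤ) {S T c d : ℕ} (e f : ℕ) (hS : S < 64) (hT : T < 64)
    (hc : 5 ≤ c + d) (hd : c + d < 69) (hc2 : c < 64) (hd2 : d < 64) (l : Comb) :
    Comb.eval (basisVec N) N (unionTerm S T (c + 64 * e) (d + 64 * f) l) =
      ((2 - ((maskSet S).card : ℂ)) * ((d : ℤ) - 4 + N * f : ℤ) -
        (2 - ((maskSet T).card : ℂ)) * ((c : ℤ) - 4 + N * e : ℤ)) •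
        tInv (mulFn (mono ((c : ℤ) - 4 + N * e) (maskSet S))
          (mono ((d : ℤ) - 4 + N * f) (maskSet T))) + Comb.eval (basisVec N) N l := by
  rw [unionTerm]
  have hl : Nat.land S T = S &&& T := rfl
  cases h : Nat.beq (Nat.land S T) 0 with
  | true =>
    have hdis := (land_eq_zero_iff T hS).1 (Nat.eq_of_beq_eq_true h)
    have hk : Nat.add (Nat.mul 64 (Nat.sub (Nat.add (c + 64 * e) (d + 64 * f)) 5)) (Nat.lor S T) =
        64 * (c + d - 5 + 64 * (e + f)) + (S ||| T) := by
      show 64 * (c + 64 * e + (d + 64 * f) - 5) + (S ||| T) = _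
      omega
    have hST : S ||| T < 64 := Nat.or_lt_two_pow (n := 6) hS hT
    have hm1 : (d + 64 * f) % 64 = d := by omega
    have hm2 : (c + 64 * e) % 64 = c := by omega
    have hm3 : (d + 64 * f) / 64 = f := by omega
    have hm4 : (c + 64 * e) / 64 = e := by omega
    rw [cond_true, eval_pushMono, hk, rawVec_pair N hST (by omega), mulFn_mono_of_disjoint _ _ hdis,
      map_smul, tInv_mono, maskSet_lor, invCount_maskSet S hT, smul_smul, card_maskSet hS,
      card_maskSet hT, hm1, hm2, hm3, hm4]
    have he : ((c + d - 5 : ℕ) : ℤ) - 4 + N * ((e + f : ℕ) : ℤ) =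
        (c : ℤ) - 4 + N * e + ((d : ℤ) - 4 + N * f) - 1 := by
      rw [Nat.cast_sub hc]; push_cast; ring
    rw [he]
    congr 2
    simp only [polyEval]
    push_cast
    rw [intSign_eq]
    ring
  | false =>
    have hdis : ¬ Disjoint (maskSet S) (maskSet T) := fun hh =>
      Nat.ne_of_beq_eq_false h ((land_eq_zero_iff T hS).2 hh)
    rw [cond_false, mulFn_mono_of_not_disjoint _ _ hdis, map_zero, smul_zero, zero_add]

/-- The exponent `n + m` has the code `h + k - 4`. The sign collects the factor `-(-1)^|S|`, the
positions of the two removed coordinates and the inversions of what is left. -/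
theorem eval_poissonTerm (N : ℤ) {S T c d e f : ℕ} (i j : Fin 6) (hS : S < 64) (hT : T < 64)
    (hc : 4 ≤ c + d) (hd : c + d < 68) (l : Comb) :
    Comb.eval (basisVec N) N (poissonTerm (2 ^ (i : ℕ)) (2 ^ (j : ℕ)) S T
        (c + d + 64 * (e + f)) l) =
      -(-1 : ℂ) ^ (maskSet S).card • mulFn (dOdd i (mono ((c : ℤ) - 4 + N * e) (maskSet S)))
          (dOdd j (mono ((d : ℤ) - 4 + N * f) (maskSet T))) + Comb.eval (basisVec N) N l := by
  rw [poissonTerm]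
  have hl : ∀ S T, Nat.land S T = S &&& T := fun _ _ => rfl
  have hs : ∀ S T, Nat.sub S T = S - T := fun _ _ => rfl
  cases h : Nat.beq (Nat.land S (2 ^ (i : ℕ))) 0 with
  | true =>
    have := (land_two_pow_eq_zero_iff hS i).1 (Nat.eq_of_beq_eq_true h)
    rw [cond_true, dOdd_mono_of_notMem _ this, map_zero, LinearMap.zero_apply, smul_zero, zero_add]
  | false =>
  have hi : i ∈ maskSet S := by
    by_contra hh
    exact Nat.ne_of_beq_eq_false h ((land_two_pow_eq_zero_iff hS i).2 hh)
  rw [cond_false]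
  cases h' : Nat.beq (Nat.land T (2 ^ (j : ℕ))) 0 with
  | true =>
    have := (land_two_pow_eq_zero_iff hT j).1 (Nat.eq_of_beq_eq_true h')
    rw [cond_true, dOdd_mono_of_notMem _ this, map_zero, smul_zero, zero_add]
  | false =>
  have hj : j ∈ maskSet T := by
    by_contra hh
    exact Nat.ne_of_beq_eq_false h' ((land_two_pow_eq_zero_iff hT j).2 hh)
  rw [cond_false, hs, hs, hl]
  have hS' : S - 2 ^ (i : ℕ) < 64 := lt_of_le_of_lt (Nat.sub_le _ _) hS
  have hT' : T - 2 ^ (j : ℕ) < 64 := lt_of_le_of_lt (Nat.sub_le _ _) hT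
  rw [dOdd_mono_of_mem _ hi, dOdd_mono_of_mem _ hj, map_smul, map_smul, LinearMap.smul_apply,
    ← maskSet_sub hS i hi, ← maskSet_sub hT j hj]
  cases hd2 : Nat.beq ((S - 2 ^ (i : ℕ)) &&& (T - 2 ^ (j : ℕ))) 0 with
  | true =>
    have hdis := (land_eq_zero_iff _ hS').1 (Nat.eq_of_beq_eq_true hd2)
    have hST : (S - 2 ^ (i : ℕ)) ||| (T - 2 ^ (j : ℕ)) < 64 := Nat.or_lt_two_pow (n := 6) hS' hT'
    have hk : Nat.add (Nat.mul 64 (Nat.sub (c + d + 64 * (e + f)) 4))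
        (Nat.lor (S - 2 ^ (i : ℕ)) (T - 2 ^ (j : ℕ))) =
        64 * (c + d - 4 + 64 * (e + f)) + ((S - 2 ^ (i : ℕ)) ||| (T - 2 ^ (j : ℕ))) := by
      show 64 * (c + d + 64 * (e + f) - 4) + ((S - 2 ^ (i : ℕ)) ||| (T - 2 ^ (j : ℕ))) = _
      omega
    rw [cond_true, eval_pushMono, hk, rawVec_pair N hST (by omega), mulFn_mono_of_disjoint _ _ hdis,
      maskSet_lor, invCount_maskSet _ hT', card_maskSet hS, below_maskSet hS, below_maskSet hT]
    have he : ((c + d - 4 : ℕ) : ℤ) - 4 + N * ((e + f : ℕ) : ℤ) =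
        (c : ℤ) - 4 + N * e + ((d : ℤ) - 4 + N * f) := by
      rw [Nat.cast_sub hc]; push_cast; ring
    rw [he]
    simp only [polyEval, smul_smul, mul_zero, add_zero]
    rw [intSign_eq]
    congr 2
    ring
  | false =>
    have hdis : ¬ Disjoint (maskSet (S - 2 ^ (i : ℕ))) (maskSet (T - 2 ^ (j : ℕ))) := fun hh =>
      Nat.ne_of_beq_eq_false hd2 ((land_eq_zero_iff _ hS').2 hh)
    rw [cond_false, mulFn_mono_of_not_disjoint _ _ hdis, smul_zero, smul_zero, smul_zero, zero_add]

/-- Labels whose brackets can be computed in terms of their codes. -/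
def ValidKey (k : ℕ) : Prop := 3 ≤ k / 64 % 64 ∧ k / 64 % 64 ≤ 30

/-- Valid keys have exponent codes from `3` to `30`, so the sum of two of them meets the bounds
needed for the product and for the Poisson terms. -/
theorem eval_monoBracket (N : ℤ) {a b : ℕ} (ha : ValidKey a) (hb : ValidKey b) (l : Comb) :
    Comb.eval (basisVec N) N (monoBracket a b l) =
      contactBracket (rawVec N a) (rawVec N b) + Comb.eval (basisVec N) N l := by
  obtain ⟨ha1, ha2⟩ := ha
  obtain ⟨hb1, hb2⟩ := hb
  have e1 : Nat.div a 64 = a / 64 % 64 + 64 * (a / 4096) := by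
    show a / 64 = _
    omega
  have e2 : Nat.div b 64 = b / 64 % 64 + 64 * (b / 4096) := by
    show b / 64 = _
    omega
  have e3 : Nat.mod a 64 = a % 64 := rfl
  have e4 : Nat.mod b 64 = b % 64 := rfl
  have hS : a % 64 < 64 := Nat.mod_lt _ (by norm_num)
  have hT : b % 64 < 64 := Nat.mod_lt _ (by norm_num)
  have e5 : ∀ c d e f : ℕ, Nat.add (c + 64 * e) (d + 64 * f) = c + d + 64 * (e + f) := by
    intro c d e f
    show c + 64 * e + (d + 64 * f) = _
    ring
  rw [monoBracket, force_eq, force_eq, force_eq, force_eq, force_eq, e1, e2, e3, e4,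
    eval_unionTerm N _ _ hS hT (by omega) (by omega) (by omega) (by omega), e5, rawVec, rawVec,
    contactBracket_mono, poissonTerms]
  generalize a / 64 % 64 = c at *
  generalize b / 64 % 64 = d at *
  generalize a / 4096 = e at *
  generalize b / 4096 = f at *
  have hp := fun (i j : Fin 6) (l : Comb) => eval_poissonTerm N (e := e) (f := f) (c := c) (d := d)
    i j hS hT (by omega) (by omega) l
  have h03 := hp 0 3
  have h14 := hp 1 4
  have h25 := hp 2 5
  have h30 := hp 3 0
  have h41 := hp 4 1
  have h52 := hp 5 2
  norm_num at h03 h14 h25 h30 h41 h52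
  rw [h03, h14, h25, h30, h41, h52]
  rw [Fin.sum_univ_six]
  have k0 : (0 : Fin 6) + 3 = 3 := by decide
  have k1 : (1 : Fin 6) + 3 = 4 := by decide
  have k2 : (2 : Fin 6) + 3 = 5 := by decide
  have k3 : (3 : Fin 6) + 3 = 0 := by decide
  have k4 : (4 : Fin 6) + 3 = 1 := by decide
  have k5 : (5 : Fin 6) + 3 = 2 := by decide
  rw [k0, k1, k2, k3, k4, k5]
  push_cast
  module

theorem eval_labBracketAux (N : ℤ) {a b : ℕ} (ha : ValidKey a) (hb : ValidKey b) (l : Comb) :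
    Comb.eval (basisVec N) N (labBracketAux a b l) =
      contactBracket (rawVec N a) (basisVec N b) + Comb.eval (basisVec N) N l := by
  rw [labBracketAux]
  cases h : Nat.beq b 282 with
  | true =>
    obtain rfl := Nat.eq_of_beq_eq_true h
    rw [cond_true, eval_monoBracket N ha hb, eval_monoBracket N ha (by norm_num [ValidKey]), basisVec,
      if_pos rfl, map_add, add_assoc]
  | false =>
    rw [cond_false, eval_monoBracket N ha hb, basisVec, if_neg (Nat.ne_of_beq_eq_false h)]

theorem eval_labBracket (N : ℤ) {a b : ℕ} (ha : ValidKey a) (hb : ValidKey b) :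
    Comb.eval (basisVec N) N (labBracket a b) =
      contactBracket (basisVec N a) (basisVec N b) := by
  rw [labBracket]
  cases h : Nat.beq a 282 with
  | true =>
    obtain rfl := Nat.eq_of_beq_eq_true h
    rw [cond_true, eval_labBracketAux N ha hb, eval_labBracketAux N (by norm_num [ValidKey]) hb,
      basisVec.eq_1 N 282, if_pos rfl, map_add, LinearMap.add_apply, Comb.eval_nil, add_zero]
  | false =>
    rw [cond_false, eval_labBracketAux N ha hb, basisVec.eq_1 N a,
      if_neg (Nat.ne_of_beq_eq_false h), Comb.eval_nil, add_zero]

/-! ### The grading of the positive part -/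

/-- The elements whose contact fields have a given parity. -/
def fnPart (i : ZMod 2) : Submodule ℂ Fn :=
  (LieSuperalgebra.part (V := Module.End ℂ Fn) i).comap contactField

theorem mono_mem_fnPart (n : ℤ) (S : Finset (Fin 6)) : mono n S ∈ fnPart (S.card : ZMod 2) :=
  contactField_mem n S

theorem contactBracket_skew {i j : ZMod 2} {x y : Fn} (hx : x ∈ fnPart i) (hy : y ∈ fnPart j) :
    contactBracket x y = -(koszul i j • contactBracket y x) := by
  apply contactField_injective
  have := LieSuperalgebra.bracket_skew (V := Module.End ℂ Fn) hx hy
  rwa [bracket_contactField, bracket_contactField, ← map_smul, ← map_neg] at this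

/-- Inherited from the supercommutator of operators through the injective map `contactField`; no
separate computation is needed. -/
theorem contactBracket_jacobi {i j k : ZMod 2} {x y z : Fn} (hx : x ∈ fnPart i)
    (hy : y ∈ fnPart j) (hz : z ∈ fnPart k) : contactBracket x (contactBracket y z) =
      contactBracket (contactBracket x y) z + koszul i j • contactBracket y (contactBracket x z) := by
  apply contactField_injective
  have := LieSuperalgebra.jacobi (V := Module.End ℂ Fn) hx hy hz
  simpa only [bracket_contactField, ← map_smul, ← map_add] using this

/-- The weights of the odd coordinates in the grading by height. -/
def oddHeight : Fin 6 → ℤ := ![6, 5, 4, 2, 3, 4]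

/-- The degree of a monomial. -/
def degree (n : ℤ) (S : Finset (Fin 6)) : ℤ := 2 * n + S.card - 2

/-- The height of a monomial: four times its degree plus the value of its weight on `(2, 1, 0)`. -/
def height (n : ℤ) (S : Finset (Fin 6)) : ℤ := 8 * n - 8 + ∑ i ∈ S, oddHeight i

theorem oddHeight_add (i : Fin 6) : oddHeight i + oddHeight (i + 3) = 8 := by
  revert i; decide

/-- The span of the monomials of given degree and height. -/
def piece (d h : ℤ) : Submodule ℂ Fn :=
  Submodule.span ℂ {f | ∃ n S, degree n S = d ∧ height n S = h ∧ f = mono n S}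

theorem mono_mem_piece {d h n : ℤ} {S : Finset (Fin 6)} (hd : degree n S = d)
    (hh : height n S = h) : mono n S ∈ piece d h :=
  Submodule.subset_span ⟨n, S, hd, hh, rfl⟩

theorem bracket_mem_of_span {V : Type u} [AddCommGroup V] [Module ℂ V] (β : V →ₗ[ℂ] V →ₗ[ℂ] V)
    {s t : Set V} {W : Submodule ℂ V} (h : ∀ x ∈ s, ∀ y ∈ t, β x y ∈ W) {x y : V}
    (hx : x ∈ Submodule.span ℂ s) (hy : y ∈ Submodule.span ℂ t) : β x y ∈ W := by
  induction hx using Submodule.span_induction with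
  | mem x hx =>
    induction hy using Submodule.span_induction with
    | mem y hy => exact h x hx y hy
    | zero => rw [map_zero]; exact W.zero_mem
    | add y z _ _ hy hz => rw [map_add]; exact W.add_mem hy hz
    | smul c y _ hy => rw [map_smul]; exact W.smul_mem c hy
  | zero => rw [map_zero]; exact W.zero_mem
  | add y z _ _ hy hz => rw [map_add]; exact W.add_mem hy hz
  | smul c y _ hy => rw [map_smul]; exact W.smul_mem c hy

/-- Degree and height vanish for `t`, the function whose field has the normalised degree zero. The
product term loses one `t`, of height `8`; a Poisson term loses a pair `ξₖ, ηₖ`, also of height `8`.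
-/
theorem contactBracket_mem_piece {d h d' h' : ℤ} {x y : Fn} (hx : x ∈ piece d h)
    (hy : y ∈ piece d' h') : contactBracket x y ∈ piece (d + d') (h + h') := by
  refine bracket_mem_of_span contactBracket ?_ hx hy
  rintro _ ⟨n, S, rfl, rfl, rfl⟩ _ ⟨m, T, rfl, rfl, rfl⟩
  rw [contactBracket_mono]
  refine sub_mem (Submodule.smul_mem _ _ ?_)
    (Submodule.smul_mem _ _ (Submodule.sum_mem _ fun i _ => ?_))
  · by_cases hd : Disjoint S T
    · rw [mulFn_mono_of_disjoint _ _ hd, map_smul, tInv_mono]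
      refine Submodule.smul_mem _ _ (mono_mem_piece ?_ ?_)
      · rw [degree, degree, degree, Finset.card_union_of_disjoint hd]; push_cast; ring
      · rw [height, height, height, Finset.sum_union hd]; ring
    · rw [mulFn_mono_of_not_disjoint _ _ hd, map_zero]; exact Submodule.zero_mem _
  · by_cases hi : i ∈ S
    swap
    · rw [dOdd_mono_of_notMem _ hi, map_zero]; exact Submodule.zero_mem _
    by_cases hj : i + 3 ∈ T
    swap
    · rw [dOdd_mono_of_notMem _ hj, map_zero]; exact Submodule.zero_mem _
    rw [dOdd_mono_of_mem _ hi, dOdd_mono_of_mem _ hj, map_smul, map_smul, LinearMap.smul_apply]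
    refine Submodule.smul_mem _ _ (Submodule.smul_mem _ _ ?_)
    by_cases hd : Disjoint (S.erase i) (T.erase (i + 3))
    · rw [mulFn_mono_of_disjoint _ _ hd]
      refine Submodule.smul_mem _ _ (mono_mem_piece ?_ ?_)
      · have h1 := Finset.card_erase_add_one hi
        have h2 := Finset.card_erase_add_one hj
        rw [degree, degree, degree, Finset.card_union_of_disjoint hd, ← h1, ← h2]
        push_cast; ring
      · have h1 := Finset.add_sum_erase S oddHeight hi
        have h2 := Finset.add_sum_erase T oddHeight hj
        rw [height, height, height, Finset.sum_union hd, ← h1, ← h2]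
        linarith [oddHeight_add i]
    · rw [mulFn_mono_of_not_disjoint _ _ hd]; exact Submodule.zero_mem _

/-- The monomials in the positive part. -/
def IsPositive (n : ℤ) (S : Finset (Fin 6)) : Prop :=
  0 ≤ degree n S ∧ (degree n S = 0 → 0 < height n S) ∧
    (degree n S = 1 → S ≠ {2, 3, 4} ∧ S ≠ {1, 3, 4} ∧ S ≠ {2, 3, 5})

/-- A basis of the component of given degree and height of the positive part. -/
def posBasis (d h : ℤ) : Set Fn :=
  {f | (∃ n S, IsPositive n S ∧ degree n S = d ∧ height n S = h ∧ f = mono n S) ∨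
    (d = 1 ∧ h = 2 ∧ f = mono 0 {1, 3, 4} + mono 0 {2, 3, 5})}

/-- The component of given height of the positive part. -/
def posPart (h : ℤ) : Submodule ℂ Fn := Submodule.span ℂ (⋃ d, posBasis d h)

theorem posBasis_subset (d h : ℤ) : posBasis d h ⊆ posPart h :=
  (Set.subset_iUnion (fun d => posBasis d h) d).trans Submodule.subset_span

theorem posBasis_subset_piece (d h : ℤ) : posBasis d h ⊆ piece d h := by
  rintro f (⟨n, S, -, h1, h2, rfl⟩ | ⟨rfl, rfl, rfl⟩)
  · exact mono_mem_piece h1 h2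
  · exact add_mem (mono_mem_piece (by decide) (by decide)) (mono_mem_piece (by decide) (by decide))

/-- All the exclusions concern degrees zero and one. -/
theorem piece_le_posPart {d : ℤ} (hd : 2 ≤ d) (h : ℤ) : piece d h ≤ posPart h := by
  refine Submodule.span_le.2 ?_
  rintro _ ⟨n, S, h1, h2, rfl⟩
  exact posBasis_subset d h (Or.inl ⟨n, S, ⟨by omega, by omega, by omega⟩, h1, h2, rfl⟩)

theorem sum_oddHeight_maskSet {s : ℕ} (h : s < 64) :
    ∑ i ∈ maskSet s, oddHeight i + 6 = 4 * bitCount s + labWt s ∧ 3 ≤ labWt s ∧ labWt s ≤ 9 := by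
  have : ∀ s : Fin 64, ∑ i ∈ maskSet s, oddHeight i + 6 = 4 * bitCount s + labWt s ∧
    3 ≤ labWt s ∧ labWt s ≤ 9 := by decide +kernel
  exact this ⟨s, h⟩

theorem labWt_mod (a : ℕ) : labWt (a % 64) = labWt a := by
  show 6 + (2 * (a % 64 % 2) + a % 64 / 2 % 2) - 2 * (a % 64 / 8 % 2) - a % 64 / 16 % 2 =
    6 + (2 * (a % 2) + a / 2 % 2) - 2 * (a / 8 % 2) - a / 16 % 2
  have h1 : a % 64 % 2 = a % 2 := by omega
  have h2 : a % 64 / 2 % 2 = a / 2 % 2 := by omega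
  have h3 : a % 64 / 8 % 2 = a / 8 % 2 := by omega
  have h4 : a % 64 / 16 % 2 = a / 16 % 2 := by omega
  rw [h1, h2, h3, h4]

theorem bitCount_le (s : ℕ) : bitCount s ≤ 6 := by
  show s % 2 + (s / 2 % 2 + (s / 4 % 2 + (s / 8 % 2 + (s / 16 % 2 + s / 32 % 2)))) ≤ 6
  omega

theorem labDeg_eq (a : ℕ) : labDeg a = 2 * (a / 64 % 64) + bitCount (a % 64) - 10 := rfl

theorem labHt_eq (a : ℕ) : labHt a = 4 * labDeg a + labWt a - 6 := rfl

/-- The lower bound `3` is the exponent `-1`, the least that occurs in the positive part. The upper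
bound `20` only keeps the computation in range; `10` is the offset of the degree. -/
theorem isLab_iff (a : ℕ) : isLab a = true ↔ 3 ≤ a / 64 % 64 ∧ a / 64 % 64 ≤ 20 ∧
    10 ≤ 2 * (a / 64 % 64) + bitCount (a % 64) ∧ (labDeg a = 0 → 7 ≤ labWt a) ∧
    (labDeg a ≠ 0 → a ≠ 284 ∧ a ≠ 300) := by
  have hm : Nat.mod (Nat.div a 64) 64 = a / 64 % 64 := rfl
  have hm2 : Nat.mod a 64 = a % 64 := rfl
  have ha : ∀ x y, Nat.add x y = x + y := fun _ _ => rfl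
  have hmu : ∀ x y, Nat.mul x y = x * y := fun _ _ => rfl
  rw [isLab, force_eq, hm, hm2, ha, hmu]
  simp only [Bool.and_eq_true, Nat.ble_eq]
  by_cases h : labDeg a = 0
  · simp [h]
  · have hb : Nat.beq (labDeg a) 0 = false := by
      rw [← Bool.not_eq_true, Nat.beq_eq]; exact h
    have hb1 : ∀ c, (!Nat.beq a c) = true ↔ a ≠ c := fun c => by
      rw [Bool.not_eq_true', ← Bool.not_eq_true, Nat.beq_eq]
    simp only [hb, cond_false, Bool.and_eq_true, hb1, h, false_imp_iff, true_and, ne_eq,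
      not_false_eq_true, true_imp_iff]

theorem exceptional_masks {s : ℕ} (h : s < 64) : (maskSet s = {2, 3, 4} ↔ s = 28) ∧
    (maskSet s = {1, 3, 4} ↔ s = 26) ∧ (maskSet s = {2, 3, 5} ↔ s = 44) := by
  have : ∀ s : Fin 64, (maskSet s = {2, 3, 4} ↔ s.1 = 28) ∧ (maskSet s = {1, 3, 4} ↔ s.1 = 26) ∧
    (maskSet s = {2, 3, 5} ↔ s.1 = 44) := by decide +kernel
  exact this ⟨s, h⟩

theorem basisVec_of_ne (N : ℤ) {k : ℕ} (h : k ≠ 282) : basisVec N k = rawVec N k := if_neg h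

theorem rawVec_add (N : ℤ) {a : ℕ} (e : ℕ) (h : a < 4096) : rawVec N (a + 4096 * e) =
    mono ((a / 64 % 64 : ℕ) - 4 + N * e) (maskSet (a % 64)) := by
  have h1 : (a + 4096 * e) / 64 % 64 = a / 64 % 64 := by omega
  have h2 : (a + 4096 * e) / 4096 = e := by omega
  have h3 : (a + 4096 * e) % 64 = a % 64 := by omega
  rw [rawVec, h1, h2, h3]

theorem basisVec_282 (N : ℤ) : basisVec N 282 = mono 0 {1, 3, 4} + mono 0 {2, 3, 5} := by
  have h1 : maskSet (282 % 64) = {1, 3, 4} := by decide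
  have h2 : maskSet (300 % 64) = {2, 3, 5} := by decide
  rw [basisVec, if_pos rfl, rawVec, rawVec, h1, h2]
  norm_num

/-- Labels encode the basis of the positive part. -/
theorem basisVec_mem_posBasis {a e : ℕ} {N : ℤ} (hN : 0 ≤ N) (ha : isLab a = true) (hlt : a < 4096)
    (he : e ≠ 0 → 2 ≤ labDeg a) :
    basisVec N (a + 4096 * e) ∈ posBasis (labDeg a + 2 * (N * e)) (labHt a + 8 * (N * e)) := by
  rw [isLab_iff] at ha
  obtain ⟨h3, h20, h10, h0, h1⟩ := ha
  have hs : a % 64 < 64 := Nat.mod_lt _ (by norm_num)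
  obtain ⟨hw, hw3, hw9⟩ := sum_oddHeight_maskSet hs
  rw [labWt_mod] at hw hw3 hw9
  have hb := bitCount_le (a % 64)
  have hN' : 0 ≤ N * e := by positivity
  have hdeg := labDeg_eq a
  have hht := labHt_eq a
  by_cases hsp : a + 4096 * e = 282
  · obtain rfl : e = 0 := by omega
    obtain rfl : a = 282 := by omega
    refine Or.inr ⟨?_, ?_, basisVec_282 N⟩
    · have : labDeg 282 = 1 := rfl
      rw [this]; simp
    · have : labHt 282 = 2 := rfl
      rw [this]; simp
  · rw [basisVec_of_ne N hsp, rawVec_add N e hlt]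
    obtain ⟨hm1, hm2, hm3⟩ := exceptional_masks hs
    have hd : degree ((a / 64 % 64 : ℕ) - 4 + N * e) (maskSet (a % 64)) =
        labDeg a + 2 * (N * e) := by
      rw [degree, card_maskSet hs]; omega
    have hh : height ((a / 64 % 64 : ℕ) - 4 + N * e) (maskSet (a % 64)) =
        labHt a + 8 * (N * e) := by
      rw [height]
      have hpos : 6 ≤ 4 * labDeg a + labWt a := by
        by_cases h : labDeg a = 0
        · have := h0 h; omega
        · omega
      omega
    refine Or.inl ⟨_, _, ⟨?_, ?_, ?_⟩, hd, hh, rfl⟩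
    · rw [hd]; positivity
    · rw [hd, hh]
      intro h
      have := h0 (by omega)
      omega
    · rw [hd]
      intro h
      -- A shifted label has degree at least two even before the shift, so the excluded monomials of
      -- degree one occur only unshifted.
      obtain rfl : e = 0 := by
        by_contra h'
        have := he h'
        omega
      have h1' := h1 (by omega)
      have hc : 2 * (a / 64 % 64) + bitCount (a % 64) = 11 := by simp at h; omega
      refine ⟨fun h' => ?_, fun h' => ?_, fun h' => ?_⟩
      · have := hm1.1 h'
        rw [this] at hc
        have hbc : bitCount 28 = 3 := rfl
        omega
      · have := hm2.1 h'
        rw [this] at hc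
        have hbc : bitCount 26 = 3 := rfl
        omega
      · have := hm3.1 h'
        rw [this] at hc
        have hbc : bitCount 44 = 3 := rfl
        omega

/-- The converse of `basisVec_mem_posBasis`. When the exponent is shifted back by `N`, the degree
must remain large enough for the result to be a basis label without exceptions; this is what `4 ≤
d₀` ensures. -/
theorem exists_label {d h : ℤ} {f : Fn} (hf : f ∈ posBasis d h) {N : ℤ} {e d₀ : ℕ} (hN : 0 ≤ N)
    (hd : d = d₀ + 2 * (N * e)) (hle : d₀ ≤ 30) (he : e ≠ 0 → 4 ≤ d₀) :
    ∃ s < 64, isLab (64 * exponentOf d₀ s + s) = true ∧ labDeg (64 * exponentOf d₀ s + s) = d₀ ∧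
      64 * exponentOf d₀ s + s < 4096 ∧ (labHt (64 * exponentOf d₀ s + s) : ℤ) + 8 * (N * e) = h ∧
      f = basisVec N (64 * exponentOf d₀ s + s + 4096 * e) := by
  have hN' : 0 ≤ N * e := by positivity
  rcases hf with ⟨n, S, ⟨hp0, hp1, hp2⟩, rfl, rfl, rfl⟩ | ⟨rfl, rfl, rfl⟩
  · obtain ⟨s, hs, rfl⟩ := exists_maskSet S
    have hb := bitCount_le s
    obtain ⟨hw, hw3, hw9⟩ := sum_oddHeight_maskSet hs
    rw [degree, card_maskSet hs] at hd hp0 hp1 hp2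
    obtain ⟨c, hc⟩ : ∃ c : ℕ, (c : ℤ) = n - N * e + 4 := ⟨(n - N * e + 4).toNat, by
      rw [Int.toNat_of_nonneg]; omega⟩
    have hex : exponentOf d₀ s = c := by
      rw [exponentOf]; omega
    rw [height] at *
    refine ⟨s, hs, ?_⟩
    rw [hex]
    -- The exponent `-2` is possible only for the product of all six odd coordinates, in degree
    -- zero; its weight is zero, so it is not in the positive part.
    have hc3 : 3 ≤ c := by
      by_contra hlt
      have hc2 : c = 2 := by omega
      have h6 : bitCount s = 6 := by omega
      have he0 : e = 0 := by by_contra h'; have := he h'; omega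
      subst he0
      have := hp1 (by simp at *; omega)
      have h63 : ∀ s : Fin 64, bitCount s = 6 → labWt s = 6 := by decide
      have := h63 ⟨s, hs⟩ h6
      simp only at this
      simp at *
      omega
    have e1 : (64 * c + s) / 64 % 64 = c := by omega
    have e2 : (64 * c + s) % 64 = s := by omega
    have hdeg : labDeg (64 * c + s) = d₀ := by rw [labDeg_eq, e1, e2]; omega
    have hwt : labWt (64 * c + s) = labWt s := by rw [← labWt_mod, e2]
    obtain ⟨hm1, hm2, hm3⟩ := exceptional_masks hs
    have hone : d₀ = 1 → e = 0 := fun h1 => by by_contra h'; have := he h'; omega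
    have hzero : d₀ = 0 → e = 0 := fun h1 => by by_contra h'; have := he h'; omega
    refine ⟨?_, hdeg, by omega, ?_, ?_⟩
    · rw [isLab_iff, e1, e2, hdeg, hwt]
      refine ⟨hc3, by omega, by omega, fun h0 => ?_, fun h1 => ⟨fun h' => ?_, fun h' => ?_⟩⟩
      · have := hzero h0
        subst this
        simp at hd hc
        have := hp1 (by omega)
        omega
      · have h28 : s = 28 := by omega
        have hbc : bitCount 28 = 3 := rfl
        rw [h28] at hd hp2
        have := hone (by rw [h28] at e1; omega)
        subst this
        simp at hd hc
        exact (hp2 (by omega)).1 (by decide)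
      · have h28 : s = 44 := by omega
        have hbc : bitCount 44 = 3 := rfl
        rw [h28] at hd hp2
        have := hone (by rw [h28] at e1; omega)
        subst this
        simp at hd hc
        exact (hp2 (by omega)).2.2 (by decide)
    · rw [labHt_eq, hdeg, hwt]
      have hpos : 6 ≤ 4 * d₀ + labWt s := by
        by_cases h : d₀ = 0
        · have := hzero h
          subst this
          simp at hd hc
          have := hp1 (by omega)
          omega
        · omega
      omega
    · rw [basisVec_of_ne, rawVec_add N e (by omega), e1, e2]
      · congr 1; omega
      · intro h'
        have h28 : s = 26 := by omega
        have hbc : bitCount 26 = 3 := rfl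
        rw [h28] at hd hp2
        have := hone (by rw [h28] at e1; omega)
        subst this
        simp at hd hc
        exact (hp2 (by omega)).2.1 (by decide)
  · have he0 : e = 0 := by by_contra h'; have := he h'; omega
    subst he0
    obtain rfl : d₀ = 1 := by simp at hd; omega
    have h1 : 64 * exponentOf 1 26 + 26 = 282 := rfl
    have h2 : labHt 282 = 2 := rfl
    refine ⟨26, by norm_num, ?_⟩
    rw [h1, h2]
    refine ⟨by decide, by decide, by decide, by simp, ?_⟩
    exact (basisVec_282 N).symm

theorem validKey_of_isLab {a : ℕ} (h : isLab a = true) (e : ℕ) : ValidKey (a + 4096 * e) := by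
  rw [isLab_iff] at h
  have h2 : (a + 4096 * e) / 64 % 64 = a / 64 % 64 := by omega
  exact ⟨by omega, by omega⟩

/-- The finite content of closure under brackets: total degrees zero and one. In particular the
subspace of codimension two in degree one is stable under the nilpotent part of degree zero. -/
theorem gradedPair_lowKeys :
    lowKeys.all (fun a => lowKeys.all fun b => gradedPair a b) = true := by decide +kernel

theorem mem_lowKeys {a : ℕ} (ha : isLab a = true) (hd : labDeg a ≤ 1) (hlt : a < 4096) :
    a ∈ lowKeys := by
  have ha' := (isLab_iff a).1 ha
  have := labDeg_eq a
  rw [lowKeys, List.mem_filter]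
  refine ⟨?_, ?_⟩
  · rw [List.mem_range]; omega
  · rw [ha, Bool.true_and, Nat.ble_eq]; exact hd

theorem mem_posPart_of_isLab {a : ℕ} (ha : isLab a = true) (hlt : a < 4096) (N : ℤ) :
    basisVec N a ∈ posPart (labHt a) := by
  have := posBasis_subset _ _ (basisVec_mem_posBasis (e := 0) le_rfl ha hlt (by simp))
  have h0 : basisVec N a = basisVec 0 a := by
    have h1 : a / 4096 = 0 := by omega
    rw [basisVec, basisVec]
    split_ifs
    · simp [rawVec]
    · simp [rawVec, h1]
  simpa [h0] using this

/-- In total degree at least two any bracket is allowed and homogeneity suffices; below that both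
arguments are among the finitely many low labels. -/
theorem contactBracket_mem_posPart {h h' : ℤ} {x y : Fn} (hx : x ∈ posPart h)
    (hy : y ∈ posPart h') : contactBracket x y ∈ posPart (h + h') := by
  refine bracket_mem_of_span contactBracket ?_ hx hy
  intro x hx y hy
  obtain ⟨d, hx⟩ := Set.mem_iUnion.1 hx
  obtain ⟨d', hy⟩ := Set.mem_iUnion.1 hy
  by_cases hd : 2 ≤ d + d'
  · exact piece_le_posPart hd _
      (contactBracket_mem_piece (posBasis_subset_piece _ _ hx) (posBasis_subset_piece _ _ hy))
  have nonneg : ∀ {d h f}, f ∈ posBasis d h → 0 ≤ d := by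
    rintro d h f (⟨n, S, hp, rfl, -⟩ | ⟨rfl, -⟩)
    · exact hp.1
    · norm_num
  have hd0 := nonneg hx
  have hd0' := nonneg hy
  obtain ⟨s, -, ha, had, hlt, hah, rfl⟩ := exists_label hx (N := 0) (e := 0) (d₀ := d.toNat)
    le_rfl (by simp [hd0]) (by omega) (by simp)
  obtain ⟨t, -, hb, hbd, hlt', hbh, rfl⟩ := exists_label hy (N := 0) (e := 0) (d₀ := d'.toNat)
    le_rfl (by simp [hd0']) (by omega) (by simp)
  generalize 64 * exponentOf d.toNat s + s = a at *
  generalize 64 * exponentOf d'.toNat t + t = b at *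
  have key := gradedPair_lowKeys
  rw [List.all_eq_true] at key
  have key := key a (mem_lowKeys ha (by omega) hlt)
  rw [List.all_eq_true] at key
  have key := key b (mem_lowKeys hb (by omega) hlt')
  rw [gradedPair, Nat.ble_eq_true_of_le (show labDeg a + labDeg b ≤ 1 by omega), cond_true,
    List.all_eq_true] at key
  have hv := validKey_of_isLab ha 0
  have hv' := validKey_of_isLab hb 0
  simp only [mul_zero, add_zero] at hv hv' hah hbh ⊢
  rw [← eval_labBracket 0 hv hv', ← Comb.eval_normalize]
  refine Comb.eval_mem _ _ _ fun x hx => ?_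
  have := key x hx
  simp only [Bool.and_eq_true, Nat.beq_eq, Nat.ble_eq] at this
  have hm := mem_posPart_of_isLab this.1 (by omega) 0
  rw [this.2.2] at hm
  rw [← hah, ← hbh]
  simpa using hm

/-! ### The defect of a linear map -/

section Defect

variable {M : Type u} [AddCommGroup M] [Module ℂ M] [LieSuperalgebra M]

/-- The failure of a linear map to preserve brackets. -/
def defect (φ : Fn →ₗ[ℂ] M) : Fn →ₗ[ℂ] Fn →ₗ[ℂ] M :=
  (LieSuperalgebra.bracket (V := M)).compl₁₂ φ φ - contactBracket.compr₂ φ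

theorem defect_apply (φ : Fn →ₗ[ℂ] M) (x y : Fn) :
    defect φ x y = ⁅φ x, φ y⁆ₛ - φ (contactBracket x y) := rfl

theorem map_contactBracket {φ : Fn →ₗ[ℂ] M} {x y : Fn} (h : defect φ x y = 0) :
    φ (contactBracket x y) = ⁅φ x, φ y⁆ₛ := (sub_eq_zero.1 h).symm

/-- The elements of parity `i` whose images have parity `i`. -/
def homPart (φ : Fn →ₗ[ℂ] M) (i : ZMod 2) : Submodule ℂ Fn :=
  fnPart i ⊓ (LieSuperalgebra.part (V := M) i).comap φ

theorem defect_skew {φ : Fn →ₗ[ℂ] M} {i j : ZMod 2} {x y : Fn} (hx : x ∈ homPart φ i)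
    (hy : y ∈ homPart φ j) : defect φ x y = -(koszul i j • defect φ y x) := by
  rw [defect_apply, defect_apply, LieSuperalgebra.bracket_skew hx.2 hy.2,
    contactBracket_skew hx.1 hy.1, map_neg, map_smul, smul_sub]
  abel

/-- Subtract the Jacobi identity of functions, mapped by `φ`, from the one of the images. The three
vanishing assumptions allow `φ` to be moved through the inner brackets, so only outer defects
remain. -/
theorem defect_jacobi {φ : Fn →ₗ[ℂ] M} {i j k : ZMod 2} {x y z : Fn} (hx : x ∈ homPart φ i)
    (hy : y ∈ homPart φ j) (hz : z ∈ homPart φ k) (hxy : defect φ x y = 0)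
    (hyz : defect φ y z = 0) (hxz : defect φ x z = 0) :
    defect φ x (contactBracket y z) = defect φ (contactBracket x y) z +
      koszul i j • defect φ y (contactBracket x z) := by
  rw [defect_apply, defect_apply, defect_apply, map_contactBracket hxy, map_contactBracket hyz,
    map_contactBracket hxz, LieSuperalgebra.jacobi hx.2 hy.2 hz.2,
    contactBracket_jacobi hx.1 hy.1 hz.1, map_add, map_smul, smul_sub]
  abel

/-- A linear map that preserves the parity of monomials. -/
def IsEven (φ : Fn →ₗ[ℂ] M) : Prop :=
  ∀ n S, φ (mono n S) ∈ LieSuperalgebra.part (V := M) (S.card : ZMod 2)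

theorem IsEven.mono_mem {φ : Fn →ₗ[ℂ] M} (hφ : IsEven φ) (n : ℤ) (S : Finset (Fin 6)) :
    mono n S ∈ homPart φ (S.card : ZMod 2) := ⟨mono_mem_fnPart n S, hφ n S⟩

theorem IsEven.basisVec_mem {φ : Fn →ₗ[ℂ] M} (hφ : IsEven φ) (N : ℤ) (k : ℕ) :
    basisVec N k ∈ homPart φ (bitCount (k % 64) : ZMod 2) := by
  have h : ∀ k, rawVec N k ∈ homPart φ (bitCount (k % 64) : ZMod 2) := fun k => by
    rw [← card_maskSet (Nat.mod_lt _ (by norm_num)), rawVec]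
    exact hφ.mono_mem _ _
  rw [basisVec]
  split_ifs with h1
  · subst h1
    exact add_mem (h 282) (h 300)
  · exact h k

theorem koszul_natCast (a b : ℕ) :
    koszul (a : ZMod 2) (b : ZMod 2) = if a % 2 = 1 ∧ b % 2 = 1 then -1 else 1 := by
  have : ∀ a : ℕ, (a : ZMod 2) = 1 ↔ a % 2 = 1 := fun a => by
    rw [← Nat.odd_iff, ← ZMod.natCast_eq_one_iff_odd]
  simp only [koszul, this]

theorem isOdd_iff (a : ℕ) : isOdd a = true ↔ bitCount (a % 64) % 2 = 1 := Nat.beq_eq ▸ Iff.rfl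

theorem cast_pairSign (a b : ℕ) : ((pairSign a b : ℤ) : ℂ) =
    koszul (bitCount (a % 64) : ZMod 2) (bitCount (b % 64) : ZMod 2) := by
  simp only [koszul_natCast, ← isOdd_iff, pairSign]
  cases isOdd a <;> cases isOdd b <;> simp

theorem defect_basisVec_skew {φ : Fn →ₗ[ℂ] M} (hφ : IsEven φ) (N : ℤ) (a b : ℕ) :
    defect φ (basisVec N a) (basisVec N b) =
      -(((pairSign a b : ℤ) : ℂ) • defect φ (basisVec N b) (basisVec N a)) := by
  rw [cast_pairSign]
  exact defect_skew (hφ.basisVec_mem N a) (hφ.basisVec_mem N b)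

/-- The defect of an encoded pair. -/
def pairDefect (φ : Fn →ₗ[ℂ] M) (N : ℤ) (q : ℕ) : M :=
  defect φ (basisVec N (q / 8192)) (basisVec N (q % 8192))

theorem memNat_iff (a : ℕ) (l : List ℕ) : memNat a l = true ↔ a ∈ l := by
  induction l with
  | nil => simp [memNat]
  | cons b l ih =>
    rw [memNat, List.mem_cons, ← ih]
    cases h : Nat.beq a b with
    | true => simp [Nat.eq_of_beq_eq_true h]
    | false => simp [Nat.ne_of_beq_eq_false h]

/-- For an even vector, antisymmetry says that the defect with itself equals its own negative. For
an odd vector it says nothing, and such pairs must be derived. -/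
theorem pairDefect_of_trivialPair {φ : Fn →ₗ[ℂ] M} (hφ : IsEven φ) (N : ℤ) {q : ℕ}
    (h : trivialPair q = true) : pairDefect φ N q = 0 := by
  have h' : Nat.beq (q / 8192) (q % 8192) = true ∧ (!isOdd (q % 8192)) = true :=
    (Bool.and_eq_true _ _).mp h
  have h2 : isOdd (q % 8192) = false := by simpa using h'.2
  rw [pairDefect, Nat.eq_of_beq_eq_true h'.1]
  have := defect_basisVec_skew hφ N (q % 8192) (q % 8192)
  rw [pairSign, h2] at this
  simp only [Bool.and_false, cond_false, Int.cast_one, one_smul] at this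
  have h2 : (2 : ℂ) • defect φ (basisVec N (q % 8192)) (basisVec N (q % 8192)) = 0 := by
    rw [two_smul]
    nth_rewrite 1 [this]
    exact neg_add_cancel _
  exact (smul_eq_zero.1 h2).resolve_left two_ne_zero

variable {φ : Fn →ₗ[ℂ] M} {N : ℤ} {known : List ℕ}

/-- Dropping a pair whose defect is known to vanish does not change the value, although it changes
the formal combination. -/
theorem eval_pushPair (hφ : IsEven φ) (hK : ∀ q ∈ known, pairDefect φ N q = 0) (p : List ℤ)
    (q : ℕ) (l : Comb) : Comb.eval (pairDefect φ N) N (pushPair known p q l) =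
      (polyEval N p : ℂ) • pairDefect φ N q + Comb.eval (pairDefect φ N) N l := by
  rw [pushPair]
  cases h : memNat q known with
  | true => rw [cond_true, hK q ((memNat_iff _ _).1 h), smul_zero, zero_add]
  | false =>
  cases h' : trivialPair q with
  | true => rw [cond_false, cond_true, pairDefect_of_trivialPair hφ N h', smul_zero, zero_add]
  | false => rw [cond_false, cond_false, Comb.eval_insert]

theorem pairDefect_code (φ : Fn →ₗ[ℂ] M) (N : ℤ) (a : ℕ) {b : ℕ} (hb : b < 8192) :
    pairDefect φ N (Nat.add (Nat.mul 8192 a) b) = defect φ (basisVec N a) (basisVec N b) := by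
  have h1 : Nat.add (Nat.mul 8192 a) b / 8192 = a := by
    show (8192 * a + b) / 8192 = a
    omega
  have h2 : Nat.add (Nat.mul 8192 a) b % 8192 = b := by
    show (8192 * a + b) % 8192 = b
    omega
  rw [pairDefect, h1, h2]

/-- Each unordered pair must have only one code for like terms to be collected; antisymmetry pays
for the exchange. The bounds make the code decodable. -/
theorem eval_addPair (hφ : IsEven φ) (hK : ∀ q ∈ known, pairDefect φ N q = 0) (p : List ℤ)
    {a b : ℕ} (ha : a < 8192) (hb : b < 8192) (l : Comb) :
    Comb.eval (pairDefect φ N) N (addPair known p a b l) =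
      (polyEval N p : ℂ) • defect φ (basisVec N a) (basisVec N b) +
        Comb.eval (pairDefect φ N) N l := by
  rw [addPair]
  cases h : Nat.ble a b with
  | true => rw [cond_true, force_eq, eval_pushPair hφ hK, pairDefect_code φ N a hb]
  | false =>
    rw [cond_false, force_eq, eval_pushPair hφ hK, pairDefect_code φ N b ha,
      defect_basisVec_skew hφ N a b, polyEval_scale]
    push_cast
    module

theorem eval_addLeft (hφ : IsEven φ) (hK : ∀ q ∈ known, pairDefect φ N q = 0) (m : List ℤ)
    {a : ℕ} (ha : a < 8192) (l : Comb) {c : Comb} (hc : ∀ x ∈ c, x.2 < 8192) :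
    Comb.eval (pairDefect φ N) N (addLeft known m a l c) =
      (polyEval N m : ℂ) • defect φ (basisVec N a) (Comb.eval (basisVec N) N c) +
        Comb.eval (pairDefect φ N) N l := by
  induction c with
  | nil => rw [addLeft, Comb.eval_nil, map_zero, smul_zero, zero_add]
  | cons x c ih =>
    rw [addLeft, eval_addPair hφ hK _ ha (hc x (by simp)), ih fun y hy => hc y (by simp [hy]),
      Comb.eval_cons, map_add, map_smul, polyEval_mul, smul_add, smul_smul, Int.cast_mul, add_assoc]

theorem eval_addRight (hφ : IsEven φ) (hK : ∀ q ∈ known, pairDefect φ N q = 0) (m : List ℤ)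
    {b : ℕ} (hb : b < 8192) (l : Comb) {c : Comb} (hc : ∀ x ∈ c, x.2 < 8192) :
    Comb.eval (pairDefect φ N) N (addRight known m b l c) =
      (polyEval N m : ℂ) • defect φ (Comb.eval (basisVec N) N c) (basisVec N b) +
        Comb.eval (pairDefect φ N) N l := by
  induction c with
  | nil => rw [addRight, Comb.eval_nil, map_zero, LinearMap.zero_apply, smul_zero, zero_add]
  | cons x c ih =>
    rw [addRight, eval_addPair hφ hK _ (hc x (by simp)) hb, ih fun y hy => hc y (by simp [hy]),
      Comb.eval_cons, map_add, map_smul, LinearMap.add_apply, LinearMap.smul_apply, polyEval_mul,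
      smul_add, smul_smul, Int.cast_mul, add_assoc]

end Defect

/-! ### Bounds for the labels that occur in brackets -/

section Bound

variable {B : ℕ}

theorem pushMono_lt {p : List ℤ} {k : ℕ} {l : Comb} (hB : 300 < B) (hk : k < B)
    (hl : ∀ x ∈ l, x.2 < B) : ∀ x ∈ pushMono p k l, x.2 < B := by
  rw [pushMono]
  cases Nat.beq k 282 with
  | true =>
    intro x hx
    simp only [cond_true, List.mem_cons] at hx
    rcases hx with rfl | rfl | hx
    · show 282 < B
      omega
    · exact hB
    · exact hl x hx
  | false =>
    intro x hx
    simp only [cond_false, List.mem_cons] at hx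
    rcases hx with rfl | hx
    · exact hk
    · exact hl x hx

theorem key_lt {h e S : ℕ} (hS : S < 64) (he : h < 64 * (e + 1)) :
    Nat.add (Nat.mul 64 h) S < 4096 * (e + 1) := by
  show 64 * h + S < 4096 * (e + 1)
  omega

/-- The multiples of `N` add without carry. With at most one shifted argument, labels therefore stay
below `8192` and fit into pair codes. -/
theorem monoBracket_lt {a b e : ℕ} {l : Comb} (ha : ValidKey a) (hb : ValidKey b)
    (he : a / 4096 + b / 4096 = e) (hl : ∀ x ∈ l, x.2 < 4096 * (e + 1)) :
    ∀ x ∈ monoBracket a b l, x.2 < 4096 * (e + 1) := by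
  obtain ⟨ha1, ha2⟩ := ha
  obtain ⟨hb1, hb2⟩ := hb
  have hS : a % 64 < 64 := Nat.mod_lt _ (by norm_num)
  have hT : b % 64 < 64 := Nat.mod_lt _ (by norm_num)
  have hB : 300 < 4096 * (e + 1) := by omega
  have hor : ∀ {S T}, S < 64 → T < 64 → Nat.lor S T < 64 := fun h h' =>
    Nat.or_lt_two_pow (n := 6) h h'
  have hp : ∀ p q l, (∀ x ∈ l, x.2 < 4096 * (e + 1)) →
      ∀ x ∈ poissonTerm p q (a % 64) (b % 64) (a / 64 + b / 64) l, x.2 < 4096 * (e + 1) := by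
    intro p q l hl
    rw [poissonTerm]
    cases Nat.beq (Nat.land (a % 64) p) 0
    swap
    · exact hl
    cases Nat.beq (Nat.land (b % 64) q) 0
    swap
    · exact hl
    cases Nat.beq (Nat.land (Nat.sub (a % 64) p) (Nat.sub (b % 64) q)) 0
    · exact hl
    refine pushMono_lt hB (key_lt (hor ?_ ?_) ?_) hl
    · exact lt_of_le_of_lt (Nat.sub_le _ _) hS
    · exact lt_of_le_of_lt (Nat.sub_le _ _) hT
    · show a / 64 + b / 64 - 4 < _
      omega
  rw [monoBracket, force_eq, force_eq, force_eq, force_eq, force_eq, unionTerm]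
  have hps : ∀ x ∈ poissonTerms (a % 64) (b % 64) (a / 64 + b / 64) l, x.2 < 4096 * (e + 1) :=
    hp _ _ _ (hp _ _ _ (hp _ _ _ (hp _ _ _ (hp _ _ _ (hp _ _ _ hl)))))
  cases Nat.beq (Nat.land (Nat.mod a 64) (Nat.mod b 64)) 0
  · exact hps
  · refine pushMono_lt hB (key_lt (hor hS hT) ?_) hps
    show a / 64 + b / 64 - 5 < _
    omega

theorem labBracketAux_lt {a b e : ℕ} {l : Comb} (ha : ValidKey a) (hb : ValidKey b)
    (he : a / 4096 + b / 4096 = e) (hl : ∀ x ∈ l, x.2 < 4096 * (e + 1)) :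
    ∀ x ∈ labBracketAux a b l, x.2 < 4096 * (e + 1) := by
  rw [labBracketAux]
  cases h : Nat.beq b 282
  · exact monoBracket_lt ha hb he hl
  · obtain rfl := Nat.eq_of_beq_eq_true h
    exact monoBracket_lt ha hb he (monoBracket_lt ha (by norm_num [ValidKey]) he hl)

theorem labBracket_lt {a b e : ℕ} (ha : ValidKey a) (hb : ValidKey b)
    (he : a / 4096 + b / 4096 = e) : ∀ x ∈ labBracket a b, x.2 < 4096 * (e + 1) := by
  rw [labBracket]
  cases h : Nat.beq a 282
  · exact labBracketAux_lt ha hb he (by simp)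
  · obtain rfl := Nat.eq_of_beq_eq_true h
    exact labBracketAux_lt ha hb he
      (labBracketAux_lt (by norm_num [ValidKey]) hb he (by simp))

end Bound

/-! ### Soundness of the derivations of vanishing defects -/

section Soundness

variable {M : Type u} [AddCommGroup M] [Module ℂ M] [LieSuperalgebra M]
variable {φ : Fn →ₗ[ℂ] M} {N : ℤ} {known : List ℕ}

/-- The terms that are added are the three sides of `defect_jacobi`, with total value zero: a Jacobi
identity is a linear equation among defects. -/
theorem eval_addJacobi (hφ : IsEven φ) (hK : ∀ q ∈ known, pairDefect φ N q = 0) (m : List ℤ)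
    {a b c : ℕ} (ha : ValidKey a) (hb : ValidKey b) (hc : ValidKey c) (ha' : a < 4096)
    (hb' : b < 4096) (hc' : c < 8192) (hab : defect φ (basisVec N a) (basisVec N b) = 0)
    (hbc : defect φ (basisVec N b) (basisVec N c) = 0)
    (hac : defect φ (basisVec N a) (basisVec N c) = 0) (l : Comb) :
    Comb.eval (pairDefect φ N) N (addJacobi known m a b c l) =
      Comb.eval (pairDefect φ N) N l := by
  have hle : 4096 * (c / 4096 + 1) ≤ 8192 := by omega
  have h0 : a / 4096 = 0 := by omega
  have h0' : b / 4096 = 0 := by omega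
  have e1 : ∀ x ∈ labBracket b c, x.2 < 8192 := fun x hx =>
    lt_of_lt_of_le (labBracket_lt hb hc (by omega) x hx) hle
  have e2 : ∀ x ∈ labBracket a b, x.2 < 8192 := fun x hx =>
    lt_of_lt_of_le (labBracket_lt ha hb (e := 0) (by omega) x hx) (by norm_num)
  have e3 : ∀ x ∈ labBracket a c, x.2 < 8192 := fun x hx =>
    lt_of_lt_of_le (labBracket_lt ha hc (by omega) x hx) hle
  rw [addJacobi, eval_addLeft hφ hK _ (by omega) _ e1, eval_addRight hφ hK _ hc' _ e2,
    eval_addLeft hφ hK _ (by omega) _ e3, eval_labBracket N hb hc, eval_labBracket N ha hb,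
    eval_labBracket N ha hc, defect_jacobi (hφ.basisVec_mem N a) (hφ.basisVec_mem N b)
      (hφ.basisVec_mem N c) hab hbc hac, polyEval_scale, polyEval_scale, ← cast_pairSign]
  push_cast
  module

/-- The value of a bracket expression. -/
def Tree.eval {V : Type v} [AddCommGroup V] [Module ℂ V] (β : V →ₗ[ℂ] V →ₗ[ℂ] V) (g : ℕ → V) :
    Tree → V
  | .gen i => g i
  | .br s t => β (s.eval β g) (t.eval β g)

/-- The value of a linear combination of bracket expressions. -/
def evalTrees {V : Type v} [AddCommGroup V] [Module ℂ V] (β : V →ₗ[ℂ] V →ₗ[ℂ] V) (g : ℕ → V) :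
    List (ℤ × Tree) → V
  | [] => 0
  | x :: r => (x.1 : ℂ) • x.2.eval β g + evalTrees β g r

theorem eval_combBracket (N : ℤ) {l m : Comb} (hl : ∀ x ∈ l, ValidKey x.2)
    (hm : ∀ x ∈ m, ValidKey x.2) : Comb.eval (basisVec N) N (combBracket l m) =
      contactBracket (Comb.eval (basisVec N) N l) (Comb.eval (basisVec N) N m) := by
  have happ : ∀ l l' : Comb, Comb.eval (basisVec N) N (l ++ l') =
      Comb.eval (basisVec N) N l + Comb.eval (basisVec N) N l' := by
    intro l l'
    induction l with
    | nil => rw [List.nil_append, Comb.eval_nil, zero_add]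
    | cons x l ih => rw [List.cons_append, Comb.eval_cons, Comb.eval_cons, ih, add_assoc]
  have hmap : ∀ (p : List ℤ) (l : Comb),
      Comb.eval (basisVec N) N (l.map fun z => (polyMul p z.1, z.2)) =
        (polyEval N p : ℂ) • Comb.eval (basisVec N) N l := by
    intro p l
    induction l with
    | nil => rw [List.map_nil, Comb.eval_nil, smul_zero]
    | cons x l ih =>
      rw [List.map_cons, Comb.eval_cons, Comb.eval_cons, ih, polyEval_mul, smul_add, smul_smul,
        Int.cast_mul]
  rw [combBracket]
  induction l with
  | nil => rw [List.flatMap_nil, Comb.eval_nil, map_zero, LinearMap.zero_apply]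
  | cons x l ih =>
    rw [List.flatMap_cons, happ, ih fun y hy => hl y (by simp [hy]), Comb.eval_cons, map_add,
      map_smul, LinearMap.add_apply, LinearMap.smul_apply]
    congr 1
    clear ih
    induction m with
    | nil => rw [List.flatMap_nil, Comb.eval_nil, map_zero, smul_zero]
    | cons y m ih =>
      rw [List.flatMap_cons, happ, ih fun z hz => hm z (by simp [hz]), hmap, polyEval_mul,
        eval_labBracket N (hl x (by simp)) (hm y (by simp)), Comb.eval_cons, map_add, map_smul,
        smul_add, smul_smul, Int.cast_mul]

theorem validKey_of_range {k : ℕ} (h : Nat.ble 192 k && Nat.blt k 576) : ValidKey k ∧ k < 576 := by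
  simp only [Bool.and_eq_true, Nat.ble_eq, Nat.blt_eq] at h
  exact ⟨⟨by omega, by omega⟩, h.2⟩

theorem isLab_of_mem_genKeys {g : ℕ} (h : g ∈ genKeys) : isLab g = true ∧ g < 576 := by
  have : ∀ g ∈ genKeys, isLab g = true ∧ g < 576 := by decide +kernel
  exact this g h

theorem validTree_br {s t : Tree} (h : validTree (s ⋆ t) = true) :
    (∀ x ∈ s.comb, ValidKey x.2 ∧ x.2 < 576) ∧ (∀ x ∈ t.comb, ValidKey x.2 ∧ x.2 < 576) ∧
      validTree s = true ∧ validTree t = true := by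
  simp only [validTree, Bool.and_eq_true, List.all_eq_true] at h
  obtain ⟨⟨⟨h1, h2⟩, h3⟩, h4⟩ := h
  exact ⟨fun x hx => validKey_of_range (by simpa using h1 x hx),
    fun x hx => validKey_of_range (by simpa using h2 x hx), h3, h4⟩

theorem Tree.eval_comb (N : ℤ) {t : Tree} (h : validTree t = true) :
    Comb.eval (basisVec N) N t.comb = t.eval contactBracket (basisVec N) := by
  induction t with
  | gen i => simp [Tree.comb, Tree.eval, Comb.eval, polyEval]
  | br s t hs ht =>
    obtain ⟨h1, h2, h3, h4⟩ := validTree_br h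
    rw [Tree.comb, Tree.eval, eval_combBracket N (fun x hx => (h1 x hx).1) fun x hx => (h2 x hx).1,
      hs h3, ht h4]

theorem Tree.eval_mem_posPart (N : ℤ) {t : Tree} (h : validTree t = true) :
    t.eval contactBracket (basisVec N) ∈ posPart t.height := by
  induction t with
  | gen i =>
    have := isLab_of_mem_genKeys ((memNat_iff _ _).1 h)
    exact mem_posPart_of_isLab this.1 (by omega) N
  | br s t hs ht =>
    obtain ⟨-, -, h3, h4⟩ := validTree_br h
    have := contactBracket_mem_posPart (hs h3) (ht h4)
    rwa [← Nat.cast_add] at this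

/-- The defect vanishes on elements of total height less than `H`. -/
def VanishesBelow (φ : Fn →ₗ[ℂ] M) (H : ℤ) : Prop :=
  ∀ h h', h + h' < H → ∀ x ∈ posPart h, ∀ y ∈ posPart h', defect φ x y = 0

theorem Tree.height_pos {t : Tree} (h : validTree t = true) : 0 < t.height := by
  induction t with
  | gen i =>
    have : ∀ g ∈ genKeys, 0 < labHt g := by decide +kernel
    exact this i ((memNat_iff _ _).1 h)
  | br s t hs ht =>
    obtain ⟨-, -, h3, h4⟩ := validTree_br h
    have := hs h3
    show 0 < s.height + t.height
    omega

/-- Every bracket inside the expression has total height at most that of the whole, hence below `H`,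
and so is preserved by the map. -/
theorem Tree.map_eval {H : ℤ} (hv : VanishesBelow φ H) {t : Tree} (h : validTree t = true)
    (ht : t.height < H) : φ (t.eval contactBracket (basisVec N)) =
      t.eval LieSuperalgebra.bracket fun k => φ (basisVec N k) := by
  induction t with
  | gen i => rfl
  | br s t ihs iht =>
    obtain ⟨-, -, h3, h4⟩ := validTree_br h
    have hs := Tree.height_pos h3
    have ht' := Tree.height_pos h4
    have hst : (s ⋆ t).height = s.height + t.height := rfl
    rw [hst] at ht
    push_cast at ht
    rw [Tree.eval, Tree.eval, map_contactBracket (hv s.height t.height ht _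
      (Tree.eval_mem_posPart N h3) _ (Tree.eval_mem_posPart N h4)), ihs h3 (by omega),
      iht h4 (by omega)]

/-- Height `H` is allowed here: the two outermost factors have positive height, so each is below `H`
and is evaluated compatibly. What remains is exactly the defect of the outermost bracket. -/
theorem eval_addTree (hφ : IsEven φ) (hK : ∀ q ∈ known, pairDefect φ N q = 0) {H : ℤ}
    (hv : VanishesBelow φ H) (m : List ℤ) {t : Tree} (h : validTree t = true) (ht : t.height ≤ H)
    (l : Comb) : Comb.eval (pairDefect φ N) N (addTree known m t l) =
      (polyEval N m : ℂ) • (t.eval LieSuperalgebra.bracket (fun k => φ (basisVec N k)) -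
        φ (t.eval contactBracket (basisVec N))) + Comb.eval (pairDefect φ N) N l := by
  cases t with
  | gen i => rw [addTree, Tree.eval, Tree.eval, sub_self, smul_zero, zero_add]
  | br s t =>
    obtain ⟨h1, h2, h3, h4⟩ := validTree_br h
    have hs := Tree.height_pos h3
    have ht' := Tree.height_pos h4
    have hst : (s ⋆ t).height = s.height + t.height := rfl
    rw [hst] at ht
    push_cast at ht
    rw [Tree.eval, Tree.eval, ← Tree.map_eval hv h3 (by omega), ← Tree.map_eval hv h4 (by omega),
      ← defect_apply, addTree, ← Tree.eval_comb N h3, ← Tree.eval_comb N h4]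
    generalize s.comb = c at h1
    induction c with
    | nil => rw [List.foldr_nil, Comb.eval_nil, map_zero, LinearMap.zero_apply, smul_zero, zero_add]
    | cons x c ih =>
      rw [List.foldr_cons, eval_addLeft hφ hK _ (by have := (h1 x (by simp)).2; omega) _
        (fun y hy => by have := (h2 y hy).2; omega), ih fun y hy => h1 y (by simp [hy]),
        Comb.eval_cons, map_add, map_smul, LinearMap.add_apply, LinearMap.smul_apply, polyEval_mul,
        smul_add, smul_smul, Int.cast_mul, add_assoc]

theorem eval_addTrees (hφ : IsEven φ) (hK : ∀ q ∈ known, pairDefect φ N q = 0) {H : ℤ}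
    (hv : VanishesBelow φ H) (m : List ℤ) {r : List (ℤ × Tree)}
    (h : ∀ x ∈ r, validTree x.2 = true) (ht : ∀ x ∈ r, (x.2.height : ℤ) ≤ H) (l : Comb) :
    Comb.eval (pairDefect φ N) N (addTrees known m l r) =
      (polyEval N m : ℂ) • (evalTrees LieSuperalgebra.bracket (fun k => φ (basisVec N k)) r -
        φ (evalTrees contactBracket (basisVec N) r)) + Comb.eval (pairDefect φ N) N l := by
  induction r with
  | nil => simp [addTrees, evalTrees]
  | cons x r ih =>
    rw [addTrees, eval_addTree hφ hK hv _ (h x (by simp)) (ht x (by simp)),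
      ih (fun y hy => h y (by simp [hy])) (fun y hy => ht y (by simp [hy])), evalTrees, evalTrees,
      map_add, map_smul, polyEval_scale]
    push_cast
    module

theorem eval_insertTrees (N : ℤ) {r : List (ℤ × Tree)} (h : ∀ x ∈ r, validTree x.2 = true) :
    Comb.eval (basisVec N) N (insertTrees r) = evalTrees contactBracket (basisVec N) r := by
  induction r with
  | nil => rfl
  | cons x r ih =>
    rw [insertTrees, Comb.eval_insertAll, ih fun y hy => h y (by simp [hy]), evalTrees,
      Tree.eval_comb N (h x (by simp))]
    simp [polyEval]

theorem validTree_relTrees : relTrees.all (fun r => r.all fun x => validTree x.2) = true := by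
  decide +kernel

/-- This is the verification that the relations hold for the contact brackets of the generators. It
is used both for the relations in the algebra itself and for turning relations into equations among
defects. -/
theorem insertTrees_relTrees :
    relTrees.all (fun r => (nonzeroTerms (insertTrees r)).isEmpty) = true := by
  decide +kernel

theorem validTree_of_mem {r : List (ℤ × Tree)} (hr : r ∈ relTrees) :
    ∀ x ∈ r, validTree x.2 = true :=
  List.all_eq_true.1 (List.all_eq_true.1 validTree_relTrees r hr)

theorem evalTrees_of_mem (N : ℤ) {r : List (ℤ × Tree)} (hr : r ∈ relTrees) :
    evalTrees contactBracket (basisVec N) r = 0 := by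
  rw [← eval_insertTrees N (validTree_of_mem hr)]
  exact Comb.eval_eq_zero _ _ (List.all_eq_true.1 insertTrees_relTrees r hr)

theorem lowTrees_iff (h : ℕ) (r : List (ℤ × Tree)) :
    lowTrees h r = true ↔ ∀ x ∈ r, x.2.height + 6 ≤ h := by
  induction r with
  | nil => simp [lowTrees]
  | cons x r ih =>
    rw [lowTrees, Bool.and_eq_true, ih, Nat.ble_eq, List.forall_mem_cons]

/-- A positive constant term and nonnegative higher coefficients give a positive value at each `N ≥
0`; up to a global sign this is the criterion that the certificate relies on. -/
theorem nonvanishing_ne_zero (hN : 0 ≤ N) {p : List ℤ} (h : nonvanishing p = true) :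
    polyEval N p ≠ 0 := by
  have h1 : ∀ p, nonnegPoly p = true → 0 ≤ polyEval N p := by
    intro p hp
    induction p with
    | nil => exact le_rfl
    | cons a p ih =>
      simp only [nonnegPoly, Bool.and_eq_true, decide_eq_true_eq] at hp
      rw [polyEval]
      have := ih hp.2
      have := hp.1
      positivity
  have h2 : ∀ p, posPoly p = true → 0 < polyEval N p := by
    intro p hp
    cases p with
    | nil => cases hp
    | cons a p =>
      simp only [posPoly, Bool.and_eq_true, decide_eq_true_eq] at hp
      rw [polyEval]
      have := h1 p hp.2
      have := hp.1
      positivity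
  rw [nonvanishing, Bool.or_eq_true] at h
  rcases h with h | h
  · exact (h2 p h).ne'
  · have := h2 _ h
    rw [polyEval_scale] at this
    intro h0
    simp [h0] at this

/-- One surviving term with an invertible coefficient: this is how a linear equation among defects
is solved. -/
theorem eq_zero_of_determines (hN : 0 ≤ N) {V : Type v} [AddCommGroup V] [Module ℂ V] {f : ℕ → V}
    {t : ℕ} {l : Comb} (h : determines t l = true) (hl : Comb.eval f N l = 0) : f t = 0 := by
  rw [← Comb.eval_nonzeroTerms] at hl
  rw [determines] at h
  split at h
  · rename_i x hx
    rw [hx, Comb.eval_cons, Comb.eval_nil, add_zero] at hl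
    rw [Bool.and_eq_true] at h
    rw [← Nat.eq_of_beq_eq_true h.1]
    exact (smul_eq_zero.1 hl).resolve_left (Int.cast_ne_zero.2 (nonvanishing_ne_zero hN h.2))
  · cases h

/-- The relations hold for the images of the generators. -/
def MapsRelations (φ : Fn →ₗ[ℂ] M) : Prop :=
  ∀ N, ∀ r ∈ relTrees, evalTrees LieSuperalgebra.bracket (fun k => φ (basisVec N k)) r = 0

theorem posPart_basisVec_tail {c tail : ℕ} (hN : 0 ≤ N) (hc : isLab c = true) (hlt : c < 4096)
    (ht : 2 * tail ≤ labDeg c) :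
    basisVec N (c + 4096 * tail) ∈ posPart (labHt c + 8 * (N * tail)) :=
  posBasis_subset _ _ (basisVec_mem_posBasis hN hc hlt (by omega))

/-- On labels the truncated subtraction in `labHt` is exact, so heights can be added in integers. -/
theorem labHt_add_six {a : ℕ} (h : isLab a = true) :
    labHt a + 6 = 4 * labDeg a + labWt a ∧ 0 < labHt a := by
  have h' := (isLab_iff a).1 h
  obtain ⟨-, h3, h9⟩ := sum_oddHeight_maskSet (Nat.mod_lt a (show 0 < 64 by norm_num))
  rw [labWt_mod] at h3 h9
  have := labHt_eq a
  by_cases h0 : labDeg a = 0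
  · have := h'.2.2.2.1 h0
    omega
  · omega

/-- An admissible item adds an expression of value zero and an inadmissible one adds nothing. So the
data of the certificate need not be trusted. -/
theorem eval_addItem (hφ : IsEven φ) (hr : MapsRelations φ) (hN : 0 ≤ N)
    (hK : ∀ q ∈ known, pairDefect φ N q = 0) {tail D w : ℕ} (htail : tail ≤ 1) {H : ℤ}
    (hH : H = 4 * D + w - 6 + 8 * (N * tail)) (hv : VanishesBelow φ H)
    (m : List ℤ) (code : ℕ) (l : Comb) :
    Comb.eval (pairDefect φ N) N (addItem tail D w known m code l) =
      Comb.eval (pairDefect φ N) N l := by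
  have hN' : 0 ≤ N * tail := by positivity
  rw [addItem]
  cases Nat.blt code 48 with
  | true =>
    rw [cond_true]
    cases h : lowTrees (Nat.add (Nat.mul 4 D) w) (relTrees.getD code []) with
    | false => rfl
    | true =>
      rw [cond_true]
      have hlow := (lowTrees_iff _ _).1 h
      have hmem : relTrees.getD code [] = [] ∨ relTrees.getD code [] ∈ relTrees := by
        rw [List.getD_eq_getElem?_getD]
        by_cases hc : code < relTrees.length
        · rw [List.getElem?_eq_getElem hc]
          exact Or.inr (List.getElem_mem hc)
        · rw [List.getElem?_eq_none (not_lt.1 hc)]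
          exact Or.inl rfl
      rcases hmem with h0 | hmem
      · rw [h0]; rfl
      · rw [eval_addTrees hφ hK hv m (validTree_of_mem hmem), hr N _ hmem, evalTrees_of_mem N hmem,
          map_zero, sub_zero, smul_zero, zero_add]
        intro x hx
        have := hlow x hx
        change x.2.height + 6 ≤ 4 * D + w at this
        omega
  | false =>
    rw [cond_false, force_eq, force_eq, force_eq]
    have ha : Nat.mod code 512 < 512 := Nat.mod_lt _ (by norm_num)
    have hb : Nat.mod (Nat.div code 512) 512 < 512 := Nat.mod_lt _ (by norm_num)
    have hc : Nat.mod (Nat.div code 262144) 1024 < 1024 := Nat.mod_lt _ (by norm_num)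
    generalize Nat.mod code 512 = a at *
    generalize Nat.mod (Nat.div code 512) 512 = b at *
    generalize Nat.mod (Nat.div code 262144) 1024 = c at *
    cases h : validTriple tail D w a b c with
    | false => rfl
    | true =>
      rw [cond_true, force_eq]
      rw [validTriple] at h
      simp only [Bool.and_eq_true, Nat.beq_eq, Nat.ble_eq] at h
      obtain ⟨h1, h2, h3, h4, h5, h6⟩ := h
      change 2 * tail ≤ labDeg c at h4
      change labDeg a + labDeg b + labDeg c = D at h5
      change labWt a + labWt b + labWt c = w + 12 at h6
      have hadd : Nat.add c (Nat.mul 4096 tail) = c + 4096 * tail := rfl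
      rw [hadd]
      have va := mem_posPart_of_isLab h1 (by omega) N
      have vb := mem_posPart_of_isLab h2 (by omega) N
      have vc := posPart_basisVec_tail hN h3 (by omega) h4
      have ea := labHt_add_six h1
      have eb := labHt_add_six h2
      have ec := labHt_add_six h3
      -- The three labels have total height `H` and each of them positive height, so any two of them
      -- are covered by the induction hypothesis.
      exact eval_addJacobi hφ hK m (validKey_of_isLab h1 0) (validKey_of_isLab h2 0)
        (validKey_of_isLab h3 tail) (by omega) (by omega) (by omega)
        (hv _ _ (by omega) _ va _ vb) (hv _ _ (by omega) _ vb _ vc) (hv _ _ (by omega) _ va _ vc) l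

/-- Each step's combination has value zero for the actual defects; since it determines its target,
the target may be used as known in later steps. -/
theorem pairDefect_of_checkSteps (hφ : IsEven φ) (hr : MapsRelations φ) (hN : 0 ≤ N)
    {tail D w : ℕ} (htail : tail ≤ 1) {H : ℤ} (hH : H = 4 * D + w - 6 + 8 * (N * tail))
    (hv : VanishesBelow φ H) (steps : List (ℕ × List (List ℤ × ℕ)))
    (hK : ∀ q ∈ known, pairDefect φ N q = 0) (h : checkSteps tail D w known steps = true) :
    ∀ q ∈ known ++ steps.map Prod.fst, pairDefect φ N q = 0 := by
  induction steps generalizing known with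
  | nil => simpa using hK
  | cons s r ih =>
    rw [checkSteps, Bool.and_eq_true] at h
    have h0 : Comb.eval (pairDefect φ N) N (addItems tail D w known s.2) = 0 := by
      generalize s.2 = items
      induction items with
      | nil => rfl
      | cons x r ih => rw [addItems, eval_addItem hφ hr hN hK htail hH hv, ih]
    have ht := eq_zero_of_determines hN h.1 h0
    have := ih (known := s.1 :: known) (by simpa using ⟨ht, hK⟩) h.2
    intro q hq
    refine this q ?_
    simp only [List.map_cons, List.mem_append, List.mem_cons] at hq ⊢
    tauto

/-- A stage relies only on smaller heights and on its own initial pairs, never on other stages. So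
the one whose weight matches `H` can be used alone. -/
theorem pairDefect_of_checkStages (hφ : IsEven φ) (hr : MapsRelations φ) (hN : 0 ≤ N)
    {tail D : ℕ} (htail : tail ≤ 1) (w₀ i : ℕ) {H : ℤ}
    (hH : H = 4 * D + (w₀ + i : ℕ) - 6 + 8 * (N * tail)) (hv : VanishesBelow φ H) (l : List Stage)
    (hK : ∀ s ∈ l, ∀ q ∈ s.1, pairDefect φ N q = 0) (h : checkStages tail D w₀ l = true) :
    ∀ q ∈ (l.map knownPairs).getD i [], pairDefect φ N q = 0 := by
  induction l generalizing w₀ i with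
  | nil => simp
  | cons s l ih =>
    rw [checkStages, Bool.and_eq_true] at h
    cases i with
    | zero => exact pairDefect_of_checkSteps hφ hr hN htail hH hv s.2 (hK s (by simp)) h.1
    | succ i =>
      have := ih (w₀ + 1) i (by rw [hH]; push_cast; ring) (fun s hs => hK s (by simp [hs])) h.2
      simpa using this

theorem defect_of_hasPair (hφ : IsEven φ) (hK : ∀ q ∈ known, pairDefect φ N q = 0) {a b : ℕ}
    (ha : a < 8192) (hb : b < 8192) (h : hasPair known a b = true) :
    defect φ (basisVec N a) (basisVec N b) = 0 := by
  rw [hasPair] at h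
  cases hab : Nat.ble a b with
  | true =>
    rw [hab, cond_true, force_eq, Bool.or_eq_true] at h
    rw [← pairDefect_code φ N a hb]
    rcases h with h | h
    · exact pairDefect_of_trivialPair hφ N h
    · exact hK _ ((memNat_iff _ _).1 h)
  | false =>
    rw [hab, cond_false, force_eq] at h
    rw [defect_basisVec_skew hφ, ← pairDefect_code φ N b ha, hK _ ((memNat_iff _ _).1 h), smul_zero,
      neg_zero]

end Soundness

/-! ### The certificate -/

/-- The lists only propose multipliers of relations and Jacobi identities; the kernel replays them.
-/
theorem checkStages_zero : checkStages 0 0 0 stages0 = true := by decide +kernel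

theorem checkStages_one : checkStages 0 1 0 stages1 = true := by decide +kernel

theorem checkStages_two : checkStages 0 2 0 stages2 = true := by decide +kernel

theorem checkStages_three : checkStages 0 3 0 stages3 = true := by decide +kernel

theorem checkStages_four : checkStages 0 4 0 stages4 = true := by decide +kernel

/-- Here the coefficients are polynomials in `N`: this check settles all odd total degrees from five
on, and the next one all even degrees from six on. -/
theorem checkStages_five : checkStages 1 5 0 stages5 = true := by decide +kernel

theorem checkStages_six : checkStages 1 6 0 stages6 = true := by decide +kernel

theorem covers_zero : covers 0 0 stages0 = true := by decide +kernel

theorem covers_one : covers 0 1 stages1 = true := by decide +kernel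

theorem covers_two : covers 0 2 stages2 = true := by decide +kernel

theorem covers_three : covers 0 3 stages3 = true := by decide +kernel

theorem covers_four : covers 0 4 stages4 = true := by decide +kernel

theorem covers_five : covers 1 5 stages5 = true := by decide +kernel

theorem covers_six : covers 1 6 stages6 = true := by decide +kernel

/-- In low degrees the derivations may start only from pairs whose defect is zero by the table that
defines the map; in high degrees, by the next check, only from brackets with `t²`. -/
theorem definitional_stages : [stages0, stages1, stages2, stages3, stages4].all (fun l =>
    l.all fun s => s.1.all fun q => definitional defTable q) = true := by decide +kernel

theorem tailPair_stages : [stages5, stages6].all (fun l =>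
    l.all fun s => s.1.all fun q => tailPair q) = true := by decide +kernel

theorem validTable_defTable : validTable genKeys defTable = true := by decide +kernel

theorem correctTable_defTable : correctTable defTable = true := by decide +kernel

theorem mem_genKeys_or_defTable : (List.range 576).all (fun k =>
    !(isLab k && Nat.ble (labDeg k) 4) || memNat k genKeys || memNat k (defTable.map Prod.fst)) =
      true := by decide +kernel

/-! ### Generation -/

/-- Labels of low degree. -/
def IsLowLab (k : ℕ) : Prop := isLab k = true ∧ k < 576 ∧ labDeg k ≤ 4

theorem validItems_iff (known : List ℕ) (k : ℕ) (l : List (ℤ × ℕ)) :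
    validItems known k l = true ↔ ∀ x ∈ l, x.2 / 8192 ∈ known ∧ x.2 % 8192 ∈ known ∧
      labHt (x.2 / 8192) + labHt (x.2 % 8192) = labHt k ∧
      (bitCount (x.2 / 8192 % 64) + bitCount (x.2 % 8192 % 64)) % 2 = bitCount (k % 64) % 2 := by
  induction l with
  | nil => simp [validItems]
  | cons x l ih =>
    rw [validItems, List.forall_mem_cons, ← ih]
    simp only [Bool.and_eq_true, memNat_iff, Nat.beq_eq, and_assoc]

theorem validTable_cons {known : List ℕ} {x : ℕ × List (ℤ × ℕ)} {t : Table}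
    (h : validTable known (x :: t) = true) : x.1 ∉ known ∧ IsLowLab x.1 ∧
      validItems known x.1 x.2 = true ∧ validTable (x.1 :: known) t = true := by
  rw [validTable] at h
  simp only [Bool.and_eq_true, Bool.not_eq_true', ← Bool.not_eq_true (memNat _ _), memNat_iff,
    Nat.blt_eq, Nat.ble_eq] at h
  tauto

theorem items_of_validTable {known : List ℕ} {t : Table} (h : validTable known t = true)
    (hk : ∀ k ∈ known, IsLowLab k) : ∀ x ∈ t, IsLowLab x.1 ∧ ∀ y ∈ x.2,
      IsLowLab (y.2 / 8192) ∧ IsLowLab (y.2 % 8192) ∧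
        labHt (y.2 / 8192) + labHt (y.2 % 8192) = labHt x.1 := by
  induction t generalizing known with
  | nil => simp
  | cons x t ih =>
    obtain ⟨-, h1, h2, h3⟩ := validTable_cons h
    rw [validItems_iff] at h2
    have := ih h3 (by simpa using ⟨h1, hk⟩)
    rw [List.forall_mem_cons]
    exact ⟨⟨h1, fun y hy => ⟨hk _ (h2 y hy).1, hk _ (h2 y hy).2.1, (h2 y hy).2.2.1⟩⟩, this⟩

theorem isLowLab_genKeys : ∀ k ∈ genKeys, IsLowLab k := by
  have : ∀ k ∈ genKeys, isLab k = true ∧ k < 576 ∧ labDeg k ≤ 4 := by decide +kernel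
  exact this

theorem isLowLab_defTable : ∀ x ∈ defTable, IsLowLab x.1 ∧ ∀ y ∈ x.2,
    IsLowLab (y.2 / 8192) ∧ IsLowLab (y.2 % 8192) ∧
      labHt (y.2 / 8192) + labHt (y.2 % 8192) = labHt x.1 :=
  items_of_validTable validTable_defTable isLowLab_genKeys

theorem IsLowLab.validKey {k : ℕ} (h : IsLowLab k) : ValidKey k := validKey_of_isLab h.1 0

theorem IsLowLab.mem_posBasis {k : ℕ} (h : IsLowLab k) :
    basisVec 0 k ∈ posBasis (labDeg k) (labHt k) := by
  have := basisVec_mem_posBasis (e := 0) (N := 0) le_rfl h.1 (by have := h.2.1; omega) (by simp)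
  simpa using this

theorem eval_expandItems (N : ℤ) {l : Comb} {items : List (ℤ × ℕ)} (h : ∀ y ∈ items,
    ValidKey (y.2 / 8192) ∧ ValidKey (y.2 % 8192)) :
    Comb.eval (basisVec N) N (expandItems l items) =
      Comb.eval (fun q => contactBracket (basisVec N (q / 8192)) (basisVec N (q % 8192))) N
        (itemComb items) + Comb.eval (basisVec N) N l := by
  induction items with
  | nil => rw [expandItems, itemComb, Comb.eval_nil, zero_add]
  | cons x r ih =>
    have hx := h x (by simp)
    rw [expandItems, Comb.eval_insertAll, ih fun y hy => h y (by simp [hy]), itemComb,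
      Comb.eval_cons, eval_labBracket N hx.1 hx.2, add_assoc]

/-- The factor `12` is a common denominator, which keeps the entries of the table integral. -/
theorem basisVec_defTable : ∀ x ∈ defTable, (12 : ℂ) • basisVec 0 x.1 =
    Comb.eval (fun q => contactBracket (basisVec 0 (q / 8192)) (basisVec 0 (q % 8192))) 0
      (itemComb x.2) := by
  have h : ∀ t : Table, correctTable t = true → (∀ x ∈ t, ∀ y ∈ x.2,
      ValidKey (y.2 / 8192) ∧ ValidKey (y.2 % 8192)) → ∀ x ∈ t, (12 : ℂ) • basisVec 0 x.1 =
      Comb.eval (fun q => contactBracket (basisVec 0 (q / 8192)) (basisVec 0 (q % 8192))) 0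
        (itemComb x.2) := by
    intro t
    induction t with
    | nil => simp
    | cons x t ih =>
      intro h hv
      rw [correctTable, Bool.and_eq_true] at h
      rw [List.forall_mem_cons] at hv ⊢
      refine ⟨?_, ih h.2 hv.2⟩
      have := Comb.eval_eq_zero (basisVec 0) 0 h.1
      rw [eval_expandItems 0 hv.1, Comb.eval_cons, Comb.eval_nil] at this
      simp only [polyEval, mul_zero, add_zero, Int.cast_neg, Int.cast_ofNat, neg_smul] at this
      exact (eq_of_sub_eq_zero (by rw [← this]; abel)).symm
  refine h _ correctTable_defTable fun x hx y hy => ?_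
  have := (isLowLab_defTable x hx).2 y hy
  exact ⟨this.1.validKey, this.2.1.validKey⟩

/-- The weight contributes at least `-3`, which the factor four of the degree outweighs from degree
one on. In degree zero positivity is part of the definition. -/
theorem posBasis_height_pos {d h : ℤ} {f : Fn} (hf : f ∈ posBasis d h) : 0 < h := by
  have nonneg : 0 ≤ d := by
    rcases hf with ⟨n, S, hp, rfl, -⟩ | ⟨rfl, -⟩
    · exact hp.1
    · norm_num
  rcases hf with ⟨n, S, hp, rfl, rfl, rfl⟩ | ⟨rfl, rfl, rfl⟩
  · by_cases h0 : degree n S = 0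
    · exact hp.2.1 h0
    · obtain ⟨s, hs, rfl⟩ := exists_maskSet S
      obtain ⟨hw, hw3, -⟩ := sum_oddHeight_maskSet hs
      rw [degree, card_maskSet hs] at h0 nonneg
      rw [height]
      omega
  · norm_num

/-- The bracket with `t²` has no Poisson terms, so it maps a monomial to a multiple of the one with
an additional `t`. -/
theorem contactBracket_tsq (n : ℤ) (S : Finset (Fin 6)) : contactBracket (mono 2 ∅) (mono n S) =
    (2 * n + 2 * S.card - 4 : ℂ) • mono (n + 1) S := by
  have h0 : ∀ i, dOdd i (mono 2 ∅) = 0 := fun i => dOdd_mono_of_notMem _ (by simp)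
  rw [contactBracket_mono, mulFn_mono_of_disjoint _ _ (by simp), map_smul, tInv_mono]
  simp only [h0, map_zero, LinearMap.zero_apply, Finset.sum_const_zero, smul_zero, sub_zero,
    Finset.empty_union, Finset.card_empty]
  have h1 : invCount ∅ S = 0 := by simp [invCount_eq_sum]
  have h2 : 2 + n - 1 = n + 1 := by ring
  rw [h1, h2, pow_zero, one_smul]
  congr 1
  push_cast
  ring

theorem basisVec_384 (N : ℤ) : basisVec N 384 = mono 2 ∅ := by
  have h1 : maskSet (384 % 64) = ∅ := by decide
  rw [basisVec_of_ne N (by norm_num), rawVec, h1]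
  norm_num

theorem isLowLab_384 : IsLowLab 384 := by
  have : isLab 384 = true ∧ 384 < 576 ∧ labDeg 384 ≤ 4 := by decide
  exact this

/-- The positive part is generated by the elements with labels in `genKeys`. -/
theorem posPart_le {W : ℤ → Submodule ℂ Fn} (hg : ∀ g ∈ genKeys, basisVec 0 g ∈ W (labHt g))
    (hb : ∀ d h d' h', ∀ x ∈ posBasis d h, ∀ y ∈ posBasis d' h', x ∈ W h → y ∈ W h' →
      contactBracket x y ∈ W (h + h')) (h : ℤ) : posPart h ≤ W h := by
  have key : ∀ m : ℕ, ∀ h : ℤ, h < m → posPart h ≤ W h := by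
    intro m
    induction m with
    | zero =>
      intro h hm
      refine Submodule.span_le.2 fun f hf => ?_
      obtain ⟨d, hf⟩ := Set.mem_iUnion.1 hf
      have := posBasis_height_pos hf
      simp at hm
      omega
    | succ m ih =>
      intro h hm
      refine Submodule.span_le.2 fun f hf => ?_
      obtain ⟨d, hf⟩ := Set.mem_iUnion.1 hf
      have hbr : ∀ d₁ h₁ d₂ h₂, ∀ x ∈ posBasis d₁ h₁, ∀ y ∈ posBasis d₂ h₂, h₁ + h₂ = h →
          contactBracket x y ∈ W h := by
        intro d₁ h₁ d₂ h₂ x hx y hy hh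
        have p1 := posBasis_height_pos hx
        have p2 := posBasis_height_pos hy
        rw [← hh]
        refine hb d₁ h₁ d₂ h₂ x hx y hy (ih _ ?_ (posBasis_subset _ _ hx))
          (ih _ ?_ (posBasis_subset _ _ hy)) <;> push_cast at hm <;> omega
      -- Up to degree four the vector is a generator or has a table entry. Beyond that it is
      -- obtained from the bracket with `t²`, whose height is `8`.
      by_cases hd : d ≤ 4
      · have hd0 : 0 ≤ d := by
          rcases hf with ⟨n, S, hp, rfl, -⟩ | ⟨rfl, -⟩
          · exact hp.1
          · norm_num
        obtain ⟨s, hs, ha, had, hlt, hah, rfl⟩ := exists_label hf (N := 0) (e := 0) (d₀ := d.toNat)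
          le_rfl (by simp [hd0]) (by omega) (by simp)
        have ha' := (isLab_iff _).1 ha
        have had' := labDeg_eq (64 * exponentOf d.toNat s + s)
        generalize 64 * exponentOf d.toNat s + s = a at *
        simp only [mul_zero, add_zero, CharP.cast_eq_zero] at hah ⊢
        have key := List.all_eq_true.1 mem_genKeys_or_defTable a
          (List.mem_range.2 (by omega))
        have hble : Nat.ble (labDeg a) 4 = true := Nat.ble_eq_true_of_le (by omega)
        rw [ha, hble] at key
        simp only [Bool.and_true, Bool.not_true, Bool.false_or, Bool.or_eq_true, memNat_iff] at key
        rcases key with key | key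
        · rw [← hah]
          exact hg a key
        · obtain ⟨x, hx, rfl⟩ := List.mem_map.1 key
          have h12 : basisVec 0 x.1 = (12 : ℂ)⁻¹ • (12 : ℂ) • basisVec 0 x.1 := by
            rw [smul_smul]; norm_num
          rw [SetLike.mem_coe, h12, basisVec_defTable x hx]
          refine Submodule.smul_mem _ _ (Comb.eval_mem _ _ _ fun y hy => ?_)
          have hitems : ∀ l : List (ℤ × ℕ), ∀ y ∈ itemComb l, ∃ z ∈ l, z.2 = y.2 := by
            intro l
            induction l with
            | nil => simp [itemComb]
            | cons w l ih =>
              intro y hy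
              rw [itemComb, List.mem_cons] at hy
              rcases hy with rfl | hy
              · exact ⟨w, by simp, rfl⟩
              · obtain ⟨z, hz, h⟩ := ih y hy
                exact ⟨z, by simp [hz], h⟩
          obtain ⟨z, hz, hzy⟩ := hitems _ y hy
          obtain ⟨h1, h2, h3⟩ := (isLowLab_defTable x hx).2 z hz
          rw [hzy] at h1 h2 h3
          exact hbr _ _ _ _ _ h1.mem_posBasis _ h2.mem_posBasis (by omega)
      · rcases hf with ⟨n, S, hp, rfl, hh, rfl⟩ | ⟨rfl, -⟩
        swap
        · norm_num at hd
        have hS : S.card ≤ 6 := Finset.card_le_univ S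
        rw [degree] at hd
        have hz := isLowLab_384.mem_posBasis
        rw [basisVec_384] at hz
        have hd' : degree (n - 1) S = degree n S - 2 := by rw [degree, degree]; ring
        have hh' : height (n - 1) S = height n S - 8 := by rw [height, height]; ring
        -- The degree drops by two to at least three, where no monomial is excluded.
        have hv : mono (n - 1) S ∈ posBasis (degree (n - 1) S) (height (n - 1) S) := by
          refine Or.inl ⟨_, _, ⟨?_, fun h => ?_, fun h => ?_⟩, rfl, rfl, rfl⟩ <;>
            rw [hd', degree] at * <;> omega
        -- The number is the degree minus four plus the number of odd coordinates, hence positive.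
        have hc : (2 * n + 2 * S.card - 6 : ℂ) ≠ 0 := by
          have : (2 * n + 2 * S.card - 6 : ℤ) ≠ 0 := by omega
          exact_mod_cast this
        have e : mono n S = (2 * n + 2 * S.card - 6 : ℂ)⁻¹ •
            contactBracket (mono 2 ∅) (mono (n - 1) S) := by
          rw [contactBracket_tsq, smul_smul, sub_add_cancel]
          have : (2 * ((n - 1 : ℤ) : ℂ) + 2 * S.card - 4) = 2 * n + 2 * S.card - 6 := by
            push_cast; ring
          rw [this, inv_mul_cancel₀ hc, one_smul]
        rw [SetLike.mem_coe, e]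
        have h8 : (labHt 384 : ℤ) = 8 := rfl
        exact Submodule.smul_mem _ _ (hbr _ _ _ _ _ hz _ hv (by rw [h8, hh', ← hh]; ring))
  exact key (h + 1).toNat h (by omega)

/-! ### Construction of the homomorphism -/

section Construction

variable {M : Type u} [AddCommGroup M] [Module ℂ M] [LieSuperalgebra M]

/-- The table is triangular: an entry involves only earlier labels. Its values can be assigned one
after the other, without conditions on `M`, and parities are respected because each bracket in an
entry has the parity of the label. -/
theorem exists_table_solution (t : Table) (known : List ℕ) (h : validTable known t = true)
    (g : ℕ → M) (hg : ∀ k ∈ known, g k ∈ LieSuperalgebra.part (V := M) (bitCount (k % 64) : ZMod 2)) :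
    ∃ f : ℕ → M, (∀ k ∈ known, f k = g k) ∧
      (∀ k ∈ known ++ t.map Prod.fst,
        f k ∈ LieSuperalgebra.part (V := M) (bitCount (k % 64) : ZMod 2)) ∧
      ∀ x ∈ t, (12 : ℂ) • f x.1 =
        Comb.eval (fun q => ⁅f (q / 8192), f (q % 8192)⁆ₛ) 0 (itemComb x.2) := by
  induction t generalizing known g with
  | nil => exact ⟨g, fun _ _ => rfl, by simpa using hg, by simp⟩
  | cons x t ih =>
    obtain ⟨h1, -, h2, h3⟩ := validTable_cons h
    rw [validItems_iff] at h2
    -- The value that the entry forces on the new label. As the label is not among the known ones,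
    -- updating `g` there leaves the ingredients unchanged.
    let v : M := (12 : ℂ)⁻¹ • Comb.eval (fun q => ⁅g (q / 8192), g (q % 8192)⁆ₛ) 0 (itemComb x.2)
    have hupd : ∀ k ∈ known, Function.update g x.1 v k = g k := fun k hk =>
      Function.update_of_ne (fun e : k = x.1 => h1 (e ▸ hk)) _ _
    have hv : v ∈ LieSuperalgebra.part (V := M) (bitCount (x.1 % 64) : ZMod 2) := by
      refine Submodule.smul_mem _ _ ?_
      have hitems : ∀ l : List (ℤ × ℕ), (∀ y ∈ l, y.2 / 8192 ∈ known ∧ y.2 % 8192 ∈ known ∧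
          (bitCount (y.2 / 8192 % 64) + bitCount (y.2 % 8192 % 64)) % 2 =
            bitCount (x.1 % 64) % 2) →
          Comb.eval (fun q => ⁅g (q / 8192), g (q % 8192)⁆ₛ) 0 (itemComb l) ∈
            LieSuperalgebra.part (V := M) (bitCount (x.1 % 64) : ZMod 2) := by
        intro l
        induction l with
        | nil => exact fun _ => Submodule.zero_mem _
        | cons y l ih =>
          intro hl
          rw [List.forall_mem_cons] at hl
          refine Submodule.add_mem _ (Submodule.smul_mem _ _ ?_) (ih hl.2)
          have hpar : ((bitCount (x.1 % 64) : ℕ) : ZMod 2) =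
              (bitCount (y.2 / 8192 % 64) : ZMod 2) + (bitCount (y.2 % 8192 % 64) : ZMod 2) := by
            rw [← Nat.cast_add]
            exact (ZMod.natCast_eq_natCast_iff _ _ 2).2 hl.1.2.2.symm
          rw [hpar]
          exact LieSuperalgebra.bracket_mem (hg _ hl.1.1) (hg _ hl.1.2.1)
      exact hitems _ fun y hy => ⟨(h2 y hy).1, (h2 y hy).2.1, (h2 y hy).2.2.2⟩
    obtain ⟨f, hf1, hf2, hf3⟩ := ih (x.1 :: known) h3 (Function.update g x.1 v) (by
      rw [List.forall_mem_cons]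
      refine ⟨by rwa [Function.update_self], fun k hk => ?_⟩
      rw [hupd k hk]
      exact hg k hk)
    rw [List.forall_mem_cons] at hf1
    have hfg : ∀ k ∈ known, f k = g k := fun k hk => (hf1.2 k hk).trans (hupd k hk)
    refine ⟨f, hfg, fun k hk => hf2 k ?_, ?_⟩
    · simp only [List.map_cons, List.mem_append, List.mem_cons] at hk ⊢
      tauto
    · rw [List.forall_mem_cons]
      refine ⟨?_, hf3⟩
      rw [hf1.1, Function.update_self, smul_smul, mul_inv_cancel₀ (by norm_num), one_smul]
      have hitems : ∀ l : List (ℤ × ℕ), (∀ y ∈ l, y.2 / 8192 ∈ known ∧ y.2 % 8192 ∈ known) →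
          Comb.eval (fun q => ⁅g (q / 8192), g (q % 8192)⁆ₛ) 0 (itemComb l) =
          Comb.eval (fun q => ⁅f (q / 8192), f (q % 8192)⁆ₛ) 0 (itemComb l) := by
        intro l
        induction l with
        | nil => exact fun _ => rfl
        | cons y l ih =>
          intro hl
          rw [List.forall_mem_cons] at hl
          rw [itemComb, Comb.eval_cons, Comb.eval_cons, ih hl.2, hfg _ hl.1.1, hfg _ hl.1.2]
      exact hitems _ fun y hy => ⟨(h2 y hy).1, (h2 y hy).2.1⟩

/-- The number with bits in `S`. -/
def maskOf (S : Finset (Fin 6)) : ℕ := ∑ i ∈ S, 2 ^ (i : ℕ)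

theorem maskOf_lt (S : Finset (Fin 6)) : maskOf S < 64 := by
  revert S; decide +kernel

theorem maskSet_maskOf (S : Finset (Fin 6)) : maskSet (maskOf S) = S := by
  revert S; decide +kernel

theorem maskOf_maskSet {s : ℕ} (h : s < 64) : maskOf (maskSet s) = s := by
  have : ∀ s : Fin 64, maskOf (maskSet s) = s := by decide +kernel
  exact this ⟨s, h⟩

/-- The images of the monomials `t ^ (j - 2)` times a fixed odd monomial. -/
def extendSeq (f : ℕ → M) (s : ℕ) : ℕ → M
  | 0 => 0
  | j + 1 =>
    -- The index `j + 1` stands for the exponent `j - 1`, whose label has the exponent code `j + 3`;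
    -- the condition says that the degree is at most four.
    if 2 * j + bitCount s ≤ 8 then
      if isLab (64 * (j + 3) + s) then f (64 * (j + 3) + s) else 0
    else (2 * j + 2 * bitCount s - 8 : ℂ)⁻¹ • ⁅f 384, extendSeq f s j⁆ₛ

/-- The linear map with given values on the labels of low degree which is compatible with the
bracket with `t ^ 2` in high degrees. -/
def extendMap (f : ℕ → M) : Fn →ₗ[ℂ] M :=
  (Finsupp.linearCombination ℂ fun p => extendSeq f (maskOf p.2) (p.1 + 2).toNat :
    ((ℤ × Finset (Fin 6)) →₀ ℂ) →ₗ[ℂ] M)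

theorem extendMap_mono (f : ℕ → M) (n : ℤ) (S : Finset (Fin 6)) :
    extendMap f (mono n S) = extendSeq f (maskOf S) (n + 2).toNat := by
  have h := Finsupp.linearCombination_single ℂ
    (v := fun p : ℤ × Finset (Fin 6) => extendSeq f (maskOf p.2) (p.1 + 2).toNat) 1 (n, S)
  rw [one_smul] at h
  exact h

theorem mem_of_isLowLab {k : ℕ} (h : IsLowLab k) : k ∈ genKeys ++ defTable.map Prod.fst := by
  have key := List.all_eq_true.1 mem_genKeys_or_defTable k (List.mem_range.2 h.2.1)
  rw [h.1, Nat.ble_eq_true_of_le h.2.2] at key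
  simpa only [Bool.and_true, Bool.not_true, Bool.false_or, Bool.or_eq_true, memNat_iff,
    List.mem_append] using key

/-- Values on the labels of low degree that respect parity and the definitions. -/
structure IsSolution (f : ℕ → M) : Prop where
  mem_part : ∀ k, IsLowLab k → f k ∈ LieSuperalgebra.part (V := M) (bitCount (k % 64) : ZMod 2)
  table : ∀ x ∈ defTable, (12 : ℂ) • f x.1 =
    Comb.eval (fun q => ⁅f (q / 8192), f (q % 8192)⁆ₛ) 0 (itemComb x.2)

theorem exists_isSolution (g : ℕ → M)
    (hg : ∀ k ∈ genKeys, g k ∈ LieSuperalgebra.part (V := M) (bitCount (k % 64) : ZMod 2)) :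
    ∃ f : ℕ → M, IsSolution f ∧ ∀ k ∈ genKeys, f k = g k := by
  obtain ⟨f, h1, h2, h3⟩ := exists_table_solution defTable genKeys validTable_defTable g hg
  exact ⟨f, ⟨fun k hk => h2 k (mem_of_isLowLab hk), h3⟩, h1⟩

variable {f : ℕ → M}

/-- Low values have the right parity by assumption, and `t²` is even, so the recursion by brackets
with its image preserves parity. -/
theorem isEven_extendMap (hf : IsSolution f) : IsEven (extendMap f) := by
  intro n S
  rw [extendMap_mono]
  generalize (n + 2).toNat = j
  have hs := maskOf_lt S
  have hc : S.card = bitCount (maskOf S) := by rw [← card_maskSet hs, maskSet_maskOf]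
  rw [hc]
  generalize maskOf S = s at hs
  induction j with
  | zero => exact Submodule.zero_mem _
  | succ j ih =>
    rw [extendSeq]
    have e1 : (64 * (j + 3) + s) % 64 = s := by omega
    split_ifs with h1 h2
    · have := hf.mem_part (64 * (j + 3) + s) ⟨h2, by omega, by
        rw [labDeg_eq, e1]; omega⟩
      rwa [e1] at this
    · exact Submodule.zero_mem _
    · refine Submodule.smul_mem _ _ ?_
      have h0 : ((bitCount (384 % 64) : ℕ) : ZMod 2) = 0 := rfl
      have hz := hf.mem_part 384 isLowLab_384
      rw [h0] at hz
      have := LieSuperalgebra.bracket_mem hz ih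
      rwa [zero_add] at this

theorem basisVec_of_lt (N : ℤ) {a : ℕ} (h : a < 4096) : basisVec N a = basisVec 0 a := by
  have h1 : a / 4096 = 0 := by omega
  rw [basisVec, basisVec]
  split_ifs
  · simp [rawVec]
  · simp [rawVec, h1]

/-- For the label `282`, whose vector is a sum, the prescribed value sits on the first monomial. The
second one has no label of its own and is sent to zero, so the sum has the correct value. -/
theorem extendMap_basisVec (f : ℕ → M) (N : ℤ) {k : ℕ} (hk : IsLowLab k) :
    extendMap f (basisVec N k) = f k := by
  have key : ∀ k, k < 576 → 192 ≤ k → labDeg k ≤ 4 → extendMap f (rawVec 0 k) =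
      if isLab k then f k else 0 := by
    intro k hk h3 hd
    have hs : k % 64 < 64 := Nat.mod_lt _ (by norm_num)
    rw [labDeg_eq] at hd
    rw [rawVec, extendMap_mono, maskOf_maskSet hs]
    obtain ⟨j, hj⟩ : ∃ j, k / 64 = j + 3 := ⟨k / 64 - 3, by omega⟩
    have hm : k / 64 % 64 = j + 3 := by omega
    have e : ((k / 64 % 64 : ℕ) - 4 + 0 * (k / 4096 : ℕ) + 2 : ℤ).toNat = j + 1 := by
      rw [hm]; push_cast; omega
    have e2 : 64 * (j + 3) + k % 64 = k := by omega
    rw [e, extendSeq, e2, if_pos (by omega)]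
  have h3 := ((isLab_iff k).1 hk.1).1
  rw [basisVec_of_lt N (by have := hk.2.1; omega)]
  by_cases h : k = 282
  · subst h
    rw [basisVec, if_pos rfl, map_add, key 282 (by norm_num) (by norm_num) hk.2.2,
      key 300 (by norm_num) (by norm_num) (by decide), if_pos hk.1,
      if_neg (by decide), add_zero]
  · rw [basisVec_of_ne 0 h, key k hk.2.1 (by have := hk.2.1; omega) hk.2.2, if_pos hk.1]

/-- From degree three on the bracket with `t²` lands in degree at least five, where the map was
defined by this very bracket. -/
theorem defect_tsq (f : ℕ → M) {n : ℤ} {S : Finset (Fin 6)} (h : 3 ≤ degree n S) :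
    defect (extendMap f) (mono 2 ∅) (mono n S) = 0 := by
  have hS : S.card ≤ 6 := Finset.card_le_univ S
  have hz := extendMap_basisVec f 0 isLowLab_384
  rw [basisVec_384] at hz
  have hs := maskOf_lt S
  have hc : S.card = bitCount (maskOf S) := by rw [← card_maskSet hs, maskSet_maskOf]
  rw [degree] at h
  obtain ⟨j, hj⟩ : ∃ j : ℕ, n = j - 2 := ⟨(n + 2).toNat, by omega⟩
  subst hj
  have e1 : ((j : ℤ) - 2 + 2).toNat = j := by omega
  have e2 : ((j : ℤ) - 2 + 1 + 2).toNat = j + 1 := by omega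
  rw [defect_apply, contactBracket_tsq, map_smul, hz, extendMap_mono, extendMap_mono, e1, e2,
    extendSeq, if_neg (by omega), smul_smul, hc]
  have hne : (2 * j + 2 * bitCount (maskOf S) - 8 : ℂ) ≠ 0 := by
    have : (2 * j + 2 * bitCount (maskOf S) - 8 : ℤ) ≠ 0 := by omega
    exact_mod_cast this
  have e3 : (2 * (((j : ℤ) - 2 : ℤ) : ℂ) + 2 * bitCount (maskOf S) - 4) =
      2 * j + 2 * bitCount (maskOf S) - 8 := by push_cast; ring
  rw [e3, mul_inv_cancel₀ hne, one_smul, sub_self]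

theorem pairDefect_of_tailPair (f : ℕ → M) {N : ℤ} (hN : 0 ≤ N) {q : ℕ} (h : tailPair q = true) :
    pairDefect (extendMap f) N q = 0 := by
  rw [tailPair] at h
  simp only [Bool.and_eq_true, Nat.beq_eq, Nat.ble_eq] at h
  obtain ⟨⟨⟨h1, h2⟩, h3⟩, h4⟩ := h
  have e1 : q % 8192 = q % 4096 + 4096 * 1 := by omega
  have hs : q % 4096 % 64 < 64 := Nat.mod_lt _ (by norm_num)
  have hl := ((isLab_iff _).1 h3).2.2.1
  rw [pairDefect, h1, basisVec_384, e1, basisVec_of_ne N (by omega), rawVec_add N 1 (by omega)]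
  refine defect_tsq f ?_
  rw [labDeg_eq] at h4
  rw [degree, card_maskSet hs]
  push_cast
  omega

theorem lookup_mem {k : ℕ} {t : Table} (h : lookup k t ≠ []) : (k, lookup k t) ∈ t := by
  induction t with
  | nil => exact absurd rfl h
  | cons x t ih =>
    rw [lookup] at h ⊢
    cases hk : Nat.beq k x.1 with
    | true =>
      rw [cond_true, Nat.eq_of_beq_eq_true hk]
      exact List.mem_cons_self
    | false =>
      rw [hk] at h
      exact List.mem_cons_of_mem _ (ih h)

theorem eval_expandTable {V : Type v} [AddCommGroup V] [Module ℂ V] (F : ℕ → V) (t : Table)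
    (l c : Comb) : Comb.eval F 0 (expandTable t l c) =
      Comb.eval (fun k => Comb.eval F 0 (itemComb (lookup k t))) 0 c + Comb.eval F 0 l := by
  induction c with
  | nil => rw [expandTable, Comb.eval_nil, zero_add]
  | cons x c ih => rw [expandTable, Comb.eval_insertAll, ih, Comb.eval_cons, add_assoc]

/-- Replacing the labels in the bracket of the pair by their table entries gives formally twelve
times the pair. Since the map respects the table, twelve times the defect is zero. -/
theorem pairDefect_of_definitional (hf : IsSolution f) {q : ℕ}
    (h : definitional defTable q = true) : pairDefect (extendMap f) 0 q = 0 := by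
  rw [definitional] at h
  simp only [Bool.and_eq_true, Nat.blt_eq, Nat.ble_eq, List.all_eq_true] at h
  obtain ⟨⟨⟨⟨⟨⟨⟨h1, h2⟩, h3⟩, h4⟩, h5⟩, h6⟩, h7⟩, h8⟩ := h
  have la : IsLowLab (q / 8192) := ⟨h1, h3, h5⟩
  have lb : IsLowLab (q % 8192) := ⟨h2, h4, h6⟩
  have := Comb.eval_eq_zero (fun q => ⁅f (q / 8192), f (q % 8192)⁆ₛ) 0 h8
  rw [eval_expandTable] at this
  have hc : Comb.eval (fun k => Comb.eval (fun q => ⁅f (q / 8192), f (q % 8192)⁆ₛ) 0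
      (itemComb (lookup k defTable))) 0 (normalize (labBracket (q / 8192) (q % 8192))) =
      Comb.eval (fun k => ((12 : ℂ) • extendMap f) (basisVec 0 k)) 0
        (normalize (labBracket (q / 8192) (q % 8192))) := by
    refine Comb.eval_congr 0 fun x hx => ?_
    have hx := lookup_mem (k := x.2) (t := defTable) (by simpa using h7 x hx)
    have := hf.table _ hx
    rw [LinearMap.smul_apply, extendMap_basisVec f 0 (isLowLab_defTable _ hx).1]
    exact this.symm
  rw [hc, ← Comb.map_eval, Comb.eval_normalize, eval_labBracket 0 la.validKey lb.validKey,
    LinearMap.smul_apply] at this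
  simp only [Comb.eval, polyEval, mul_zero, add_zero] at this
  rw [pairDefect, defect_apply, extendMap_basisVec f 0 la, extendMap_basisVec f 0 lb]
  have h12 : (12 : ℂ) • (⁅f (q / 8192), f (q % 8192)⁆ₛ -
      extendMap f (contactBracket (basisVec 0 (q / 8192)) (basisVec 0 (q % 8192)))) = 0 := by
    rw [smul_sub, sub_eq_zero, ← sub_eq_zero, ← neg_eq_zero, ← this]
    push_cast
    module
  exact (smul_eq_zero.1 h12).resolve_left (by norm_num)

/-! ### The defect vanishes on the positive part -/

/-- A basis vector of the required degree has a label, and `covers` places its pair with the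
generator in the stage of the right weight. Generators have degree at most one, so `5 ≤ D` yields
the degree of at least four that shifted labels need. -/
theorem defect_gen_of_stages {φ : Fn →ₗ[ℂ] M} (hφ : IsEven φ) (hr : MapsRelations φ) {N : ℤ}
    (hN : 0 ≤ N) {tail D : ℕ} (htail : tail ≤ 1) (hD5 : tail = 1 → 5 ≤ D) (hD6 : D ≤ 6) {H : ℤ}
    (hv : VanishesBelow φ H) {l : List Stage} (hK : ∀ s ∈ l, ∀ q ∈ s.1, pairDefect φ N q = 0)
    (hs : checkStages tail D 0 l = true) (hc : covers tail D l = true) {g : ℕ} (hg : g ∈ genKeys)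
    {d h : ℤ} (hd : labDeg g + d = D + 2 * (N * tail)) (hh : labHt g + h = H) {y : Fn}
    (hy : y ∈ posBasis d h) : defect φ (basisVec 0 g) y = 0 := by
  have hgd : ∀ g ∈ genKeys, labDeg g ≤ 1 := by decide +kernel
  have hg1 := hgd g hg
  have hN' : 0 ≤ N * tail := by positivity
  have hd0 : 0 ≤ d := by
    rcases hy with ⟨n, S, hp, rfl, -⟩ | ⟨rfl, -⟩
    · exact hp.1
    · norm_num
  have hgl := isLowLab_genKeys g hg
  by_cases hle : labDeg g ≤ D
  swap
  · have : tail = 0 := by omega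
    subst this
    simp at hd
    omega
  obtain ⟨s, hs64, ha, had, hlt, hah, rfl⟩ := exists_label hy (N := N) (e := tail)
    (d₀ := D - labDeg g) hN (by omega) (by omega) (by omega)
  have hc := List.all_eq_true.1 (List.all_eq_true.1 hc g hg) s (List.mem_range.2 hs64)
  simp only [force_eq] at hc
  generalize 64 * exponentOf (D - labDeg g) s + s = v at *
  have hcond : (Nat.beq (labDeg v + labDeg g) D && isLab v) = true := by
    rw [ha, Bool.and_true, Nat.beq_eq]; omega
  rw [hcond, cond_true] at hc
  have e1 := labHt_add_six hgl.1
  have e2 := labHt_add_six ha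
  have e3 := hgl.2.1
  rw [← basisVec_of_lt N (by omega)]
  have hw : 6 ≤ labWt g + labWt v := by
    obtain ⟨-, h3, -⟩ := sum_oddHeight_maskSet (Nat.mod_lt g (show 0 < 64 by norm_num))
    obtain ⟨-, h3', -⟩ := sum_oddHeight_maskSet (Nat.mod_lt v (show 0 < 64 by norm_num))
    rw [labWt_mod] at h3 h3'
    omega
  exact defect_of_hasPair hφ (pairDefect_of_checkStages hφ hr hN htail 0
    (labWt g + labWt v - 6) (by omega) hv l hK hs) (by omega) (by omega) hc

theorem defect_gen (hf : IsSolution f) (hr : MapsRelations (extendMap f)) {H : ℤ}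
    (hv : VanishesBelow (extendMap f) H) {g : ℕ} (hg : g ∈ genKeys) {y : Fn}
    (hy : y ∈ posPart (H - labHt g)) : defect (extendMap f) (basisVec 0 g) y = 0 := by
  have hφ := isEven_extendMap hf
  have key : posPart (H - labHt g) ≤ LinearMap.ker (defect (extendMap f) (basisVec 0 g)) := by
    refine Submodule.span_le.2 fun y hy => ?_
    obtain ⟨d, hy⟩ := Set.mem_iUnion.1 hy
    rw [SetLike.mem_coe, LinearMap.mem_ker]
    have hd0 : 0 ≤ d := by
      rcases hy with ⟨n, S, hp, rfl, -⟩ | ⟨rfl, -⟩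
      · exact hp.1
      · norm_num
    have hlow : ∀ {D : ℕ} {l : List Stage}, l ∈ [stages0, stages1, stages2, stages3, stages4] →
        checkStages 0 D 0 l = true → covers 0 D l = true → D ≤ 6 → (labDeg g : ℤ) + d = D →
        defect (extendMap f) (basisVec 0 g) y = 0 := by
      intro D l hl h1 h2 h3 h4
      refine defect_gen_of_stages hφ hr le_rfl zero_le_one (by simp) h3 hv (fun s hs q hq => ?_)
        h1 h2 hg (by simpa using h4) (by ring) hy
      exact pairDefect_of_definitional hf (List.all_eq_true.1 (List.all_eq_true.1
        (List.all_eq_true.1 definitional_stages l hl) s hs) q hq)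
    have hhigh : ∀ {D : ℕ} {l : List Stage} {N : ℤ}, l ∈ [stages5, stages6] →
        checkStages 1 D 0 l = true → covers 1 D l = true → 5 ≤ D → D ≤ 6 → 0 ≤ N →
        (labDeg g : ℤ) + d = D + 2 * N → defect (extendMap f) (basisVec 0 g) y = 0 := by
      intro D l N hl h1 h2 h3 h3' hN h4
      refine defect_gen_of_stages hφ hr hN le_rfl (fun _ => h3) h3' hv (fun s hs q hq => ?_)
        h1 h2 hg (by simpa using h4) (by ring) hy
      exact pairDefect_of_tailPair f hN (List.all_eq_true.1 (List.all_eq_true.1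
        (List.all_eq_true.1 tailPair_stages l hl) s hs) q hq)
    obtain ⟨D, hD⟩ : ∃ D : ℕ, (labDeg g : ℤ) + d = D := ⟨(labDeg g + d).toNat, by omega⟩
    by_cases h4 : D ≤ 4
    · interval_cases D
      · exact hlow (by simp) checkStages_zero covers_zero (by norm_num) hD
      · exact hlow (by simp) checkStages_one covers_one (by norm_num) hD
      · exact hlow (by simp) checkStages_two covers_two (by norm_num) hD
      · exact hlow (by simp) checkStages_three covers_three (by norm_num) hD
      · exact hlow (by simp) checkStages_four covers_four (by norm_num) hD
    -- Total degrees above four are `6 + 2N` or `5 + 2N`, with `N = m - 3` or `N = m - 2`.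
    · rcases Nat.even_or_odd' D with ⟨m, hm | hm⟩
      · exact hhigh (N := m - 3) (by simp) checkStages_six covers_six (by norm_num) (by norm_num)
          (by omega) (by omega)
      · exact hhigh (N := m - 2) (by simp) checkStages_five covers_five (by norm_num) (by norm_num)
          (by omega) (by omega)
  exact key hy

theorem IsEven.exists_homPart {φ : Fn →ₗ[ℂ] M} (hφ : IsEven φ) {d h : ℤ} {x : Fn}
    (hx : x ∈ posBasis d h) : ∃ i, x ∈ homPart φ i := by
  rcases hx with ⟨n, S, -, -, -, rfl⟩ | ⟨-, -, rfl⟩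
  · exact ⟨_, hφ.mono_mem n S⟩
  · exact ⟨1, add_mem (hφ.mono_mem 0 {1, 3, 4}) (hφ.mono_mem 0 {2, 3, 5})⟩

/-- Induction on the total height. At height `H`, the first arguments with vanishing defect against
everything of complementary height include the generators by the certificate, and are closed under
brackets by `defect_jacobi`; generation then gives everything. -/
theorem vanishesBelow (hf : IsSolution f) (hr : MapsRelations (extendMap f)) (H : ℕ) :
    VanishesBelow (extendMap f) H := by
  have hφ := isEven_extendMap hf
  have hneg : ∀ h, h ≤ 0 → posPart h = ⊥ := by
    intro h hh
    rw [posPart, Submodule.span_eq_bot]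
    intro f hf
    obtain ⟨d, hf⟩ := Set.mem_iUnion.1 hf
    have := posBasis_height_pos hf
    omega
  induction H with
  | zero =>
    intro h h' hh x hx y hy
    by_cases h0 : h ≤ 0
    · rw [hneg h h0, Submodule.mem_bot] at hx
      rw [hx, map_zero, LinearMap.zero_apply]
    · rw [hneg h' (by simp at hh; omega), Submodule.mem_bot] at hy
      rw [hy, map_zero]
  | succ H ih =>
    have key : ∀ h, ∀ x ∈ posPart h, ∀ y ∈ posPart (H - h), defect (extendMap f) x y = 0 := by
      let W : ℤ → Submodule ℂ Fn := fun h =>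
        { carrier := {x | ∀ y ∈ posPart (H - h), defect (extendMap f) x y = 0}
          add_mem' := fun ha hb y hy => by
            rw [map_add, LinearMap.add_apply, ha y hy, hb y hy, add_zero]
          zero_mem' := fun y _ => by rw [map_zero, LinearMap.zero_apply]
          smul_mem' := fun c x hx y hy => by
            rw [map_smul, LinearMap.smul_apply, hx y hy, smul_zero] }
      refine fun h => posPart_le (W := W) (fun g hg y hy => defect_gen hf hr ih hg hy) ?_ h
      intro d h d' h' a ha b hb hWa hWb
      have ha0 := posBasis_height_pos ha
      have hb0 := posBasis_height_pos hb
      have hle : posPart (H - (h + h')) ≤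
          LinearMap.ker (defect (extendMap f) (contactBracket a b)) := by
        refine Submodule.span_le.2 fun y hy => ?_
        obtain ⟨d'', hy⟩ := Set.mem_iUnion.1 hy
        have hy0 := posBasis_height_pos hy
        obtain ⟨i, hi⟩ := hφ.exists_homPart ha
        obtain ⟨j, hj⟩ := hφ.exists_homPart hb
        obtain ⟨k, hk⟩ := hφ.exists_homPart hy
        have ma := posBasis_subset _ _ ha
        have mb := posBasis_subset _ _ hb
        have my := posBasis_subset _ _ hy
        -- The three heights add up to `H` and are positive, so each pair among `a`, `b` and `y`
        -- falls under the induction hypothesis.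
        have hj := defect_jacobi hi hj hk (ih _ _ (by omega) _ ma _ mb)
          (ih _ _ (by omega) _ mb _ my) (ih _ _ (by omega) _ ma _ my)
        have e1 : h' + (H - (h + h')) = H - h := by ring
        have e2 : h + (H - (h + h')) = H - h' := by ring
        rw [hWa _ (e1 ▸ contactBracket_mem_posPart mb my),
          hWb _ (e2 ▸ contactBracket_mem_posPart ma my), smul_zero, add_zero] at hj
        exact hj.symm
      exact fun y hy => hle hy
    intro h h' hh x hx y hy
    by_cases hlt : h + h' < H
    · exact ih h h' hlt x hx y hy
    · have : h' = H - h := by push_cast at hh; omega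
      subst this
      exact key h x hx y hy

/-- The positive part. -/
def posAlg : Submodule ℂ Fn := ⨆ h, posPart h

theorem posPart_le_posAlg (h : ℤ) : posPart h ≤ posAlg := le_iSup posPart h

theorem map_contactBracket_of_mem (hf : IsSolution f) (hr : MapsRelations (extendMap f)) {x y : Fn}
    (hx : x ∈ posAlg) (hy : y ∈ posAlg) :
    extendMap f (contactBracket x y) = ⁅extendMap f x, extendMap f y⁆ₛ := by
  refine map_contactBracket ?_
  have h1 : ∀ h, ∀ x ∈ posPart h, posAlg ≤ LinearMap.ker (defect (extendMap f) x) := by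
    intro h x hx
    refine iSup_le fun h' y hy => ?_
    exact vanishesBelow hf hr (h + h' + 1).toNat h h' (by omega) x hx y hy
  have h2 : posAlg ≤ LinearMap.ker ((defect (extendMap f)).flip y) :=
    iSup_le fun h x hx => h1 h x hx hy
  exact h2 hx

end Construction

/-! ### The relations -/

/-- The labels of the generators `Xᵢ`. -/
def keyX : Fin 4 → ℕ := ![328, 273, 290, 262]

/-- The labels of the generators `X̃ᵢ`. -/
def keyY : Fin 4 → ℕ := ![312, 245, 235, 207]

/-- The link between the relations as stated and the list of trees on which the certificate
operates. -/
theorem relations_iff {M : Type v} [AddCommGroup M] [Module ℂ M] [LieSuperalgebra M]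
    (x y : Fin 4 → M) (g : ℕ → M) (hx : ∀ i, g (keyX i) = x i) (hy : ∀ i, g (keyY i) = y i) :
    Relations x y ↔ ∀ r ∈ relTrees, evalTrees LieSuperalgebra.bracket g r = 0 := by
  have x0 : g 328 = x 0 := hx 0
  have x1 : g 273 = x 1 := hx 1
  have x2 : g 290 = x 2 := hx 2
  have x3 : g 262 = x 3 := hx 3
  have y0 : g 312 = y 0 := hy 0
  have y1 : g 245 = y 1 := hy 1
  have y2 : g 235 = y 2 := hy 2
  have y3 : g 207 = y 3 := hy 3
  simp only [relTrees, List.forall_mem_cons, evalTrees, Tree.eval, X0, X1, X2, X3, Y0, Y1, Y2, Y3,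
    x0, x1, x2, x3, y0, y1, y2, y3, Int.cast_one, one_smul, add_zero, Int.cast_neg,
    Int.cast_ofNat, neg_smul, ← sub_eq_add_neg, ← add_assoc, add_sub_assoc', List.not_mem_nil,
    false_imp_iff, implies_true, and_true, Relations, and_assoc]

/-- A function on labels with given values on the labels of the generators. -/
def genValue {M : Type v} [AddCommGroup M] (x y : Fin 4 → M) (k : ℕ) : M :=
  if k = 328 then x 0 else if k = 273 then x 1 else if k = 290 then x 2 else if k = 262 then x 3
  else if k = 312 then y 0 else if k = 245 then y 1 else if k = 235 then y 2
  else if k = 207 then y 3 else 0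

theorem genValue_keyX {M : Type v} [AddCommGroup M] (x y : Fin 4 → M) (i : Fin 4) :
    genValue x y (keyX i) = x i := by
  fin_cases i <;> simp [genValue, keyX]

theorem genValue_keyY {M : Type v} [AddCommGroup M] (x y : Fin 4 → M) (i : Fin 4) :
    genValue x y (keyY i) = y i := by
  fin_cases i <;> simp [genValue, keyY]

theorem forall_genKeys {p : ℕ → Prop} (hx : ∀ i, p (keyX i)) (hy : ∀ i, p (keyY i)) :
    ∀ k ∈ genKeys, p k := by
  have h : ∀ k ∈ genKeys, (∃ i, k = keyX i) ∨ ∃ i, k = keyY i := by decide +kernel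
  intro k hk
  rcases h k hk with ⟨i, rfl⟩ | ⟨i, rfl⟩
  · exact hx i
  · exact hy i

theorem basisVec_eq_mono {k : ℕ} (n : ℤ) (S : Finset (Fin 6)) (hk : k < 4096) (h : k ≠ 282)
    (hn : ((k / 64 % 64 : ℕ) : ℤ) - 4 = n) (hS : maskSet (k % 64) = S) :
    basisVec 0 k = mono n S := by
  have := rawVec_add 0 0 hk
  rw [mul_zero, add_zero] at this
  rw [basisVec_of_ne 0 h, this, hS, zero_mul, add_zero, hn]

theorem genX_eq (i : Fin 4) : genX i = contactField (basisVec 0 (keyX i)) := by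
  fin_cases i
  · exact congrArg contactField (basisVec_eq_mono 1 {eta 0} (by decide) (by decide) (by decide)
      (by decide)).symm
  · exact congrArg contactField (basisVec_eq_mono 0 {xi 0, eta 1} (by decide) (by decide)
      (by decide) (by decide)).symm
  · exact congrArg contactField (basisVec_eq_mono 0 {xi 1, eta 2} (by decide) (by decide)
      (by decide) (by decide)).symm
  · exact congrArg contactField (basisVec_eq_mono 0 {xi 1, xi 2} (by decide) (by decide)
      (by decide) (by decide)).symm

theorem genY_eq (i : Fin 4) : genY i = contactField (basisVec 0 (keyY i)) := by
  fin_cases i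
  · exact congrArg contactField (basisVec_eq_mono 0 {eta 0, eta 1, eta 2} (by decide) (by decide)
      (by decide) (by decide)).symm
  · exact congrArg contactField (basisVec_eq_mono (-1) {xi 0, xi 2, eta 1, eta 2} (by decide)
      (by decide) (by decide) (by decide)).symm
  · exact congrArg contactField (basisVec_eq_mono (-1) {xi 0, xi 1, eta 0, eta 2} (by decide)
      (by decide) (by decide) (by decide)).symm
  · exact congrArg contactField (basisVec_eq_mono (-1) {xi 0, xi 1, xi 2, eta 0} (by decide)
      (by decide) (by decide) (by decide)).symm

theorem coe_bracket_kLPos (x y : kLPos) :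
    (⁅x, y⁆ₛ : kLPos).1 = ⁅x.1, y.1⁆ₛ := rfl

/-- The trees of each relation already sum to zero for the contact bracket of functions; the map
`contactField` carries this over to operators. -/
theorem relations_pos : Relations posX posY := by
  rw [relations_iff posX posY (genValue posX posY) (genValue_keyX _ _) (genValue_keyY _ _)]
  have hg : ∀ k ∈ genKeys, (genValue posX posY k).1 = contactField (basisVec 0 k) := by
    refine forall_genKeys (fun i => ?_) fun i => ?_
    · rw [genValue_keyX]; exact genX_eq i
    · rw [genValue_keyY]; exact genY_eq i
  have ht : ∀ t : Tree, validTree t = true →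
      (t.eval LieSuperalgebra.bracket (genValue posX posY)).1 =
        contactField (t.eval contactBracket (basisVec 0)) := by
    intro t
    induction t with
    | gen i => exact fun h => hg i ((memNat_iff _ _).1 h)
    | br s t hs ht =>
      intro h
      obtain ⟨-, -, h3, h4⟩ := validTree_br h
      rw [Tree.eval, Tree.eval, coe_bracket_kLPos, hs h3, ht h4, bracket_contactField]
  have hr : ∀ r : List (ℤ × Tree), (∀ x ∈ r, validTree x.2 = true) →
      (evalTrees LieSuperalgebra.bracket (genValue posX posY) r).1 =
        contactField (evalTrees contactBracket (basisVec 0) r) := by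
    intro r
    induction r with
    | nil => exact fun _ => (map_zero contactField).symm
    | cons x r ih =>
      intro h
      rw [List.forall_mem_cons] at h
      rw [evalTrees, evalTrees, map_add, map_smul, ← ih h.2, ← ht x.2 h.1]
      rfl
  intro r hmem
  refine Subtype.ext ?_
  rw [hr r (validTree_of_mem hmem), evalTrees_of_mem 0 hmem, map_zero]
  rfl

/-! ### The algebra generated by the generators -/

theorem contactBracket_mem_posAlg {x y : Fn} (hx : x ∈ posAlg) (hy : y ∈ posAlg) :
    contactBracket x y ∈ posAlg := by
  have h1 : ∀ h, ∀ x ∈ posPart h, ∀ y ∈ posAlg, contactBracket x y ∈ posAlg := by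
    intro h x hx y hy
    refine Submodule.iSup_induction posPart (motive := fun y => contactBracket x y ∈ posAlg) hy
      (fun h' y hy => posPart_le_posAlg (h + h') (contactBracket_mem_posPart hx hy)) ?_ ?_
    · rw [map_zero]; exact Submodule.zero_mem _
    · intro a b ha hb
      rw [map_add]
      exact Submodule.add_mem _ ha hb
  refine Submodule.iSup_induction posPart (motive := fun x => contactBracket x y ∈ posAlg) hx
    (fun h x hx => h1 h x hx y hy) ?_ ?_
  · rw [map_zero]; exact Submodule.zero_mem _
  · intro a b ha hb
    rw [map_add]
    exact Submodule.add_mem _ ha hb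

/-- One inclusion holds because the positive part contains the generators and is closed under
brackets, the other because it is generated by them. -/
theorem kLPos_eq_map : kLPos = posAlg.map contactField := by
  have hmem : ∀ k ∈ genKeys, basisVec 0 k ∈ posAlg := fun k hk =>
    posPart_le_posAlg _ (posBasis_subset _ _ (isLowLab_genKeys k hk).mem_posBasis)
  have hX : ∀ i, keyX i ∈ genKeys := by decide
  have hY : ∀ i, keyY i ∈ genKeys := by decide
  refine le_antisymm (sInf_le ⟨?_, ?_⟩) ?_
  · rintro _ (⟨i, rfl⟩ | ⟨i, rfl⟩)
    · exact ⟨_, hmem _ (hX i), (genX_eq i).symm⟩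
    · exact ⟨_, hmem _ (hY i), (genY_eq i).symm⟩
  · rintro _ ⟨x, hx, rfl⟩ _ ⟨y, hy, rfl⟩
    exact ⟨_, contactBracket_mem_posAlg hx hy, (bracket_contactField x y).symm⟩
  · rw [Submodule.map_le_iff_le_comap]
    refine iSup_le fun h => posPart_le (W := fun _ => kLPos.comap contactField) ?_ ?_ h
    · refine forall_genKeys (fun i => ?_) fun i => ?_
      · rw [Submodule.mem_comap, ← genX_eq]
        exact subset_lieSpan _ (Or.inl ⟨i, rfl⟩)
      · rw [Submodule.mem_comap, ← genY_eq]
        exact subset_lieSpan _ (Or.inr ⟨i, rfl⟩)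
    · intro _ _ _ _ x _ y _ hx hy
      rw [Submodule.mem_comap, ← bracket_contactField]
      exact bracket_mem_lieSpan hx hy

/-- In degree zero the number of odd coordinates is even, so the weight is zero or a root `±εᵢ ±
εⱼ`. On roots, positivity of the first nonzero coordinate agrees with positivity on `(2, 1, 0)`. -/
theorem lex_weight_iff {n : ℤ} {S : Finset (Fin 6)} (h : 2 * n + (S.card : ℤ) - 2 = 0) :
    toLex (0 : Fin 3 → ℤ) < toLex (weight S) ↔ 0 < height n S := by
  have key : ∀ S : Finset (Fin 6), S.card % 2 = 0 →
      ((∃ i, (∀ j, j < i → (0 : ℤ) = weight S j) ∧ (0 : ℤ) < weight S i) ↔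
        0 < ∑ i ∈ S, oddHeight i - 4 * S.card) := by decide +kernel
  have e : height n S = ∑ i ∈ S, oddHeight i - 4 * S.card := by rw [height]; omega
  rw [e, ← key S (by omega)]
  rfl

/-- The basis was indexed by height; here it is regrouped by degree into degree zero, degree one and
the full components above. -/
theorem map_posAlg : posAlg.map contactField =
    nPlus ⊔ gOneSub ⊔ ⨆ d : ℤ, ⨆ _ : 2 ≤ d, kLGrade d := by
  apply le_antisymm
  · rw [Submodule.map_le_iff_le_comap]
    refine iSup_le fun h => Submodule.span_le.2 fun f hf => ?_
    obtain ⟨d, hf⟩ := Set.mem_iUnion.1 hf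
    rw [SetLike.mem_coe, Submodule.mem_comap]
    rcases hf with ⟨n, S, ⟨h0, h1, h2⟩, rfl, rfl, rfl⟩ | ⟨-, -, rfl⟩
    · by_cases hd : 2 ≤ degree n S
      · refine Submodule.mem_sup_right ?_
        have : kLGrade (degree n S) ≤ ⨆ d : ℤ, ⨆ _ : 2 ≤ d, kLGrade d :=
          le_iSup₂_of_le (degree n S) hd le_rfl
        exact this ⟨_, Submodule.subset_span ⟨n, S, rfl, rfl⟩, rfl⟩
      refine Submodule.mem_sup_left ?_
      by_cases hd0 : degree n S = 0
      · exact Submodule.mem_sup_left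
          ⟨_, Submodule.subset_span ⟨n, S, hd0, (lex_weight_iff hd0).2 (h1 hd0), rfl⟩, rfl⟩
      · have hd1 : degree n S = 1 := by omega
        have h3 := h2 hd1
        exact Submodule.mem_sup_right
          ⟨_, Submodule.subset_span (Or.inl ⟨n, S, hd1, h3.1, h3.2.1, h3.2.2, rfl⟩), rfl⟩
    · exact Submodule.mem_sup_left (Submodule.mem_sup_right
        ⟨_, Submodule.subset_span (Or.inr rfl), rfl⟩)
  · have hpos : ∀ {n S}, IsPositive n S → mono n S ∈ posAlg := fun {n S} h =>
      posPart_le_posAlg _ (posBasis_subset (degree n S) _ (Or.inl ⟨n, S, h, rfl, rfl, rfl⟩))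
    refine sup_le (sup_le ?_ ?_) (iSup₂_le fun d hd => ?_)
    · refine Submodule.map_mono (Submodule.span_le.2 ?_)
      rintro _ ⟨n, S, hd, hw, rfl⟩
      have hd' : degree n S = 0 := hd
      exact hpos ⟨hd'.ge, fun _ => (lex_weight_iff hd).1 hw, fun h => by omega⟩
    · refine Submodule.map_mono (Submodule.span_le.2 ?_)
      rintro _ (⟨n, S, hd, h1, h2, h3, rfl⟩ | rfl)
      · have hd' : degree n S = 1 := hd
        exact hpos ⟨by omega, fun h => by omega, fun _ => ⟨h1, h2, h3⟩⟩
      · exact posPart_le_posAlg 2 (posBasis_subset 1 _ (Or.inr ⟨rfl, rfl, rfl⟩))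
    · refine Submodule.map_mono (Submodule.span_le.2 ?_)
      rintro _ ⟨n, S, hd', rfl⟩
      have : degree n S = d := hd'
      exact hpos ⟨by omega, fun h => by omega, fun h => by omega⟩

/-! ### The homomorphism -/

section Hom

variable {M : Type u} [AddCommGroup M] [Module ℂ M]

theorem exists_of_mem_kLPos (x : kLPos) : ∃ u ∈ posAlg, contactField u = x.1 :=
  kLPos_eq_map.le x.2

theorem kLPos_le : kLPos ≤ LinearMap.range contactField := fun x hx => by
  obtain ⟨u, -, hu⟩ := exists_of_mem_kLPos ⟨x, hx⟩
  exact ⟨u, hu⟩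

/-- The linear map on the positive part induced by a linear map on functions. -/
def liftPos (φ : Fn →ₗ[ℂ] M) : kLPos →ₗ[ℂ] M :=
  φ ∘ₗ (LinearEquiv.ofInjective contactField contactField_injective).symm.toLinearMap ∘ₗ
    Submodule.inclusion kLPos_le

theorem liftPos_apply (φ : Fn →ₗ[ℂ] M) {x : kLPos} {u : Fn} (h : contactField u = x.1) :
    liftPos φ x = φ u := by
  have : (LinearEquiv.ofInjective contactField contactField_injective).symm
      (Submodule.inclusion kLPos_le x) = u := by
    rw [LinearEquiv.symm_apply_eq]
    exact Subtype.ext h.symm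
  exact congrArg φ this

variable [LieSuperalgebra M]

/-- Evenness is assumed on monomials only. A homogeneous function is split into its even and odd
monomials, and the part of the wrong parity vanishes because the parity components of operators are
disjoint. -/
theorem IsEven.map_mem {φ : Fn →ₗ[ℂ] M} (hφ : IsEven φ) {i : ZMod 2} {x : Fn}
    (hx : x ∈ fnPart i) : φ x ∈ LieSuperalgebra.part (V := M) i := by
  have hm : ∀ (j : ZMod 2) (x : Fn), x ∈ homPart φ j → x ∈ homPart φ 0 ⊔ homPart φ 1 := by
    intro j x hx
    rcases zmod2_cases j with rfl | rfl
    · exact Submodule.mem_sup_left hx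
    · exact Submodule.mem_sup_right hx
  have htop : x ∈ homPart φ 0 ⊔ homPart φ 1 := by
    clear hx
    induction x using Fn.induction with
    | h0 => exact Submodule.zero_mem _
    | ha _ _ h1 h2 => exact Submodule.add_mem _ h1 h2
    | hs c _ h => exact Submodule.smul_mem _ c h
    | hm n S => exact hm _ _ (hφ.mono_mem n S)
  obtain ⟨a, ha, b, hb, rfl⟩ := Submodule.mem_sup.1 htop
  have hdis := (LieSuperalgebra.isCompl (V := Module.End ℂ Fn)).1
  rw [Submodule.disjoint_def] at hdis
  have hz : ∀ y : Fn, y ∈ fnPart 0 → y ∈ fnPart 1 → y = 0 := fun y h0 h1 =>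
    contactField_injective ((hdis _ h0 h1).trans (map_zero _).symm)
  rcases zmod2_cases i with rfl | rfl
  · have : b ∈ fnPart 0 := by simpa using Submodule.sub_mem _ hx ha.1
    rw [hz b this hb.1, add_zero]
    exact ha.2
  · have : a ∈ fnPart 1 := by simpa using Submodule.sub_mem _ hx hb.1
    rw [hz a ha.1 this, zero_add]
    exact hb.2

/-- An even linear map that preserves brackets on the positive part gives a homomorphism. -/
def homOfMap (φ : Fn →ₗ[ℂ] M) (hφ : IsEven φ) (hb : ∀ x ∈ posAlg, ∀ y ∈ posAlg,
    φ (contactBracket x y) = ⁅φ x, φ y⁆ₛ) : LieSuperHom kLPos M where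
  toLinearMap := liftPos φ
  map_part i x hx := by
    obtain ⟨u, -, hu⟩ := exists_of_mem_kLPos x
    rw [liftPos_apply φ hu]
    refine hφ.map_mem ?_
    have : x.1 ∈ LieSuperalgebra.part (V := Module.End ℂ Fn) i := hx
    rwa [← hu] at this
  map_bracket x y := by
    obtain ⟨u, hu, hux⟩ := exists_of_mem_kLPos x
    obtain ⟨w, hw, hwy⟩ := exists_of_mem_kLPos y
    have h : contactField (contactBracket u w) = (⁅x, y⁆ₛ : kLPos).1 := by
      rw [coe_bracket_kLPos, ← hux, ← hwy, bracket_contactField]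
    rw [liftPos_apply φ h, liftPos_apply φ hux, liftPos_apply φ hwy, hb u hu w hw]

/-- The equaliser of two homomorphisms is closed under brackets, so it is everything once it
contains the generators. -/
theorem hom_ext_of_generators {φ ψ : LieSuperHom kLPos M}
    (hX : ∀ i, φ.toLinearMap (posX i) = ψ.toLinearMap (posX i))
    (hY : ∀ i, φ.toLinearMap (posY i) = ψ.toLinearMap (posY i)) : φ = ψ := by
  have hle : kLPos ≤ (LinearMap.eqLocus φ.toLinearMap ψ.toLinearMap).map kLPos.subtype := by
    refine sInf_le ⟨?_, ?_⟩
    · rintro _ (⟨i, rfl⟩ | ⟨i, rfl⟩)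
      · exact ⟨posX i, hX i, rfl⟩
      · exact ⟨posY i, hY i, rfl⟩
    · rintro _ ⟨x, hx, rfl⟩ _ ⟨y, hy, rfl⟩
      refine ⟨⁅x, y⁆ₛ, ?_, rfl⟩
      rw [SetLike.mem_coe, LinearMap.mem_eqLocus] at *
      rw [φ.map_bracket, ψ.map_bracket, hx, hy]
  have h : φ.toLinearMap = ψ.toLinearMap := by
    ext x
    obtain ⟨y, hy, hyx⟩ := hle x.2
    have : y = x := Subtype.ext hyx
    rwa [this] at hy
  cases φ
  cases ψ
  congr

/-- The parities of the given elements allow the table to be solved, and the relations start the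
derivations of the certificate; the resulting linear map then preserves all brackets in the positive
part. -/
theorem exists_hom (x y : Fin 4 → M)
    (hx : ∀ i, x i ∈ LieSuperalgebra.part (V := M) (genParity i))
    (hy : ∀ i, y i ∈ LieSuperalgebra.part (V := M) (genParity i)) (hr : Relations x y) :
    ∃ φ : LieSuperHom kLPos M,
      (∀ i, φ.toLinearMap (posX i) = x i) ∧ ∀ i, φ.toLinearMap (posY i) = y i := by
  obtain ⟨f, hf, hfg⟩ := exists_isSolution (genValue x y) (by
    refine forall_genKeys (fun i => ?_) fun i => ?_
    · have : ((bitCount (keyX i % 64) : ℕ) : ZMod 2) = genParity i := by revert i; decide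
      rw [genValue_keyX, this]
      exact hx i
    · have : ((bitCount (keyY i % 64) : ℕ) : ZMod 2) = genParity i := by revert i; decide
      rw [genValue_keyY, this]
      exact hy i)
  have hX : ∀ i, keyX i ∈ genKeys := by decide
  have hY : ∀ i, keyY i ∈ genKeys := by decide
  have hval : ∀ N, ∀ k ∈ genKeys, extendMap f (basisVec N k) = genValue x y k := fun N k hk => by
    rw [extendMap_basisVec f N (isLowLab_genKeys k hk), hfg k hk]
  have hrel : MapsRelations (extendMap f) := fun N =>
    (relations_iff x y (fun k => extendMap f (basisVec N k))
      (fun i => (hval N _ (hX i)).trans (genValue_keyX x y i))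
      (fun i => (hval N _ (hY i)).trans (genValue_keyY x y i))).1 hr
  refine ⟨homOfMap (extendMap f) (isEven_extendMap hf) fun u hu w hw =>
    map_contactBracket_of_mem hf hrel hu hw, fun i => ?_, fun i => ?_⟩
  · rw [← genValue_keyX x y i, ← hval 0 _ (hX i)]
    exact liftPos_apply _ (genX_eq i).symm
  · rw [← genValue_keyY x y i, ← hval 0 _ (hY i)]
    exact liftPos_apply _ (genY_eq i).symm

end Hom

end StringyContact

end

theorem mainTheorem8 :
    StringyContact.Relations StringyContact.posX StringyContact.posY ∧
    (∀ (M : Type u) [AddCommGroup M] [Module ℂ M] [StringyContact.LieSuperalgebra M] (x y : Fin 4 → M),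
      (∀ i, x i ∈ StringyContact.LieSuperalgebra.part (V := M) (StringyContact.genParity i)) →
      (∀ i, y i ∈ StringyContact.LieSuperalgebra.part (V := M) (StringyContact.genParity i)) →
      StringyContact.Relations x y →
      ∃! φ : StringyContact.LieSuperHom StringyContact.kLPos M,
        (∀ i, φ.toLinearMap (StringyContact.posX i) = x i) ∧ (∀ i, φ.toLinearMap (StringyContact.posY i) = y i)) ∧
    StringyContact.kLPos = StringyContact.nPlus ⊔ StringyContact.gOneSub ⊔ ⨆ d : ℤ, ⨆ _ : 2 ≤ d, StringyContact.kLGrade d := by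
  refine ⟨StringyContact.relations_pos, fun M _ _ _ x y hx hy hr => ?_,
    StringyContact.kLPos_eq_map.trans StringyContact.map_posAlg⟩
  obtain ⟨φ, h1, h2⟩ := StringyContact.exists_hom x y hx hy hr
  exact ⟨φ, ⟨h1, h2⟩, fun ψ h => StringyContact.hom_ext_of_generators
    (fun i => (h.1 i).trans (h1 i).symm) fun i => (h.2 i).trans (h2 i).symm⟩
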